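/- **Setting.** Let $n\ge 1$. A cube is a set $I=\prod_{i=1}^n[a_i,a_i+\ell)$ with $a\in\mathbb R^n$ and side length $\ell(I)=\ell>0$; for $m\in\mathbb Z^n$ let $I\dot+m:=I+\ell(I)m$. For an interval $J$ with left and right halves $J_+,J_-$ put $h^0_J=|J|^{-1/2}1_J$ and $h^1_J=|J|^{-1/2}(1_{J_+}-1_{J_-})$, and for a cube $I=I_1\times\dots\times I_n$ and $\theta\in\{0,1\}^n$ let $h_I^\theta(x)=\prod_i h^{\theta_i}_{I_i}(x_i)$. Let $\mathbb K\in\{\mathbb R,\mathbb C\}$ and let $\mathcal S$ be the $\mathbb K$-linear span of the indicators of all cubes. Let $T$ be a linear operator on $\mathcal S$, given through its pairings $\langle g,Tf\rangle\in\mathbb K$, which are bilinear in $f,g\in\mathcal S$. Assume that $T$ has the following two regularity properties, both of which every operator that is bounded on some $L^p(\mathbb R^n)$, $1<p<\infty$, has: * $\langle 1_J,T1_I\rangle$ is a continuous function of (the corner and the side length of) $I$ for fixed $J$, and of $J$ for fixed $I$; * $\lim_{k\to\infty}|Q_k|^{-2}\langle 1_{Q_k},T1_{Q_k}\rangle=0$,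 where $Q_k=[-2^k,2^k)^n$ (this follows for instance from the weak boundedness property $|\langle 1_Q,T1_Q\rangle|\lesssim|Q|$). The condition $T(1)=0$ means that $\sum_{m\in\mathbb Z^n}\langle h_I^\theta,T1_{I\dot+m}\rangle=0$ for all cubes $I$ and all $\theta\neq0$, and $T^*(1)=0$ means that $\sum_{m\in\mathbb Z^n}\langle 1_{I\dot+m},Th_I^\theta\rangle=0$ for all cubes $I$ and all $\theta\ne0$ (with absolute convergence of the series). A Banach space $X$ over $\mathbb K$ is UMD if for every $p\in(1,\infty)$ martingale difference sequences in $L^p(\Omega;X)$ are unconditional, with one finite constant for all probability spaces $\Omega$; $\beta_{p,X}$ denotes the unconditionality constant (for signs $\pm1$) of martingale differences in $L^p(\mathbb R^n;X)$. **Statement.** Let $X$ be a UMD space over $\mathbb K$ and $p\in(1,\infty)$. Let $T$ be as above, with $T(1)=T^*(1)=0$ and $$\sum_{m\in\mathbb Z^n}(1+\log^+|m|)\,\sup_I\big|\langle h^\eta_{I\dot+m},Th^\theta_I\rangle\big|\le C\qquad\text{for all }(\eta,\theta)\in\{0,1\}^{2n}\setminus\{(0,0)\},$$ where the supremum is over all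 cubes $I$ in $\mathbb R^n$. Then $T$ extends to a bounded linear operator $\widetilde T$ on $L^p(\mathbb R^n;X)$, that is, $\int g\,\widetilde T(f\otimes x)=\langle g,Tf\rangle\,x$ for all $f,g\in\mathcal S$ and $x\in X$, and $$\|\widetilde T\|_{\mathcal L(L^p(\mathbb R^n;X))}\le K\,\beta_{p,X}^2,$$ where $K$ depends only on $n$ and $C$. -/

import Mathlib

open MeasureTheory Filter Topology
open scoped ENNReal NNReal Real

namespace HaarT1

/-! ### Unconditional martingale differences -/

section UMD

/-- `β` bounds the `ε`-transforms of the difference sequence `f 0, f 1 - f 0, f 2 - f 1, …` of every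
martingale in `L^p(Ω, μ; X)`, uniformly over all signs and all finite lengths. The filtration is
`σ`-finite, so that the conditional expectations are the true ones also when `μ` is infinite. -/
def IsUnconditionalityBound {Ω : Type*} [MeasurableSpace Ω] (μ : Measure Ω) (p : ℝ≥0∞)
    (X : Type*) [NormedAddCommGroup X] [NormedSpace ℝ X] [CompleteSpace X] (β : ℝ≥0∞) : Prop :=
  ∀ (ℱ : Filtration ℕ ‹MeasurableSpace Ω›) (f : ℕ → Ω → X) (ε : ℕ → ℝ),
    SigmaFiniteFiltration μ ℱ → Martingale f ℱ μ → (∀ k, MemLp (f k) p μ) →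
    (∀ k, ε k = 1 ∨ ε k = -1) →
    ∀ N : ℕ,
      eLpNorm (ε 0 • f 0 + ∑ k ∈ Finset.range N, ε (k + 1) • (f (k + 1) - f k)) p μ
        ≤ β * eLpNorm (f N) p μ

/-- The unconditionality constant of martingale differences in `L^p(Ω, μ; X)`. -/
noncomputable def unconditionalityConst {Ω : Type*} [MeasurableSpace Ω] (μ : Measure Ω)
    (p : ℝ≥0∞) (X : Type*) [NormedAddCommGroup X] [NormedSpace ℝ X] [CompleteSpace X] : ℝ≥0∞ :=
  sInf {β | IsUnconditionalityBound μ p X β}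

/-- `X` is a UMD space: for every `p ∈ (1, ∞)`, martingale differences in `L^p(Ω, μ; X)` are
unconditional with a finite constant that is the same for all probability spaces. -/
def IsUMD (X : Type*) [NormedAddCommGroup X] [NormedSpace ℝ X] [CompleteSpace X] : Prop :=
  ∀ p : ℝ≥0∞, 1 < p → p < ∞ → ∃ β : ℝ≥0,
    ∀ (Ω : Type) [MeasurableSpace Ω] (μ : Measure Ω), IsProbabilityMeasure μ →
      IsUnconditionalityBound μ p X β

/-- `β_{p,X}`: the unconditionality constant of martingale differences in `L^p(ℝⁿ; X)`. -/
noncomputable def umdConst (n : ℕ) (p : ℝ≥0∞) (X : Type*) [NormedAddCommGroup X]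
    [NormedSpace ℝ X] [CompleteSpace X] : ℝ≥0∞ :=
  unconditionalityConst (volume : Measure (Fin n → ℝ)) p X

end UMD

/-! ### Cubes and Haar functions -/

/-- A cube `∏ᵢ [aᵢ, aᵢ + ℓ)` in `ℝⁿ`, given by its corner `a` and its side length `ℓ > 0`. -/
abbrev Cube (n : ℕ) : Type := (Fin n → ℝ) × Set.Ioi (0 : ℝ)

namespace Cube

variable {n : ℕ}

/-- The lower left corner. -/
def corner (I : Cube n) : Fin n → ℝ := I.1

/-- The side length `ℓ(I)`. -/
def side (I : Cube n) : ℝ := I.2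

lemma side_pos (I : Cube n) : 0 < I.side := I.2.2

/-- The cube as a subset of `ℝⁿ`. -/
def toSet (I : Cube n) : Set (Fin n → ℝ) :=
  {x | ∀ i, x i ∈ Set.Ico (I.corner i) (I.corner i + I.side)}

/-- The translate `I ∔ m = I + ℓ(I) m`. -/
def shift (I : Cube n) (m : Fin n → ℤ) : Cube n :=
  (fun i => I.corner i + I.side * m i, I.2)

/-- The cube `[-2^k, 2^k)ⁿ`. -/
noncomputable def centered (n k : ℕ) : Cube n :=
  (fun _ => -2 ^ k, ⟨2 * 2 ^ k, Set.mem_Ioi.2 (by positivity)⟩)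

/-- The `2ⁿ` dyadic children of a cube. -/
noncomputable def child (I : Cube n) (σ : Fin n → Fin 2) : Cube n :=
  (fun i => I.corner i + if σ i = 0 then 0 else I.side / 2,
    ⟨I.side / 2, half_pos I.side_pos⟩)

end Cube

section Haar

variable (𝕜 : Type*) [RCLike 𝕜]

/-- The indicator function `1_I` of a cube. -/
noncomputable def cubeIndicator {n : ℕ} (I : Cube n) : (Fin n → ℝ) → 𝕜 :=
  I.toSet.indicator 1

/-- The scalar step functions: finite linear combinations of indicators of cubes. -/
noncomputable def StepFun (n : ℕ) : Submodule 𝕜 ((Fin n → ℝ) → 𝕜) :=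
  Submodule.span 𝕜 (Set.range (cubeIndicator 𝕜 : Cube n → _))

/-- The one-dimensional functions `h⁰` and `h¹` of the interval `[a, a + ℓ)`:
`h⁰ = ℓ^{-1/2} 1_{[a, a + ℓ)}` and `h¹ = ℓ^{-1/2} (1_{[a, a + ℓ/2)} - 1_{[a + ℓ/2, a + ℓ)})`. -/
noncomputable def haarOne (θ : Fin 2) (a l t : ℝ) : 𝕜 :=
  ((Real.sqrt l)⁻¹ : ℝ) *
    if θ = 0 then (Set.Ico a (a + l)).indicator 1 t
    else (Set.Ico a (a + l / 2)).indicator 1 t - (Set.Ico (a + l / 2) (a + l)).indicator 1 t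

/-- The Haar function `h_I^θ(x) = ∏ᵢ h_{Iᵢ}^{θᵢ}(xᵢ)`, `θ ∈ {0,1}ⁿ`. -/
noncomputable def haarFun {n : ℕ} (θ : Fin n → Fin 2) (I : Cube n) (x : Fin n → ℝ) : 𝕜 :=
  ∏ i, haarOne 𝕜 (θ i) (I.corner i) I.side (x i)

variable {𝕜}

lemma cubeIndicator_mem {n : ℕ} (I : Cube n) : cubeIndicator 𝕜 I ∈ StepFun 𝕜 n :=
  Submodule.subset_span ⟨I, rfl⟩

lemma cubeIndicator_eq_prod {n : ℕ} (I : Cube n) (x : Fin n → ℝ) :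
    cubeIndicator 𝕜 I x
      = ∏ i, (Set.Ico (I.corner i) (I.corner i + I.side)).indicator (1 : ℝ → 𝕜) (x i) := by
  classical
  by_cases h : x ∈ I.toSet
  · rw [cubeIndicator, Set.indicator_of_mem h]
    refine (Finset.prod_eq_one fun i _ => ?_).symm
    rw [Set.indicator_of_mem (h i)]; rfl
  · rw [cubeIndicator, Set.indicator_of_notMem h]
    obtain ⟨i, hi⟩ := not_forall.1 h
    exact (Finset.prod_eq_zero (Finset.mem_univ i) (Set.indicator_of_notMem hi _)).symm

lemma haarOne_eq_sum (θ : Fin 2) {a l : ℝ} (hl : 0 < l) (t : ℝ) :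
    haarOne 𝕜 θ a l t = ∑ b : Fin 2,
      (((Real.sqrt l)⁻¹ : ℝ) * (if θ = 0 ∨ b = 0 then 1 else -1) : 𝕜) *
        (Set.Ico (a + if b = 0 then 0 else l / 2)
          ((a + if b = 0 then 0 else l / 2) + l / 2)).indicator (1 : ℝ → 𝕜) t := by
  have h2 : a + l / 2 + l / 2 = a + l := by ring
  have hU : (Set.Ico a (a + l)).indicator (1 : ℝ → 𝕜) t
      = (Set.Ico a (a + l / 2)).indicator 1 t
        + (Set.Ico (a + l / 2) (a + l)).indicator 1 t := by
    rw [← Set.Ico_union_Ico_eq_Ico (show a ≤ a + l / 2 by linarith)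
      (show a + l / 2 ≤ a + l by linarith), Set.indicator_union_of_disjoint]
    exact Set.Ico_disjoint_Ico_same
  rw [haarOne, hU]
  by_cases h : θ = 0
  · simp [Fin.sum_univ_two, h, h2]; ring
  · simp [Fin.sum_univ_two, h, h2]; ring

lemma haarFun_mem {n : ℕ} (θ : Fin n → Fin 2) (I : Cube n) :
    haarFun 𝕜 θ I ∈ StepFun 𝕜 n := by
  have key : haarFun 𝕜 θ I = ∑ σ : Fin n → Fin 2,
      (∏ i, (((Real.sqrt I.side)⁻¹ : ℝ) * (if θ i = 0 ∨ σ i = 0 then 1 else -1) : 𝕜)) •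
        cubeIndicator 𝕜 (I.child σ) := by
    funext x
    simp only [haarFun, haarOne_eq_sum _ I.side_pos, Finset.prod_univ_sum, Finset.sum_apply,
      Pi.smul_apply, smul_eq_mul, cubeIndicator_eq_prod, Fintype.piFinset_univ,
      Finset.prod_mul_distrib]
    rfl
  rw [key]
  exact Submodule.sum_mem _ fun σ _ => Submodule.smul_mem _ _ (cubeIndicator_mem _)

variable (𝕜)

/-- `1_I` as a step function. -/
noncomputable def ind {n : ℕ} (I : Cube n) : StepFun 𝕜 n := ⟨cubeIndicator 𝕜 I, cubeIndicator_mem I⟩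

/-- `h_I^θ` as a step function. -/
noncomputable def haar {n : ℕ} (θ : Fin n → Fin 2) (I : Cube n) : StepFun 𝕜 n :=
  ⟨haarFun 𝕜 θ I, haarFun_mem θ I⟩

end Haar

/-! ### Operators given by their pairings with step functions -/

section Operator

/-- A linear operator on step functions, with values in the functionals on step functions:
`T f g` is the pairing `⟨g, T f⟩`. The pairing is bilinear. -/
abbrev StepOperator (𝕜 : Type*) [RCLike 𝕜] (n : ℕ) : Type _ :=
  StepFun 𝕜 n →ₗ[𝕜] StepFun 𝕜 n →ₗ[𝕜] 𝕜

variable {𝕜 : Type*} [RCLike 𝕜] {n : ℕ}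

/-- Weak continuity: `⟨1_J, T 1_I⟩` depends continuously on the cube `I` for fixed `J`, and on the
cube `J` for fixed `I` (continuity in corner and side length). -/
def IsWeaklyContinuous (T : StepOperator 𝕜 n) : Prop :=
  (∀ J : Cube n, Continuous fun I : Cube n => T (ind 𝕜 I) (ind 𝕜 J)) ∧
    ∀ I : Cube n, Continuous fun J : Cube n => T (ind 𝕜 I) (ind 𝕜 J)

/-- `|Q|⁻² ⟨1_Q, T 1_Q⟩ → 0` for `Q = [-2^k, 2^k)ⁿ`, `k → ∞`. The volume of `Q` is `ℓ(Q)ⁿ`. -/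
def VanishesAtLargeScales (T : StepOperator 𝕜 n) : Prop :=
  Tendsto (fun k : ℕ =>
      T (ind 𝕜 (Cube.centered n k)) (ind 𝕜 (Cube.centered n k))
        / (((Cube.centered n k).side ^ n : ℝ) : 𝕜) ^ 2)
    atTop (𝓝 0)

/-- `T(1) = 0`: the pairing `⟨h_I^θ, T 1⟩ = ∑ₘ ⟨h_I^θ, T 1_{I ∔ m}⟩` vanishes for all cubes `I` and
all `θ ≠ 0`. -/
def AnnihilatesOne (T : StepOperator 𝕜 n) : Prop :=
  ∀ (I : Cube n) (θ : Fin n → Fin 2), θ ≠ 0 →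
    HasSum (fun m : Fin n → ℤ => T (ind 𝕜 (I.shift m)) (haar 𝕜 θ I)) 0

/-- `T*(1) = 0`, where `T*` is the transposed operator, `⟨f, T* g⟩ = ⟨g, T f⟩`. -/
def AdjointAnnihilatesOne (T : StepOperator 𝕜 n) : Prop :=
  AnnihilatesOne T.flip

/-- The Euclidean length `|m|` of `m ∈ ℤⁿ`. -/
noncomputable def latticeNorm (m : Fin n → ℤ) : ℝ := Real.sqrt (∑ i, (m i : ℝ) ^ 2)

/-- `∑ₘ (1 + log⁺ |m|) sup_I |⟨h_{I ∔ m}^η, T h_I^θ⟩| ≤ C` for all `(η, θ) ≠ (0, 0)`, with the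
supremum over all cubes `I`. -/
def HaarCoefficientBound (T : StepOperator 𝕜 n) (C : ℝ≥0) : Prop :=
  ∀ η θ : Fin n → Fin 2, (η, θ) ≠ (0, 0) →
    ∑' m : Fin n → ℤ, ENNReal.ofReal (1 + Real.posLog (latticeNorm m)) *
      ⨆ I : Cube n, ‖T (haar 𝕜 θ I) (haar 𝕜 η (I.shift m))‖ₑ ≤ C

lemma Cube.measurableSet_toSet (I : Cube n) : MeasurableSet I.toSet := by
  have : I.toSet = Set.univ.pi fun i => Set.Ico (I.corner i) (I.corner i + I.side) := by
    ext x; simp [Cube.toSet]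
  rw [this]
  exact MeasurableSet.univ_pi fun i => measurableSet_Ico

lemma Cube.volume_toSet_ne_top (I : Cube n) : volume I.toSet ≠ ∞ := by
  have : I.toSet = Set.univ.pi fun i => Set.Ico (I.corner i) (I.corner i + I.side) := by
    ext x; simp [Cube.toSet]
  rw [this, volume_pi_pi]
  exact ENNReal.prod_ne_top fun i _ => by simp

lemma StepFun.memLp_smul {X : Type*} [NormedAddCommGroup X] [NormedSpace 𝕜 X] (p : ℝ≥0∞)
    (f : StepFun 𝕜 n) (x : X) : MemLp (fun y => (f : (Fin n → ℝ) → 𝕜) y • x) p volume := by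
  obtain ⟨f, hf⟩ := f
  refine Submodule.span_induction (p := fun f _ => MemLp (fun y => f y • x) p volume)
    ?_ ?_ ?_ ?_ hf
  · rintro _ ⟨I, rfl⟩
    have h : (fun y => cubeIndicator 𝕜 I y • x) = I.toSet.indicator fun _ => x := by
      funext y
      by_cases hy : y ∈ I.toSet <;> simp [cubeIndicator, hy]
    rw [h]
    exact memLp_indicator_const p I.measurableSet_toSet x (Or.inr I.volume_toSet_ne_top)
  · simp
  · intro f g _ _ hf hg
    simpa [add_smul] using! hf.add hg
  · intro c f _ hf
    convert hf.const_smul c using 1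
    funext y
    simp [smul_smul]

/-- The elementary `X`-valued step function `f ⊗ x` as an element of `L^p(ℝⁿ; X)`. -/
noncomputable def tensorLp {X : Type*} [NormedAddCommGroup X] [NormedSpace 𝕜 X] (p : ℝ≥0∞)
    (f : StepFun 𝕜 n) (x : X) : Lp X p (volume : Measure (Fin n → ℝ)) :=
  (StepFun.memLp_smul p f x).toLp _

/-- The bounded operator `S` on `L^p(ℝⁿ; X)` extends `T`: `⟨g, S (f ⊗ x)⟩ = ⟨g, T f⟩ x` for all
scalar step functions `f`, `g` and all `x ∈ X`. -/
def IsBoundedExtension {X : Type*} [NormedAddCommGroup X] [NormedSpace ℝ X] [NormedSpace 𝕜 X]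
    {p : ℝ≥0∞} [Fact (1 ≤ p)] (T : StepOperator 𝕜 n)
    (S : Lp X p (volume : Measure (Fin n → ℝ)) →L[𝕜] Lp X p (volume : Measure (Fin n → ℝ))) :
    Prop :=
  ∀ (f g : StepFun 𝕜 n) (x : X),
    ∫ y, (g : (Fin n → ℝ) → 𝕜) y • (S (tensorLp p f x) : (Fin n → ℝ) → X) y = T f g • x

end Operator

end HaarT1

/-!
The operator is discretised at the scale `2^{-M}`: its matrix with respect to the cells of side
`2^{-M}` is a kernel on `ℤⁿ` (`cellKernel`), and all estimates take place on `ℤⁿ` with the counting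
measure, uniformly in `M` (`IsLatticeKernel.eLpNorm_le`).

On `ℤⁿ` the kernel is averaged over products of two cubes of side `2^k` of the same grid, and then
over all grids. The differences of consecutive averages split into parts that belong to pairs of
signatures `(η, θ) ≠ (0, 0)`, and the averages themselves tend to zero by the summability of the
Haar coefficients and the condition on centred cubes (`eq_sum_haarPart`,
`IsLatticeKernel.tendsto_gridAvg`). Each part is a series, over `m ∈ ℤⁿ`, of averages over all
grids of shift operators that map a Haar function of a cube to one of its `m`-th neighbour. For
`η = 0` or `θ = 0`, the conditions `T(1) = 0` and `T*(1) = 0` allow the non-cancellative function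
to be replaced by the difference of the indicator functions of the two cubes
(`hasSum_diffKernel`), which in turn is split into halves.

What remains is to bound one shift operator by `(1 + log⁺ |m|) β²`. A cube is good with respect to
a grid if it and its `m`-th neighbour have a common ancestor only about `log₂ |m|` generations up.
Every cube is good for a fixed proportion of the grids, so good cubes suffice (`average_shift_le`).
Sorting the generations into about `log₂ |m|` residue classes, and the cubes of one generation into
two colours, separates the pairs of cubes such that they form a tree (`good_shift_le`). There the
shift is a composition of two martingale transforms: the first one projects onto the span of the
functions `φ` of the cubes, the second one replaces each `φ` by the function `ψ` of the neighbour,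
by a change of the sign of `φ - ψ` in `φ = (φ + ψ) / 2 + (φ - ψ) / 2` (`IsShiftFamily.projection`,
`IsShiftFamily.transfer`). The latter requires that `(φ, ψ)` and `(ψ, φ)` have the same joint
distribution, which holds for the pairs of functions above. Martingale transforms on `ℤⁿ` are
bounded by `β_{p,X}` since they lift to `ℝⁿ` along the map to the unit cells
(`isDiscreteBound_umdConst`).

As `M → ∞`, the approximations of `T 1_Q`, for a dyadic cell `Q`, form a martingale that is bounded
in `L²`, by the estimate for scalar functions and `p = 2`. Its limit and Fatou's lemma yield the
extension on `L^p(ℝⁿ; X)` (`exists_extension_cells`), first for the pairings with dyadic cells, and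
by the continuity of `⟨1_J, T 1_I⟩` for all cubes (`isBoundedExtension_of_cells`).
-/

namespace HaarT1

/-! ### Martingale difference systems on a countable set -/

section DiffSystem

/-- A finite family `d α`, `α : ι`, of finitely supported functions on `G` that, together with the
initial function `e`, forms a martingale difference sequence when ordered by the level `lev α`; the
functions of one level may come in any order.

`R α a b` says that the points `a`, `b` are not separated before `d α` is added: all functions of
lower level and the other functions of the same level are constant along `R α`, and `d α` sums to
zero over every set that is invariant under `R α`. -/
structure IsDiffSystem {G X ι : Type*} [AddCommMonoid X] (lev : ι → ℕ) (Q : Finset G)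
    (R : ι → G → G → Prop) (e : G → X) (d : ι → G → X) : Prop where
  supp_init : ∀ a ∉ Q, e a = 0
  supp : ∀ α, ∀ a ∉ Q, d α a = 0
  rel : ∀ α a b, R α a b → a ∈ Q ∧ b ∈ Q
  const_init : ∀ α a b, R α a b → e a = e b
  const_lt : ∀ α α' a b, lev α < lev α' → R α' a b → d α a = d α b
  const_same : ∀ α α' a b, lev α = lev α' → α ≠ α' → R α' a b → d α a = d α b
  sum_zero : ∀ α (A : Set G), (∀ a b, R α a b → (a ∈ A ↔ b ∈ A)) →
    ∑ a ∈ Q, A.indicator (d α) a = 0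

lemma comp_eq_sum_indicator {G X Ω : Type*} [AddCommMonoid X] (φ : Ω → G) {Q : Finset G} {g : G → X}
    (hg : ∀ a ∉ Q, g a = 0) :
    g ∘ φ = fun ω => ∑ a ∈ Q, (φ ⁻¹' {a}).indicator (fun _ => g a) ω := by
  classical
  funext ω
  by_cases h : φ ω ∈ Q
  · rw [Finset.sum_eq_single (φ ω)]
    · simp
    · intro b _ hb
      simp [Set.indicator, hb.symm]
    · exact fun h' => absurd h h'
  · rw [Function.comp, hg _ h]
    refine (Finset.sum_eq_zero fun b hb => ?_).symm
    have : φ ω ≠ b := fun h' => h (h' ▸ hb)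
    simp [Set.indicator, this]

variable {G : Type*} [MeasurableSpace G] [MeasurableSingletonClass G]

variable (G) in
/-- `β` bounds the sign transforms of all finite martingale difference systems in `ℓ^p(G; X)`. -/
def IsDiscreteBound (p : ℝ≥0∞) (X : Type*) [NormedAddCommGroup X] [NormedSpace ℝ X]
    (β : ℝ≥0∞) : Prop :=
  ∀ (ι : Type) [Fintype ι] (lev : ι → ℕ) (Q : Finset G) (R : ι → G → G → Prop)
    (e : G → X) (d : ι → G → X) (ε : ι → ℝ), IsDiffSystem lev Q R e d →
    (∀ α, ε α = 1 ∨ ε α = -1) →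
    eLpNorm (e + ∑ α, ε α • d α) p Measure.count ≤ β * eLpNorm (e + ∑ α, d α) p Measure.count

variable {X : Type*} [NormedAddCommGroup X]

lemma memLp_comp_of_finite_support {Ω : Type*} [MeasurableSpace Ω] {μ : Measure Ω} {φ : Ω → G}
    (hφ : Measurable φ) (hμ : ∀ a, μ (φ ⁻¹' {a}) ≠ ∞) {Q : Finset G} {g : G → X}
    (hg : ∀ a ∉ Q, g a = 0) (p : ℝ≥0∞) : MemLp (g ∘ φ) p μ := by
  rw [comp_eq_sum_indicator φ hg]
  exact memLp_finsetSum _ fun a _ =>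
    memLp_indicator_const p (hφ (measurableSet_singleton a)) _ (Or.inr (hμ a))

lemma integral_comp_of_finite_support {Ω : Type*} [MeasurableSpace Ω] [NormedSpace ℝ X]
    {μ : Measure Ω} {φ : Ω → G}
    (hφ : Measurable φ) (hμ : ∀ a, μ (φ ⁻¹' {a}) ≠ ∞) {Q : Finset G} {g : G → X}
    (hg : ∀ a ∉ Q, g a = 0) [CompleteSpace X] :
    ∫ ω, g (φ ω) ∂μ = ∑ a ∈ Q, (μ.real (φ ⁻¹' {a})) • g a := by
  have h := comp_eq_sum_indicator φ hg
  change ∫ ω, (g ∘ φ) ω ∂μ = _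
  rw [h, integral_finsetSum]
  · exact Finset.sum_congr rfl fun a _ =>
      integral_indicator_const _ (hφ (measurableSet_singleton a))
  · intro a _
    exact (integrable_indicator_iff (hφ (measurableSet_singleton a))).2
      (integrableOn_const (hμ a))

/-- The sets that do not separate points related by `R α`, for the differences `α` of step at
least `k`. -/
@[reducible]
def invariantSets {ι : Type*} (step : ι → ℕ) (R : ι → G → G → Prop) (k : ℕ) :
    MeasurableSpace G where
  MeasurableSet' B := ∀ α, k ≤ step α → ∀ a b, R α a b → (a ∈ B ↔ b ∈ B)
  measurableSet_empty := by simp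
  measurableSet_compl B hB α hα a b hab := not_congr (hB α hα a b hab)
  measurableSet_iUnion f hf α hα a b hab := by
    simp only [Set.mem_iUnion]
    exact exists_congr fun i => hf i α hα a b hab

variable [Countable G]

/-- Martingale difference systems on `G` are pulled back to martingales along a map `φ : Ω → G`
whose fibres over the support have equal measure. -/
theorem IsUnconditionalityBound.comp_le {Ω : Type*} [MeasurableSpace Ω] {μ : Measure Ω}
    [NormedSpace ℝ X] [CompleteSpace X] {p β : ℝ≥0∞} (H : IsUnconditionalityBound μ p X β)
    {φ : Ω → G} (hφ : Measurable φ) (hμ : ∀ a, μ (φ ⁻¹' {a}) ≠ ∞)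
    {ι : Type*} [Fintype ι] {lev : ι → ℕ} {Q : Finset G} {R : ι → G → G → Prop}
    {e : G → X} {d : ι → G → X} {ε : ι → ℝ} {c : ℝ≥0∞} (hc : ∀ a ∈ Q, μ (φ ⁻¹' {a}) = c)
    (hd : IsDiffSystem lev Q R e d) (hε : ∀ α, ε α = 1 ∨ ε α = -1) :
    eLpNorm ((e + ∑ α, ε α • d α) ∘ φ) p μ ≤ β * eLpNorm ((e + ∑ α, d α) ∘ φ) p μ := by
  classical
  -- Each level takes two steps: first the differences with sign `1`, then those with sign `-1`.
  set step : ι → ℕ := fun α => 2 * lev α + if ε α = 1 then 0 else 1 with hstep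
  set g : ℕ → G → X := fun k => e + ∑ α with step α < k, d α with hgdef
  -- The σ-algebra at time `k` is pulled back from the sets that no later step separates.
  have hle : ∀ k, (invariantSets step R k).comap φ ≤ ‹MeasurableSpace Ω› := by
    rintro k _ ⟨B, -, rfl⟩
    exact hφ (Set.to_countable B).measurableSet
  let ℱ : Filtration ℕ ‹MeasurableSpace Ω› :=
    { seq := fun k => (invariantSets step R k).comap φ
      mono' := by
        intro k l hkl
        refine MeasurableSpace.comap_mono ?_
        exact fun B hB α hα => hB α (hkl.trans hα)
      le' := hle }
  have hgQ : ∀ k, ∀ a ∉ Q, g k a = 0 := by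
    intro k a ha
    simp [hgdef, hd.supp_init a ha, Finset.sum_apply, hd.supp _ a ha]
  have hgconst : ∀ k α, k ≤ step α → ∀ a b, R α a b → g k a = g k b := by
    intro k α hα a b hab
    simp only [hgdef, Pi.add_apply, Finset.sum_apply]
    rw [hd.const_init α a b hab]
    congr 1
    refine Finset.sum_congr rfl fun α' hα' => ?_
    have h1 : step α' < step α := lt_of_lt_of_le (Finset.mem_filter.1 hα').2 hα
    rcases lt_trichotomy (lev α') (lev α) with h | h | h
    · exact hd.const_lt α' α a b h hab
    · exact hd.const_same α' α a b h (fun h' => by simp [h'] at h1) hab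
    · simp only [hstep] at h1
      split_ifs at h1 <;> omega
  -- Outside `Q` every set is invariant, so that finite sets of points exhaust `Ω`.
  have hsf : SigmaFiniteFiltration μ ℱ := by
    constructor
    intro k
    obtain ⟨enc, henc⟩ := exists_injective_nat G
    have hfin : ∀ r : ℕ, ((Q : Set G) ∪ {a | enc a < r}).Finite := fun r =>
      Q.finite_toSet.union ((Set.finite_Iio r).preimage henc.injOn)
    have hmeas : ∀ r : ℕ, MeasurableSet[ℱ k] (φ ⁻¹' ((Q : Set G) ∪ {a | enc a < r})) := by
      intro r
      refine ⟨_, ?_, rfl⟩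
      intro α _ a b hab
      have := hd.rel α a b hab
      simp [this.1, this.2]
    refine ⟨⟨⟨fun r => φ ⁻¹' ((Q : Set G) ∪ {a | enc a < r}), fun _ => trivial, ?_, ?_⟩⟩⟩
    · intro r
      rw [trim_measurableSet_eq _ (hmeas r)]
      have hU : φ ⁻¹' ((Q : Set G) ∪ {a | enc a < r})
          = ⋃ a ∈ (hfin r).toFinset, φ ⁻¹' {a} := by ext; simp
      rw [hU]
      exact (measure_biUnion_finset_le _ _).trans_lt
        (ENNReal.sum_lt_top.2 fun a _ => (hμ a).lt_top)
    · refine Set.eq_univ_of_forall fun ω => Set.mem_iUnion.2 ⟨enc (φ ω) + 1, ?_⟩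
      simp
  have hadapt : StronglyAdapted ℱ (fun k => g k ∘ φ) := by
    intro k
    have hfin : (Set.range (g k)).Finite := by
      refine ((Q.finite_toSet.image (g k)).union (Set.finite_singleton 0)).subset ?_
      rintro _ ⟨a, rfl⟩
      by_cases ha : a ∈ Q
      · exact Or.inl ⟨a, ha, rfl⟩
      · exact Or.inr (hgQ k a ha)
    have : StronglyMeasurable[invariantSets step R k] (g k) :=
      @SimpleFunc.stronglyMeasurable _ _ (invariantSets step R k) _
        (@SimpleFunc.mk _ (invariantSets step R k) _ (g k)
        (fun x α hα a b hab => by simp [hgconst k α hα a b hab]) hfin)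
    exact this.comp_measurable (comap_measurable φ)
  have hmem : ∀ k q, MemLp (g k ∘ φ) q μ := fun k q =>
    memLp_comp_of_finite_support hφ hμ (hgQ k) q
  have hint : ∀ k, Integrable (g k ∘ φ) μ := fun k => memLp_one_iff_integrable.1 (hmem k 1)
  have hmart1 : ∀ i j, i ≤ j → ∀ B : Set G, MeasurableSet[invariantSets step R i] B →
      ∫ ω in φ ⁻¹' B, (g i ∘ φ) ω ∂μ = ∫ ω in φ ⁻¹' B, (g j ∘ φ) ω ∂μ := by
    intro i j hij B hB
    have hBm : MeasurableSet (φ ⁻¹' B) := hφ (Set.to_countable B).measurableSet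
    have key : ∀ k, ∫ ω in φ ⁻¹' B, (g k ∘ φ) ω ∂μ
        = c.toReal • ∑ a ∈ Q, B.indicator (g k) a := by
      intro k
      rw [← integral_indicator hBm]
      have h1 : (φ ⁻¹' B).indicator (g k ∘ φ) = fun ω => B.indicator (g k) (φ ω) := by
        ext ω; simp [Set.indicator]
      rw [h1, integral_comp_of_finite_support hφ hμ (Q := Q), Finset.smul_sum]
      · refine Finset.sum_congr rfl fun a ha => ?_
        rw [measureReal_def, hc a ha]
      · intro a ha
        simp [Set.indicator, hgQ k a ha]
    rw [key, key]
    congr 1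
    have hg' : ∀ k, ∑ a ∈ Q, B.indicator (g k) a
        = ∑ a ∈ Q, B.indicator e a + ∑ α with step α < k, ∑ a ∈ Q, B.indicator (d α) a := by
      intro k
      rw [Finset.sum_comm, ← Finset.sum_add_distrib]
      refine Finset.sum_congr rfl fun a _ => ?_
      by_cases ha : a ∈ B <;> simp [hgdef, ha]
    rw [hg', hg']
    congr 1
    refine Finset.sum_subset ?_ ?_
    · intro α hα
      simp only [Finset.mem_filter, Finset.mem_univ, true_and] at hα ⊢
      omega
    · intro α _ hα
      simp only [Finset.mem_filter, Finset.mem_univ, true_and, not_lt] at hα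
      exact hd.sum_zero α B fun a b hab => hB α hα a b hab
  have hmart : Martingale (fun k => g k ∘ φ) ℱ μ := by
    refine ⟨hadapt, fun i j hij => ?_⟩
    have := hsf.SigmaFinite i
    refine (ae_eq_condExp_of_forall_setIntegral_eq (ℱ.le i) (hint j)
      (fun _ _ _ => (hint i).integrableOn) ?_
      (hadapt i).aestronglyMeasurable).symm
    rintro _ ⟨B, hB, rfl⟩ _
    exact hmart1 i j hij B hB
  set N := (Finset.univ.sup step) + 1
  have hN : ∀ α, step α < N := fun α => Nat.lt_succ_of_le (Finset.le_sup (Finset.mem_univ α))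
  set δ : ℕ → ℝ := fun k => if k = 0 then 1 else if Even (k - 1) then 1 else -1 with hδ
  have hδ' : ∀ k, δ k = 1 ∨ δ k = -1 := by
    intro k
    simp only [hδ]
    split_ifs <;> simp
  have hδstep : ∀ α, δ (step α + 1) = ε α := by
    intro α
    simp only [hδ, hstep]
    rcases hε α with h | h
    · simp [h]
    · rw [h]
      norm_num [Nat.even_add, Nat.even_mul]
  have hfinal := H ℱ (fun k => g k ∘ φ) δ hsf hmart (fun k => hmem k p) hδ' N
  have hgN : g N = e + ∑ α, d α := by
    simp only [hgdef]
    congr 1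
    refine Finset.sum_congr (Finset.filter_true_of_mem fun α _ => hN α) fun _ _ => rfl
  have hlhs : δ 0 • (g 0 ∘ φ) + ∑ k ∈ Finset.range N, δ (k + 1) • (g (k + 1) ∘ φ - g k ∘ φ)
      = (e + ∑ α, ε α • d α) ∘ φ := by
    have hg0 : g 0 = e := by simp [hgdef]
    have hdiff : ∀ k, g (k + 1) ∘ φ - g k ∘ φ = (∑ α with step α = k, d α) ∘ φ := by
      intro k
      have hsplit : ∑ α with step α < k + 1, d α
          = ∑ α with step α < k, d α + ∑ α with step α = k, d α := by
        rw [← Finset.sum_union]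
        · refine Finset.sum_congr ?_ fun _ _ => rfl
          ext α
          simp only [Finset.mem_filter, Finset.mem_univ, true_and, Finset.mem_union]
          omega
        · refine Finset.disjoint_filter.2 fun α _ h => ?_
          omega
      funext ω
      simp only [hgdef, hsplit, Pi.sub_apply, Function.comp, Pi.add_apply]
      abel
    simp only [hdiff]
    funext ω
    have hδ0 : δ 0 = 1 := by simp [hδ]
    simp only [hg0, hδ0, one_smul, Pi.add_apply, Function.comp, Finset.sum_apply, Pi.smul_apply,
      Finset.smul_sum]
    congr 1
    have hmaps : ∀ α ∈ (Finset.univ : Finset ι), step α ∈ Finset.range N :=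
      fun α _ => Finset.mem_range.2 (hN α)
    rw [← Finset.sum_fiberwise_of_maps_to hmaps]
    refine Finset.sum_congr rfl fun k _ => Finset.sum_congr rfl fun α hα => ?_
    rw [← hδstep α, (Finset.mem_filter.1 hα).2]
  rw [hlhs] at hfinal
  simpa [hgN] using hfinal

end DiffSystem

/-! ### The dyadic grid and discrete norms -/

section Grid

lemma eLpNorm_count_of_support {G X : Type*} [MeasurableSpace G] [MeasurableSingletonClass G]
    [NormedAddCommGroup X] {p : ℝ≥0∞} (hp0 : p ≠ 0) (hp : p ≠ ∞) {Q : Finset G} {g : G → X}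
    (hg : ∀ a ∉ Q, g a = 0) :
    eLpNorm g p Measure.count = (∑ a ∈ Q, ‖g a‖ₑ ^ p.toReal) ^ (1 / p.toReal) := by
  rw [eLpNorm_eq_lintegral_rpow_enorm_toReal hp0 hp, lintegral_count, tsum_eq_sum (s := Q)]
  intro a ha
  rw [hg a ha, enorm_zero, ENNReal.zero_rpow_of_pos (ENNReal.toReal_pos hp0 hp)]

lemma eLpNorm_count_ne_top {G X : Type*} [MeasurableSpace G] [MeasurableSingletonClass G]
    [NormedAddCommGroup X] (p : ℝ≥0∞) {Q : Finset G} {g : G → X}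
    (hg : ∀ a ∉ Q, g a = 0) : eLpNorm g p Measure.count ≠ ∞ := by
  have := memLp_comp_of_finite_support (μ := Measure.count) (φ := (id : G → G)) measurable_id
    (by simp) hg p
  exact this.2.ne

variable {n : ℕ}

/-- The index of the dyadic cell of side `2^{-M}` that contains `y`. -/
noncomputable def gridMap (n M : ℕ) (y : Fin n → ℝ) : Fin n → ℤ := fun i => ⌊2 ^ M * y i⌋

/-- The dyadic cell `2^{-M} (a + [0, 1)ⁿ)`. -/
noncomputable def cell (M : ℕ) (a : Fin n → ℤ) : Cube n :=
  (fun i => a i / 2 ^ M, ⟨(2 ^ M)⁻¹, Set.mem_Ioi.2 (by positivity)⟩)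

lemma mem_cell {M : ℕ} {a : Fin n → ℤ} {y : Fin n → ℝ} :
    y ∈ (cell M a).toSet ↔ gridMap n M y = a := by
  have h2 : (0 : ℝ) < 2 ^ M := by positivity
  simp only [Cube.toSet, Set.mem_ofPred_eq, cell, Cube.corner, Cube.side, Set.mem_Ico, gridMap,
    funext_iff, Int.floor_eq_iff]
  refine forall_congr' fun i => ?_
  rw [div_le_iff₀ h2, ← one_div, ← add_div, lt_div_iff₀ h2, mul_comm]

lemma gridMap_preimage_singleton (M : ℕ) (a : Fin n → ℤ) :
    gridMap n M ⁻¹' {a} = (cell M a).toSet := by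
  ext y
  simp [mem_cell]

lemma measurable_gridMap (n M : ℕ) : Measurable (gridMap n M) :=
  measurable_pi_lambda _ fun i => ((measurable_pi_apply i).const_mul _).floor

lemma Cube.toSet_eq_pi (I : Cube n) :
    I.toSet = Set.univ.pi fun i => Set.Ico (I.corner i) (I.corner i + I.side) := by
  ext x; simp [Cube.toSet]

lemma Cube.volume_toSet (I : Cube n) : volume I.toSet = ENNReal.ofReal I.side ^ n := by
  rw [I.toSet_eq_pi, volume_pi_pi]
  simp

/-- The volume `2^{-Mn}` of a dyadic cell. -/
noncomputable def cellVol (n M : ℕ) : ℝ≥0∞ := ENNReal.ofReal ((2 ^ M)⁻¹) ^ n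

lemma cellVol_ne_zero (n M : ℕ) : cellVol n M ≠ 0 :=
  pow_ne_zero _ (ENNReal.ofReal_pos.2 (by positivity)).ne'

lemma cellVol_toReal (n M : ℕ) : (cellVol n M).toReal = ((2 ^ M) ^ n)⁻¹ := by
  rw [cellVol, ENNReal.toReal_pow, ENNReal.toReal_ofReal (by positivity), inv_pow]

lemma volume_cell (M : ℕ) (a : Fin n → ℤ) : volume (cell M a).toSet = cellVol n M := by
  rw [Cube.volume_toSet]; rfl

lemma map_gridMap_volume (n M : ℕ) :
    (volume : Measure (Fin n → ℝ)).map (gridMap n M) = cellVol n M • Measure.count := by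
  refine Measure.ext_of_singleton fun a => ?_
  rw [Measure.map_apply (measurable_gridMap n M) (measurableSet_singleton a),
    gridMap_preimage_singleton, volume_cell]
  simp

lemma eLpNorm_comp_gridMap {X : Type*} [NormedAddCommGroup X] (p : ℝ≥0∞) (M : ℕ)
    (g : (Fin n → ℤ) → X) : eLpNorm (g ∘ gridMap n M) p volume
      = cellVol n M ^ (1 / p).toReal * eLpNorm g p Measure.count := by
  rw [← eLpNorm_map_measure StronglyMeasurable.of_discrete.aestronglyMeasurable
    (measurable_gridMap n M).aemeasurable, map_gridMap_volume,
    eLpNorm_smul_measure_of_ne_zero (cellVol_ne_zero n M), smul_eq_mul]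

end Grid

/-! ### Bounds for discrete martingale difference systems -/

section DiscreteBounds

lemma IsDiffSystem.sum_eq_zero {G X ι : Type*} [AddCommMonoid X] {lev : ι → ℕ} {Q : Finset G}
    {R : ι → G → G → Prop} {e : G → X} {d : ι → G → X} (hd : IsDiffSystem lev Q R e d)
    [Fintype ι] (ε : ι → X → X) (hε : ∀ α, ε α 0 = 0) :
    ∀ a ∉ Q, (e + ∑ α, fun b => ε α (d α b)) a = 0 := by
  intro a ha
  simp [hd.supp_init a ha, Finset.sum_apply, hd.supp _ a ha, hε]

lemma isDiscreteBound_umdConst (n : ℕ) (p : ℝ≥0∞) (X : Type*) [NormedAddCommGroup X]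
    [NormedSpace ℝ X] [CompleteSpace X] {β₀ : ℝ≥0∞} (hβ₀ : IsDiscreteBound (Fin n → ℤ) p X β₀) :
    IsDiscreteBound (Fin n → ℤ) p X (umdConst n p X) := by
  intro ι _ lev Q R e d ε hd hε
  have hfin : eLpNorm (e + ∑ α, d α) p Measure.count ≠ ∞ :=
    eLpNorm_count_ne_top p (hd.sum_eq_zero (fun _ x => x) fun _ => rfl)
  have key : ∀ β : ℝ≥0∞, IsUnconditionalityBound (volume : Measure (Fin n → ℝ)) p X β →
      eLpNorm (e + ∑ α, ε α • d α) p Measure.count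
        ≤ β * eLpNorm (e + ∑ α, d α) p Measure.count := by
    intro β hβ
    have h := hβ.comp_le (measurable_gridMap n 0)
      (fun a => by rw [gridMap_preimage_singleton]; exact Cube.volume_toSet_ne_top _)
      (fun a _ => by rw [gridMap_preimage_singleton, volume_cell]) hd hε
    rw [eLpNorm_comp_gridMap, eLpNorm_comp_gridMap] at h
    simpa [cellVol] using h
  -- If `umdConst` is infinite, the bound still has content when the right-hand norm vanishes.
  rcases eq_or_ne (eLpNorm (e + ∑ α, d α) p Measure.count) 0 with h0 | h0
  · simpa [h0] using hβ₀ ι lev Q R e d ε hd hε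
  rw [← ENNReal.div_le_iff h0 hfin, umdConst, unconditionalityConst]
  exact le_sInf fun β hβ => (ENNReal.div_le_iff h0 hfin).2 (key β hβ)

lemma IsUMD.exists_isDiscreteBound {X : Type*} [NormedAddCommGroup X]
    [NormedSpace ℝ X] [CompleteSpace X] (hX : IsUMD X) (n : ℕ) {p : ℝ≥0∞} (hp1 : 1 < p)
    (hp : p < ∞) : ∃ β : ℝ≥0, IsDiscreteBound (Fin n → ℤ) p X β := by
  obtain ⟨β, hβ⟩ := hX p hp1 hp
  refine ⟨β, fun ι _ lev Q R e d ε hd hε => ?_⟩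
  have h1 : ∀ a ∉ Q, (e + ∑ α, ε α • d α) a = 0 := hd.sum_eq_zero (fun α x => ε α • x) (by simp)
  have h2 : ∀ a ∉ Q, (e + ∑ α, d α) a = 0 := hd.sum_eq_zero (fun _ x => x) fun _ => rfl
  rcases Q.eq_empty_or_nonempty with rfl | hQ
  · have : (e + ∑ α, ε α • d α) = 0 := funext fun a => h1 a (by simp)
    rw [this]
    simp
  set c : ℝ≥0∞ := (Q.card : ℝ≥0∞)⁻¹ with hc
  have hQ0 : (Q.card : ℝ≥0∞) ≠ 0 := by simpa using hQ.ne_empty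
  have hc0 : c ≠ 0 := by simp [hc]
  have hct : c ≠ ∞ := by simpa [hc] using hQ.ne_empty
  set μ : Measure (Fin n → ℤ) := c • (Measure.count.restrict (Q : Set (Fin n → ℤ))) with hμ
  have hprob : IsProbabilityMeasure μ := by
    constructor
    rw [hμ, Measure.smul_apply, Measure.restrict_apply_univ, Measure.count_apply_finset,
      smul_eq_mul]
    exact ENNReal.inv_mul_cancel hQ0 (by simp)
  have h := (hβ (Fin n → ℤ) μ hprob).comp_le (φ := id) measurable_id
    (fun a => measure_ne_top μ _) (c := c) (fun a ha => by
      have : ({a} : Set (Fin n → ℤ)) ∩ Q = {a} := by simpa using ha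
      simp [hμ, Measure.restrict_apply, this]) hd hε
  have hres : ∀ g : (Fin n → ℤ) → X, (∀ a ∉ Q, g a = 0) →
      eLpNorm (g ∘ id) p μ = c ^ (1 / p).toReal * eLpNorm g p Measure.count := by
    intro g hg
    rw [hμ, eLpNorm_smul_measure_of_ne_zero hc0, smul_eq_mul, Function.comp_id,
      eLpNorm_restrict_eq_of_support_subset]
    intro a ha
    by_contra h'
    exact ha (hg a h')
  rw [hres _ h1, hres _ h2, mul_left_comm] at h
  refine (ENNReal.mul_le_mul_iff_right ?_ ?_).1 h
  · exact (ENNReal.rpow_pos (pos_iff_ne_zero.2 hc0) hct).ne'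
  · exact ENNReal.rpow_ne_top_of_nonneg ENNReal.toReal_nonneg hct

/-- Martingale differences are orthogonal in `ℓ²`. -/
lemma isDiscreteBound_two (G 𝕜 : Type*) [RCLike 𝕜] [MeasurableSpace G]
    [MeasurableSingletonClass G] : IsDiscreteBound G 2 𝕜 1 := by
  classical
  intro ι _ lev Q R e d ε hd hε
  -- functions that are constant along `R α` are orthogonal to `d α`
  have orth : ∀ α (h : G → 𝕜), (∀ a b, R α a b → h a = h b) → ∑ a ∈ Q, h a * d α a = 0 := by
    intro α h hh
    have hmaps : ∀ a ∈ Q, h a ∈ Q.image h := fun a ha => Finset.mem_image_of_mem h ha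
    rw [← Finset.sum_fiberwise_of_maps_to hmaps]
    refine Finset.sum_eq_zero fun v _ => ?_
    have := hd.sum_zero α {a | h a = v} fun a b hab => by simp [hh a b hab]
    rw [Finset.sum_congr rfl (g := fun a => v * d α a)
      (fun a ha => by rw [(Finset.mem_filter.1 ha).2]), ← Finset.mul_sum, Finset.sum_filter]
    simp only [Set.indicator, Set.mem_ofPred_eq] at this
    exact mul_eq_zero_of_right _ (by convert this)
  set F : Option ι → G → 𝕜 := fun o => o.elim e d with hF
  have cross : ∀ o o' : Option ι, o ≠ o' → ∑ a ∈ Q, F o a * (starRingEnd 𝕜) (F o' a) = 0 := by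
    have half : ∀ (o : Option ι) (α : ι), o ≠ some α →
        (∀ a b, R α a b → F o a = F o b) → ∑ a ∈ Q, F o a * (starRingEnd 𝕜) (F (some α) a) = 0 := by
      intro o α _ h
      have := orth α (fun a => (starRingEnd 𝕜) (F o a)) (fun a b hab => by rw [h a b hab])
      rw [← map_eq_zero (starRingEnd 𝕜), map_sum]
      simpa [hF] using this
    have symm : ∀ o o', ∑ a ∈ Q, F o a * (starRingEnd 𝕜) (F o' a) = 0 →
        ∑ a ∈ Q, F o' a * (starRingEnd 𝕜) (F o a) = 0 := by
      intro o o' h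
      rw [← map_eq_zero (starRingEnd 𝕜), map_sum]
      simpa [mul_comm] using h
    rintro (_ | α) (_ | α') hne
    · exact absurd rfl hne
    · exact half none α' (by simp) fun a b hab => hd.const_init α' a b hab
    · exact symm _ _ (half none α (by simp) fun a b hab => hd.const_init α a b hab)
    · have hne' : α ≠ α' := fun h => hne (by rw [h])
      rcases lt_trichotomy (lev α) (lev α') with h | h | h
      · exact half (some α) α' hne fun a b hab => hd.const_lt α α' a b h hab
      · exact half (some α) α' hne fun a b hab => hd.const_same α α' a b h hne' hab
      · exact symm _ _ (half (some α') α hne.symm fun a b hab => hd.const_lt α' α a b h hab)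
  have energy : ∀ s : Option ι → ℝ, (∀ o, s o = 1 ∨ s o = -1) →
      ∑ a ∈ Q, (∑ o, (s o : 𝕜) * F o a) * (starRingEnd 𝕜) (∑ o, (s o : 𝕜) * F o a)
        = ∑ o, ∑ a ∈ Q, F o a * (starRingEnd 𝕜) (F o a) := by
    intro s hs
    simp only [map_sum, map_mul, RCLike.conj_ofReal, Finset.sum_mul_sum]
    rw [Finset.sum_comm]
    refine Finset.sum_congr rfl fun o _ => ?_
    rw [Finset.sum_comm, Finset.sum_eq_single o]
    · refine Finset.sum_congr rfl fun a _ => ?_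
      rcases hs o with h | h <;> simp [h]
    · intro o' _ hne
      have := cross o o' hne.symm
      rw [← mul_zero ((s o : 𝕜) * (s o' : 𝕜)), ← this, Finset.mul_sum]
      exact Finset.sum_congr rfl fun a _ => by ring
    · simp
  have energy' : ∀ s : Option ι → ℝ, (∀ o, s o = 1 ∨ s o = -1) →
      ∑ a ∈ Q, ‖∑ o, (s o : 𝕜) * F o a‖ ^ 2 = ∑ a ∈ Q, ‖∑ o, F o a‖ ^ 2 := by
    intro s hs
    have h1 := (energy s hs).trans (energy (fun _ => 1) (by simp)).symm
    simp only [RCLike.mul_conj, RCLike.ofReal_one, one_mul] at h1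
    exact_mod_cast h1
  have h1 : ∀ a ∉ Q, (e + ∑ α, ε α • d α) a = 0 := hd.sum_eq_zero (fun α x => ε α • x) (by simp)
  have h2 : ∀ a ∉ Q, (e + ∑ α, d α) a = 0 := hd.sum_eq_zero (fun _ x => x) fun _ => rfl
  rw [eLpNorm_count_of_support (by simp) (by simp) h1,
    eLpNorm_count_of_support (by simp) (by simp) h2, one_mul]
  refine le_of_eq ?_
  congr 1
  have h3 := energy' (fun o => o.elim 1 ε) (by rintro (_ | α) <;> simp [hε])
  have conv : ∀ g : G → 𝕜, ∑ a ∈ Q, ‖g a‖ₑ ^ (2 : ℝ≥0∞).toReal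
      = ENNReal.ofReal (∑ a ∈ Q, ‖g a‖ ^ 2) := by
    intro g
    rw [ENNReal.ofReal_sum_of_nonneg fun _ _ => by positivity]
    refine Finset.sum_congr rfl fun a _ => ?_
    rw [← ofReal_norm, ENNReal.ofReal_rpow_of_nonneg (norm_nonneg _) (by simp)]
    norm_num
  rw [conv, conv]
  congr 1
  simp only [Fintype.sum_option, hF, Option.elim] at h3
  simpa [RCLike.real_smul_eq_coe_mul] using h3

end DiscreteBounds

/-! ### Transforms with general coefficients -/

section Multipliers

variable {G : Type*} [MeasurableSpace G] [Countable G] [MeasurableSingletonClass G]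
  {X : Type*} [NormedAddCommGroup X] [NormedSpace ℝ X]

/-- Signs may be replaced by coefficients in `[-1, 1]`, since the cube `[-1, 1]^ι` is the convex
hull of its vertices. -/
lemma IsDiscreteBound.real_coeff {p : ℝ≥0∞} (hp : 1 ≤ p) {β : ℝ≥0∞}
    (hβ : IsDiscreteBound G p X β) {ι : Type} [Fintype ι] {lev : ι → ℕ} {Q : Finset G}
    {R : ι → G → G → Prop} {e : G → X} {d : ι → G → X} (hd : IsDiffSystem lev Q R e d)
    {c₀ : ℝ} (hc₀ : c₀ ∈ Set.Icc (-1 : ℝ) 1) {c : ι → ℝ} (hc : ∀ α, c α ∈ Set.Icc (-1 : ℝ) 1) :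
    eLpNorm (c₀ • e + ∑ α, c α • d α) p Measure.count
      ≤ β * eLpNorm (e + ∑ α, d α) p Measure.count := by
  set B := β * eLpNorm (e + ∑ α, d α) p Measure.count
  set L : (Option ι → ℝ) → G → X := fun s => s none • e + ∑ α, s (some α) • d α with hL
  have hconv : Convex ℝ {s : Option ι → ℝ | eLpNorm (L s) p Measure.count ≤ B} := by
    intro s hs t ht a b ha hb hab
    have hlin : L (a • s + b • t) = a • L s + b • L t := by
      funext x
      simp only [hL, Pi.add_apply, Pi.smul_apply, Finset.sum_apply, smul_eq_mul, add_smul,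
        mul_smul, Finset.sum_add_distrib, smul_add, Finset.smul_sum]
      abel
    simp only [Set.mem_ofPred_eq] at hs ht ⊢
    rw [hlin]
    refine (eLpNorm_add_le StronglyMeasurable.of_discrete.aestronglyMeasurable
      StronglyMeasurable.of_discrete.aestronglyMeasurable hp).trans ?_
    rw [eLpNorm_const_smul, eLpNorm_const_smul]
    calc ‖a‖ₑ * eLpNorm (L s) p Measure.count + ‖b‖ₑ * eLpNorm (L t) p Measure.count
        ≤ ‖a‖ₑ * B + ‖b‖ₑ * B := by gcongr
      _ = B := by
        rw [← add_mul, Real.enorm_eq_ofReal ha, Real.enorm_eq_ofReal hb,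
          ← ENNReal.ofReal_add ha hb, hab]
        simp
  have hvert : (Set.univ.pi fun _ : Option ι => ({-1, 1} : Set ℝ))
      ⊆ {s : Option ι → ℝ | eLpNorm (L s) p Measure.count ≤ B} := by
    intro s hs
    have hs' : ∀ o, s o = 1 ∨ s o = -1 := fun o => by
      have := hs o (Set.mem_univ o)
      simpa [or_comm] using this
    -- the sign of the initial function is normalised to `1`
    rcases hs' none with h0 | h0
    · have := hβ ι lev Q R e d (fun α => s (some α)) hd fun α => hs' _
      simpa [hL, h0] using this
    · have := hβ ι lev Q R e d (fun α => -s (some α)) hd fun α => by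
        rcases hs' (some α) with h | h <;> simp [h]
      have hneg : L s = -(e + ∑ α, (-s (some α)) • d α) := by
        simp only [hL, h0, neg_smul, one_smul, Finset.sum_neg_distrib]
        abel
      simp only [Set.mem_ofPred_eq]
      rw [hneg, eLpNorm_neg]
      exact this
  have hhull := convexHull_min hvert hconv
  rw [convexHull_pi, convexHull_pair, segment_eq_Icc (by norm_num)] at hhull
  have : (fun o : Option ι => o.elim c₀ c) ∈
      (Set.univ.pi fun _ : Option ι => Set.Icc (-1 : ℝ) 1) := by
    rintro (_ | α) _
    · exact hc₀
    · exact hc α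
  simpa [hL] using hhull this

/-- Scalar coefficients of modulus at most one: real and imaginary part are treated separately. -/
lemma IsDiscreteBound.scalar_coeff {𝕜 : Type*} [RCLike 𝕜] [NormedSpace 𝕜 X] [IsScalarTower ℝ 𝕜 X]
    {p : ℝ≥0∞} (hp : 1 ≤ p) {β : ℝ≥0∞}
    (hβ : IsDiscreteBound G p X β) {ι : Type} [Fintype ι] {lev : ι → ℕ} {Q : Finset G}
    {R : ι → G → G → Prop} {d : ι → G → X} (hd : IsDiffSystem lev Q R 0 d)
    {c : ι → 𝕜} (hc : ∀ α, ‖c α‖ ≤ 1) :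
    eLpNorm (∑ α, c α • d α) p Measure.count
      ≤ 2 * (β * eLpNorm (∑ α, d α) p Measure.count) := by
  have hbd : ∀ α, RCLike.re (c α) ∈ Set.Icc (-1 : ℝ) 1 ∧ RCLike.im (c α) ∈ Set.Icc (-1 : ℝ) 1 :=
    fun α => ⟨abs_le.1 ((RCLike.abs_re_le_norm _).trans (hc α)),
      abs_le.1 ((RCLike.abs_im_le_norm _).trans (hc α))⟩
  have hre := hβ.real_coeff hp hd (c₀ := 0) (by simp) fun α => (hbd α).1
  have him := hβ.real_coeff hp hd (c₀ := 0) (by simp) fun α => (hbd α).2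
  simp only [zero_smul, zero_add] at hre him
  have hsplit : ∑ α, c α • d α = ∑ α, RCLike.re (c α) • d α
      + (RCLike.I : 𝕜) • ∑ α, RCLike.im (c α) • d α := by
    rw [Finset.smul_sum, ← Finset.sum_add_distrib]
    refine Finset.sum_congr rfl fun α _ => ?_
    funext a
    conv_lhs => rw [← RCLike.re_add_im (c α)]
    simp only [Pi.smul_apply, Pi.add_apply, add_smul, mul_comm _ (RCLike.I : 𝕜), mul_smul]
    rw [← RCLike.real_smul_eq_coe_smul, ← RCLike.real_smul_eq_coe_smul]
  rw [hsplit, two_mul]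
  refine (eLpNorm_add_le StronglyMeasurable.of_discrete.aestronglyMeasurable
      StronglyMeasurable.of_discrete.aestronglyMeasurable hp).trans (add_le_add hre ?_)
  rw [eLpNorm_const_smul]
  have hI : ‖(RCLike.I : 𝕜)‖ₑ ≤ 1 := by
    rw [← ofReal_norm]
    refine ENNReal.ofReal_le_one.2 ?_
    rcases RCLike.I_mul_I (K := 𝕜) with h | h
    · simp [h]
    · have h' := congrArg norm h
      rw [norm_mul, norm_neg, norm_one] at h'
      nlinarith [norm_nonneg (RCLike.I : 𝕜)]
  calc _ ≤ 1 * eLpNorm (∑ α, RCLike.im (c α) • d α) p Measure.count := by gcongr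
    _ ≤ _ := by rw [one_mul]; exact him

end Multipliers

/-! ### Conditional expectations on partitions into finite sets -/

section Averages

/-- A partition of `G` into finite sets, given by the class `cl a` of each point `a`. -/
structure FinPartition (G : Type*) where
  /-- the class of a point -/
  cl : G → Finset G
  mem_self : ∀ a, a ∈ cl a
  cl_eq : ∀ {a b}, b ∈ cl a → cl b = cl a

namespace FinPartition

variable {G X : Type*} (P : FinPartition G)

lemma mem_comm {a b : G} : b ∈ P.cl a ↔ a ∈ P.cl b :=
  ⟨fun h => P.cl_eq h ▸ P.mem_self a, fun h => P.cl_eq h ▸ P.mem_self b⟩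

variable [AddCommGroup X] [Module ℝ X]

/-- The conditional expectation of `f`: its mean values on the classes of the partition. -/
noncomputable def avg (f : G → X) (a : G) : X := ((P.cl a).card : ℝ)⁻¹ • ∑ b ∈ P.cl a, f b

lemma avg_eq_of_mem (f : G → X) {a b : G} (h : b ∈ P.cl a) : P.avg f b = P.avg f a := by
  rw [avg, avg, P.cl_eq h]

lemma avg_eq_zero {f : G → X} {Q : Finset G} (hf : ∀ a ∉ Q, f a = 0)
    (hQ : ∀ a ∈ Q, P.cl a ⊆ Q) {a : G} (ha : a ∉ Q) : P.avg f a = 0 := by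
  rw [avg, Finset.sum_eq_zero, smul_zero]
  exact fun b hb => hf b fun hbQ => ha (hQ b hbQ (P.mem_comm.1 hb))

/-- The conditional expectation has the same sums over unions of classes. -/
lemma sum_avg (f : G → X) {B : Finset G} (hB : ∀ a ∈ B, P.cl a ⊆ B) :
    ∑ a ∈ B, P.avg f a = ∑ a ∈ B, f a := by
  classical
  have h1 : ∀ a ∈ B, P.avg f a
      = ∑ b ∈ B, if b ∈ P.cl a then ((P.cl a).card : ℝ)⁻¹ • f b else 0 := by
    intro a ha
    rw [avg, Finset.smul_sum, ← Finset.sum_filter]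
    refine Finset.sum_congr ?_ fun _ _ => rfl
    ext b
    simp only [Finset.mem_filter]
    exact ⟨fun h => ⟨hB a ha h, h⟩, fun h => h.2⟩
  rw [Finset.sum_congr rfl h1, Finset.sum_comm]
  refine Finset.sum_congr rfl fun b hb => ?_
  have h2 : ∀ a ∈ B, (if b ∈ P.cl a then ((P.cl a).card : ℝ)⁻¹ • f b else 0)
      = if a ∈ P.cl b then ((P.cl b).card : ℝ)⁻¹ • f b else 0 := by
    intro a _
    by_cases h : b ∈ P.cl a
    · rw [if_pos h, if_pos (P.mem_comm.1 h), P.cl_eq h]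
    · rw [if_neg h, if_neg fun h' => h (P.mem_comm.1 h')]
  rw [Finset.sum_congr rfl h2, ← Finset.sum_filter]
  have h3 : B.filter (fun a => a ∈ P.cl b) = P.cl b := by
    ext a
    simp only [Finset.mem_filter]
    exact ⟨fun h => h.2, fun h => ⟨hB b hb h, h⟩⟩
  rw [h3, Finset.sum_const, ← Nat.cast_smul_eq_nsmul ℝ, smul_smul, mul_inv_cancel₀, one_smul]
  exact_mod_cast (Finset.card_pos.2 ⟨b, P.mem_self b⟩).ne'

/-- The partition into single points. -/
def points (G : Type*) : FinPartition G where
  cl a := {a}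
  mem_self a := by simp
  cl_eq h := by rw [Finset.mem_singleton.1 h]

lemma avg_points (f : G → X) : (points G).avg f = f := by
  funext a; simp [avg, points]

/-- Replace the classes that lie in one of the disjoint sets `B i` by the set `B i` itself. -/
noncomputable def merge {κ : Type*} (B : κ → Finset G)
    (hdisj : ∀ i j a, a ∈ B i → a ∈ B j → B i = B j) (hsat : ∀ i, ∀ a ∈ B i, P.cl a ⊆ B i) :
    FinPartition G where
  cl a := by
    classical
    exact if h : ∃ i, a ∈ B i then B h.choose else P.cl a
  mem_self a := by
    by_cases h : ∃ i, a ∈ B i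
    · simp only [h, dif_pos]; exact h.choose_spec
    · simp only [h, dif_neg, not_false_eq_true]; exact P.mem_self a
  cl_eq {a b} hb := by
    by_cases h : ∃ i, a ∈ B i
    · simp only [h, dif_pos] at hb ⊢
      have h' : ∃ i, b ∈ B i := ⟨_, hb⟩
      simp only [h', dif_pos]
      exact hdisj _ _ b h'.choose_spec hb
    · simp only [h, dif_neg, not_false_eq_true] at hb ⊢
      have h' : ¬ ∃ i, b ∈ B i := fun ⟨i, hi⟩ => h ⟨i, hsat i b hi (P.mem_comm.1 hb)⟩
      simp only [h', dif_neg, not_false_eq_true]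
      exact P.cl_eq hb

section Merge
variable {κ : Type*} {B : κ → Finset G}
    {hdisj : ∀ i j a, a ∈ B i → a ∈ B j → B i = B j} {hsat : ∀ i, ∀ a ∈ B i, P.cl a ⊆ B i}

lemma merge_cl_of_mem {i : κ} {a : G} (h : a ∈ B i) : (P.merge B hdisj hsat).cl a = B i := by
  have h' : ∃ i, a ∈ B i := ⟨i, h⟩
  simp only [merge, h', dif_pos]
  exact hdisj _ _ a h'.choose_spec h

lemma merge_cl_of_notMem {a : G} (h : ∀ i, a ∉ B i) :
    (P.merge B hdisj hsat).cl a = P.cl a := by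
  have h' : ¬ ∃ i, a ∈ B i := fun ⟨i, hi⟩ => h i hi
  simp only [merge, h', dif_neg, not_false_eq_true]

lemma cl_subset_merge (a : G) : P.cl a ⊆ (P.merge B hdisj hsat).cl a := by
  by_cases h : ∃ i, a ∈ B i
  · obtain ⟨i, hi⟩ := h
    rw [P.merge_cl_of_mem hi]
    exact hsat i a hi
  · rw [P.merge_cl_of_notMem fun i hi => h ⟨i, hi⟩]

end Merge

end FinPartition

variable {G : Type*} [MeasurableSpace G] [Countable G] [MeasurableSingletonClass G]
  {X : Type*} [NormedAddCommGroup X] [NormedSpace ℝ X]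

/-- The martingale transform of the conditional expectations of `f` on successively finer
partitions. -/
lemma IsDiscreteBound.avg_transform {p : ℝ≥0∞} (hp : 1 ≤ p) {β : ℝ≥0∞}
    (hβ : IsDiscreteBound G p X β) (P : ℕ → FinPartition G)
    (hP : ∀ k a, (P (k + 1)).cl a ⊆ (P k).cl a) (L : ℕ) {f : G → X} {F : Finset G}
    (hf : ∀ a ∉ F, f a = 0) {c : ℕ → ℝ} (hc : ∀ k, c k ∈ Set.Icc (-1 : ℝ) 1) :
    eLpNorm (∑ k ∈ Finset.range L, c k • ((P (k + 1)).avg f - (P k).avg f)) p Measure.count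
      ≤ β * eLpNorm f p Measure.count := by
  classical
  -- after step `L` all points are separated, so that the martingale ends in `f`
  set P' : ℕ → FinPartition G := fun k => if k ≤ L then P k else FinPartition.points G with hP'
  have hmono : ∀ k a, (P' (k + 1)).cl a ⊆ (P' k).cl a := by
    intro k a
    simp only [hP']
    by_cases h : k + 1 ≤ L
    · rw [if_pos h, if_pos (by omega)]
      exact hP k a
    · rw [if_neg h]
      intro b hb
      rw [show b = a from Finset.mem_singleton.1 hb]
      exact FinPartition.mem_self _ _
  have hanti : ∀ k l, k ≤ l → ∀ a, (P' l).cl a ⊆ (P' k).cl a := by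
    intro k l hkl a
    induction l, hkl using Nat.le_induction with
    | base => exact subset_rfl
    | succ l _ ih => exact (hmono l a).trans ih
  set Q : Finset G := F.biUnion (P' 0).cl with hQ
  have hFQ : ∀ a ∉ Q, f a = 0 := fun a ha => hf a fun haF =>
    ha (Finset.mem_biUnion.2 ⟨a, haF, FinPartition.mem_self _ _⟩)
  have hQsat0 : ∀ a ∈ Q, (P' 0).cl a ⊆ Q := by
    intro a ha b hb
    obtain ⟨x, hx, hax⟩ := Finset.mem_biUnion.1 ha
    exact Finset.mem_biUnion.2 ⟨x, hx, (P' 0).cl_eq hax ▸ hb⟩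
  have hQsat : ∀ k, ∀ a ∈ Q, (P' k).cl a ⊆ Q := fun k a ha =>
    (hanti 0 k (Nat.zero_le k) a).trans (hQsat0 a ha)
  have hzero : ∀ k, ∀ a ∉ Q, (P' k).avg f a = 0 := fun k a ha =>
    (P' k).avg_eq_zero hFQ (hQsat k) ha
  have hd : IsDiffSystem (ι := Fin (L + 1)) (fun k => (k : ℕ)) Q
      (fun k a b => a ∈ Q ∧ b ∈ (P' k).cl a) ((P' 0).avg f)
      (fun k => (P' (k + 1)).avg f - (P' k).avg f) := by
    refine ⟨hzero 0, fun k a ha => ?_, fun k a b h => ⟨h.1, hQsat k a h.1 h.2⟩, ?_, ?_, ?_, ?_⟩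
    · simp [hzero _ a ha]
    · intro k a b h
      exact ((P' 0).avg_eq_of_mem f (hanti 0 k (Nat.zero_le _) a h.2)).symm
    · intro j k a b hjk h
      simp only [Pi.sub_apply]
      rw [(P' (j + 1)).avg_eq_of_mem f (hanti (j + 1) k hjk a h.2),
        (P' j).avg_eq_of_mem f (hanti j k (by omega) a h.2)]
    · intro j k a b hjk hne _
      exact absurd (Fin.ext hjk) hne
    · intro k A hA
      have h1 : ∀ g : G → X, ∑ a ∈ Q, A.indicator g a = ∑ a ∈ Q with a ∈ A, g a := by
        intro g
        rw [Finset.sum_filter]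
        exact Finset.sum_congr rfl fun a _ => by simp [Set.indicator]
      have hsat : ∀ l, (k : ℕ) ≤ l → ∀ a ∈ Q.filter (· ∈ A), (P' l).cl a ⊆ Q.filter (· ∈ A) := by
        intro l hl a ha b hb
        rw [Finset.mem_filter] at ha ⊢
        exact ⟨hQsat l a ha.1 hb, (hA a b ⟨ha.1, hanti k l hl a hb⟩).1 ha.2⟩
      rw [h1]
      simp only [Pi.sub_apply]
      rw [Finset.sum_sub_distrib, (P' (k + 1)).sum_avg f (hsat _ (by omega)),
        (P' k).sum_avg f (hsat _ le_rfl), sub_self]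
  have htel : (P' 0).avg f + ∑ k : Fin (L + 1), ((P' (k + 1)).avg f - (P' k).avg f) = f := by
    rw [Fin.sum_univ_eq_sum_range (fun k => (P' (k + 1)).avg f - (P' k).avg f) (L + 1),
      Finset.sum_range_sub (fun k => (P' k).avg f)]
    have : P' (L + 1) = FinPartition.points G := by simp [hP']
    rw [this, FinPartition.avg_points]
    abel
  have hmain := hβ.real_coeff hp hd (c₀ := 0) (by simp)
    (c := fun k => if (k : ℕ) < L then c k else 0)
    (fun k => by split_ifs; exacts [hc _, by simp])
  rw [htel, Fin.sum_univ_eq_sum_range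
    (fun k => (if k < L then c k else 0) • ((P' (k + 1)).avg f - (P' k).avg f)) (L + 1),
    Finset.sum_range_succ] at hmain
  simp only [lt_irrefl, if_false, zero_smul, add_zero, zero_add] at hmain
  convert hmain using 2
  refine Finset.sum_congr rfl fun k hk => ?_
  have hk' := Finset.mem_range.1 hk
  simp [hP', hk', hk'.le, Nat.succ_le_of_lt hk']

end Averages

/-! ### Shifts along a tree of partitions -/

section Shift

/-- A finite family of pairs `φ α`, `ψ α` of `{-1, 0, 1}`-valued functions, which live on disjoint
sets `S α` inside the classes of the partition `r (lev α)` and are constant on the classes of the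
next partition. The moment conditions say that `φ α` and `ψ α` are exchangeable: the pairs
`(φ α, ψ α)` and `(ψ α, φ α)` have the same distribution on `S α`. -/
structure IsShiftFamily {G ι : Type*} (r : ℕ → FinPartition G) (lev : ι → ℕ)
    (S : ι → Finset G) (φ ψ : ι → G → ℝ) : Prop where
  refine_cl : ∀ k a, (r (k + 1)).cl a ⊆ (r k).cl a
  supp_left : ∀ α, ∀ a ∉ S α, φ α a = 0
  supp_right : ∀ α, ∀ a ∉ S α, ψ α a = 0
  mem_cl : ∀ α, ∀ a ∈ S α, ∀ b ∈ S α, b ∈ (r (lev α)).cl a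
  disj : ∀ α α', lev α = lev α' → α ≠ α' → Disjoint (S α) (S α')
  const_left : ∀ α a b, b ∈ (r (lev α + 1)).cl a → φ α b = φ α a
  const_right : ∀ α a b, b ∈ (r (lev α + 1)).cl a → ψ α b = ψ α a
  val_left : ∀ α a, φ α a = -1 ∨ φ α a = 0 ∨ φ α a = 1
  val_right : ∀ α a, ψ α a = -1 ∨ ψ α a = 0 ∨ ψ α a = 1
  sum_left : ∀ α, ∑ a ∈ S α, φ α a = 0
  sum_right : ∀ α, ∑ a ∈ S α, ψ α a = 0
  sum_sq : ∀ α, ∑ a ∈ S α, φ α a ^ 2 = ∑ a ∈ S α, ψ α a ^ 2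
  sum_mixed : ∀ α, ∑ a ∈ S α, φ α a ^ 2 * ψ α a = ∑ a ∈ S α, φ α a * ψ α a ^ 2

/-- The moment conditions imply that `φ - ψ` has mean zero on the level sets of `φ + ψ`. -/
lemma sum_level_mul_sub_eq_zero {G : Type*} {S : Finset G} {φ ψ : G → ℝ}
    (hφ : ∀ a, φ a = -1 ∨ φ a = 0 ∨ φ a = 1) (hψ : ∀ a, ψ a = -1 ∨ ψ a = 0 ∨ ψ a = 1)
    (h1 : ∑ a ∈ S, φ a = 0) (h2 : ∑ a ∈ S, ψ a = 0)
    (h3 : ∑ a ∈ S, φ a ^ 2 = ∑ a ∈ S, ψ a ^ 2)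
    (h4 : ∑ a ∈ S, φ a ^ 2 * ψ a = ∑ a ∈ S, φ a * ψ a ^ 2) (χ : ℝ → ℝ) :
    ∑ a ∈ S, χ (φ a + ψ a) * (φ a - ψ a) = 0 := by
  -- the antisymmetric functions on `{-1, 0, 1}²` are spanned by the three moments
  have hpt : ∀ a, χ (φ a + ψ a) * (φ a - ψ a)
      = (χ 1 + χ (-1)) / 2 * (φ a - ψ a) + (χ 1 - χ (-1)) / 2 * (φ a ^ 2 - ψ a ^ 2)
        + ((χ 1 + χ (-1)) / 2 - χ 0) * (φ a ^ 2 * ψ a - φ a * ψ a ^ 2) := by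
    intro a
    rcases hφ a with h | h | h <;> rcases hψ a with h' | h' | h' <;> rw [h, h'] <;> norm_num <;>
      ring
  simp only [hpt, Finset.sum_add_distrib, ← Finset.mul_sum, Finset.sum_sub_distrib, h1, h2, h3, h4]
  ring

lemma sum_sign_smul {G Y : Type*} [AddCommGroup Y] [Module ℝ Y] {S : Finset G} {φ : G → ℝ}
    (hφ : ∀ a, φ a = -1 ∨ φ a = 0 ∨ φ a = 1) (g : G → Y) :
    ∑ b ∈ S, φ b • g b = ∑ b ∈ S with φ b = 1, g b - ∑ b ∈ S with φ b = -1, g b := by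
  rw [Finset.sum_filter, Finset.sum_filter, ← Finset.sum_sub_distrib]
  refine Finset.sum_congr rfl fun b _ => ?_
  rcases hφ b with h1 | h1 | h1 <;> rw [h1] <;> norm_num

lemma IsShiftFamily.antitone_cl {G ι : Type*} {r : ℕ → FinPartition G} {lev : ι → ℕ}
    {S : ι → Finset G} {φ ψ : ι → G → ℝ} (h : IsShiftFamily r lev S φ ψ) {k l : ℕ} (hkl : k ≤ l)
    (a : G) : (r l).cl a ⊆ (r k).cl a := by
  induction l, hkl using Nat.le_induction with
  | base => exact subset_rfl
  | succ l _ ih => exact (h.refine_cl l a).trans ih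

variable {G : Type*} [MeasurableSpace G] [Countable G] [MeasurableSingletonClass G]
  {X : Type*} [NormedAddCommGroup X] [NormedSpace ℝ X]
  {ι : Type} [Fintype ι] {r : ℕ → FinPartition G} {lev : ι → ℕ} {S : ι → Finset G}
  {φ ψ : ι → G → ℝ}

/-- Replacing `φ α` by `ψ α` is a martingale transform: with `u = (φ + ψ) / 2`, `v = (φ - ψ) / 2`
it changes the sign of `v` in `φ = u + v`. -/
lemma IsShiftFamily.transfer {𝕜 : Type*} [RCLike 𝕜] [NormedSpace 𝕜 X] [IsScalarTower ℝ 𝕜 X]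
    {p : ℝ≥0∞} (hp : 1 ≤ p) {β : ℝ≥0∞} (hβ : IsDiscreteBound G p X β)
    (h : IsShiftFamily r lev S φ ψ) (y : ι → X) {c : ι → 𝕜} (hc : ∀ α, ‖c α‖ ≤ 1) :
    eLpNorm (fun a => ∑ α, c α • ψ α a • y α) p Measure.count
      ≤ 2 * (β * eLpNorm (fun a => ∑ α, φ α a • y α) p Measure.count) := by
  classical
  set u : ι → G → ℝ := fun α a => (φ α a + ψ α a) / 2 with hu
  set v : ι → G → ℝ := fun α a => (φ α a - ψ α a) / 2 with hv
  set w : ι × Bool → G → ℝ := fun i a => if i.2 then v i.1 a else u i.1 a with hw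
  have hw0 : ∀ i a, a ∉ S i.1 → w i a = 0 := by
    intro i a ha
    simp [hw, hu, hv, h.supp_left _ a ha, h.supp_right _ a ha]
  have hwlev : ∀ i i' : ι × Bool, lev i.1 < lev i'.1 → ∀ a b, a ∈ S i'.1 → b ∈ S i'.1 →
      w i a = w i b := by
    intro i i' hlt a b ha hb
    have hmem : b ∈ (r (lev i.1 + 1)).cl a := h.antitone_cl hlt a (h.mem_cl _ a ha b hb)
    simp only [hw, hu, hv, h.const_left _ a b hmem, h.const_right _ a b hmem]
  have hwdisj : ∀ i i' : ι × Bool, lev i.1 = lev i'.1 → i.1 ≠ i'.1 → ∀ a b, a ∈ S i'.1 →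
      b ∈ S i'.1 → w i a = w i b := by
    intro i i' hl hne a b ha hb
    have hd := Finset.disjoint_right.1 (h.disj _ _ hl hne)
    rw [hw0 i a (hd ha), hw0 i b (hd hb)]
  -- Within one level the sums `u` come first; `R` then also fixes the value of `φ + ψ` for the `v`.
  have hd : IsDiffSystem (X := X) (ι := ι × Bool) (fun i => 2 * lev i.1 + if i.2 then 1 else 0)
      (Finset.univ.biUnion S)
      (fun i a b => a ∈ S i.1 ∧ b ∈ S i.1 ∧ (i.2 = true → φ i.1 a + ψ i.1 a = φ i.1 b + ψ i.1 b))
      0 (fun i a => w i a • y i.1) := by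
    refine ⟨fun _ _ => rfl, fun i a ha => ?_, fun i a b hab => ?_, fun _ _ _ _ => rfl, ?_, ?_, ?_⟩
    · have : a ∉ S i.1 := fun h' => ha (Finset.mem_biUnion.2 ⟨i.1, Finset.mem_univ _, h'⟩)
      simp only [hw0 i a this, zero_smul]
    · exact ⟨Finset.mem_biUnion.2 ⟨i.1, Finset.mem_univ _, hab.1⟩,
        Finset.mem_biUnion.2 ⟨i.1, Finset.mem_univ _, hab.2.1⟩⟩
    · rintro ⟨α, s⟩ ⟨α', s'⟩ a b hlt ⟨ha, hb, hs⟩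
      dsimp only at hlt ha hb hs ⊢
      congr 1
      rcases lt_trichotomy (lev α) (lev α') with hl | hl | hl
      · exact hwlev (α, s) (α', s') hl a b ha hb
      · by_cases hαα : α = α'
        · subst hαα
          cases s <;> cases s' <;> simp at hlt
          have := hs rfl
          simp only [hw, hu, Bool.false_eq_true, if_false, this]
        · exact hwdisj (α, s) (α', s') hl hαα a b ha hb
      · exfalso
        split_ifs at hlt <;> omega
    · rintro ⟨α, s⟩ ⟨α', s'⟩ a b hl hne ⟨ha, hb, hs⟩
      dsimp only at hl ha hb hs ⊢
      congr 1
      by_cases hαα : α = α'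
      · subst hαα
        cases s <;> cases s' <;> simp at hl hne
      · exact hwdisj (α, s) (α', s') (by dsimp only; split_ifs at hl <;> omega) hαα a b ha hb
    · rintro ⟨α, s⟩ A hA
      dsimp only at hA
      have hsum : ∑ a ∈ Finset.univ.biUnion S, A.indicator (fun a => w (α, s) a • y α) a
          = (∑ a ∈ S α, A.indicator (w (α, s)) a) • y α := by
        rw [Finset.sum_smul]
        symm
        refine (Finset.sum_subset (Finset.subset_biUnion_of_mem S (Finset.mem_univ α)) ?_).trans
          (Finset.sum_congr rfl fun a _ => ?_)
        · intro a _ ha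
          simp [Set.indicator, hw0 (α, s) a ha]
        · by_cases ha : a ∈ A <;> simp [ha]
      rw [hsum]
      convert zero_smul ℝ (y α)
      have hφψ := sum_level_mul_sub_eq_zero (h.val_left α) (h.val_right α) (h.sum_left α)
        (h.sum_right α) (h.sum_sq α) (h.sum_mixed α)
      cases s
      · -- the set `A` contains all of `S α` or nothing of it
        by_cases hne : ∃ a ∈ S α, a ∈ A
        · obtain ⟨a₀, ha₀, hA₀⟩ := hne
          have : ∀ a ∈ S α, A.indicator (w (α, false)) a = (φ α a + ψ α a) / 2 := by
            intro a ha
            rw [Set.indicator_of_mem ((hA a₀ a ⟨ha₀, ha, by simp⟩).1 hA₀)]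
            rfl
          rw [Finset.sum_congr rfl this, ← Finset.sum_div, Finset.sum_add_distrib, h.sum_left,
            h.sum_right]
          simp
        · exact Finset.sum_eq_zero fun a ha =>
            Set.indicator_of_notMem (fun hA' => hne ⟨a, ha, hA'⟩) _
      · have h0 := hφψ fun t => if ∃ b ∈ S α, b ∈ A ∧ φ α b + ψ α b = t then 1 / 2 else 0
        rw [← h0]
        refine Finset.sum_congr rfl fun a ha => ?_
        by_cases haA : a ∈ A
        · rw [Set.indicator_of_mem haA, if_pos ⟨a, ha, haA, rfl⟩]
          simp only [hw, hv, if_true]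
          ring
        · rw [Set.indicator_of_notMem haA, if_neg, zero_mul]
          rintro ⟨b, hb, hbA, hab⟩
          exact haA ((hA b a ⟨hb, ha, fun _ => hab⟩).1 hbA)
  have hmain := hβ.scalar_coeff hp hd (c := fun i => if i.2 then -c i.1 else c i.1)
    (fun i => by split_ifs <;> simp [hc])
  have e1 : ∑ i : ι × Bool, (if i.2 then -c i.1 else c i.1) • (fun a => w i a • y i.1)
      = fun a => ∑ α, c α • ψ α a • y α := by
    funext a
    rw [Finset.sum_apply, Fintype.sum_prod_type]
    refine Finset.sum_congr rfl fun α _ => ?_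
    rw [Fintype.sum_bool]
    simp only [hw, hu, hv, Pi.smul_apply, if_true, Bool.false_eq_true, if_false]
    rw [neg_smul, neg_add_eq_sub, ← smul_sub, ← sub_smul]
    congr 2
    ring
  have e2 : ∑ i : ι × Bool, (fun a => w i a • y i.1) = fun a => ∑ α, φ α a • y α := by
    funext a
    rw [Finset.sum_apply, Fintype.sum_prod_type]
    refine Finset.sum_congr rfl fun α _ => ?_
    rw [Fintype.sum_bool]
    simp only [hw, hu, hv, if_true, Bool.false_eq_true, if_false]
    rw [← add_smul]
    congr 1
    ring
  rwa [e1, e2] at hmain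

/-- The projection of `f` onto the span of the `φ α` is a martingale transform of `f`: it collects
the differences in which the support of `φ α` is split into the sets `φ α = 1` and `φ α = -1`. -/
lemma IsShiftFamily.projection {p : ℝ≥0∞} (hp : 1 ≤ p) {β : ℝ≥0∞}
    (hβ : IsDiscreteBound G p X β) (h : IsShiftFamily r lev S φ ψ) {f : G → X} {F : Finset G}
    (hf : ∀ a ∉ F, f a = 0) :
    eLpNorm (fun a => ∑ α, φ α a • (∑ b ∈ S α, φ α b ^ 2)⁻¹ • ∑ b ∈ S α, φ α b • f b) p
      Measure.count ≤ β * eLpNorm f p Measure.count := by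
  classical
  set x : ι → X := fun α => (∑ b ∈ S α, φ α b ^ 2)⁻¹ • ∑ b ∈ S α, φ α b • f b with hx
  -- Between the partitions `r i` and `r (i + 1)` two more are inserted: in `M i` the supports of
  -- the functions of level `i` are classes, in `M' i` they are split by the sign of `φ α`.
  set B : ℕ → ι → Finset G := fun i α => if lev α = i then (S α).filter (φ α · ≠ 0) else ∅ with hB
  set B' : ℕ → ι × Bool → Finset G := fun i α =>
    if lev α.1 = i then (S α.1).filter (φ α.1 · = if α.2 then 1 else -1) else ∅ with hB'
  have memB : ∀ i α a, a ∈ B i α ↔ lev α = i ∧ a ∈ S α ∧ φ α a ≠ 0 := by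
    intro i α a
    simp only [hB]
    split_ifs with hl <;> simp [hl]
  have memB' : ∀ i α s a, a ∈ B' i (α, s) ↔ lev α = i ∧ a ∈ S α ∧ φ α a = if s then 1 else -1 := by
    intro i α s a
    simp only [hB']
    by_cases hl : lev α = i <;> simp [hl]
  have uniq : ∀ {α α' a}, lev α = lev α' → a ∈ S α → a ∈ S α' → α = α' := by
    intro α α' a hl ha ha'
    by_contra hne
    exact Finset.disjoint_left.1 (h.disj _ _ hl hne) ha ha'
  have memS : ∀ {α a}, φ α a ≠ 0 → a ∈ S α := by
    intro α a ha
    by_contra h'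
    exact ha (h.supp_left α a h')
  have hdisj : ∀ i α α' a, a ∈ B i α → a ∈ B i α' → B i α = B i α' := by
    intro i α α' a ha ha'
    rw [memB] at ha ha'
    rw [uniq (ha.1.trans ha'.1.symm) ha.2.1 ha'.2.1]
  have hsat : ∀ i α, ∀ a ∈ B i α, (r (i + 1)).cl a ⊆ B i α := by
    intro i α a ha b hb
    rw [memB] at ha ⊢
    have hc := h.const_left α a b (by rw [ha.1]; exact hb)
    have hb0 : φ α b ≠ 0 := by rw [hc]; exact ha.2.2
    exact ⟨ha.1, memS hb0, hb0⟩
  have hdisj' : ∀ i α α' a, a ∈ B' i α → a ∈ B' i α' → B' i α = B' i α' := by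
    rintro i ⟨α, s⟩ ⟨α', s'⟩ a ha ha'
    rw [memB'] at ha ha'
    obtain rfl := uniq (ha.1.trans ha'.1.symm) ha.2.1 ha'.2.1
    have := ha.2.2.symm.trans ha'.2.2
    cases s <;> cases s' <;> simp at this ⊢ <;> norm_num at this
  have hsat' : ∀ i α, ∀ a ∈ B' i α, (r (i + 1)).cl a ⊆ B' i α := by
    rintro i ⟨α, s⟩ a ha b hb
    rw [memB'] at ha ⊢
    have hc := h.const_left α a b (by rw [ha.1]; exact hb)
    have hb0 : φ α b ≠ 0 := by rw [hc, ha.2.2]; split_ifs <;> norm_num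
    exact ⟨ha.1, memS hb0, hc.trans ha.2.2⟩
  set M : ℕ → FinPartition G := fun i => (r (i + 1)).merge (B i) (hdisj i) (hsat i) with hM
  set M' : ℕ → FinPartition G := fun i => (r (i + 1)).merge (B' i) (hdisj' i) (hsat' i) with hM'
  have sign_of_mem : ∀ {i α a}, a ∈ B i α → ∃ s, a ∈ B' i (α, s) := by
    intro i α a ha
    rw [memB] at ha
    rcases h.val_left α a with h1 | h1 | h1
    · exact ⟨false, (memB' _ _ _ _).2 ⟨ha.1, ha.2.1, by simp [h1]⟩⟩
    · exact absurd h1 ha.2.2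
    · exact ⟨true, (memB' _ _ _ _).2 ⟨ha.1, ha.2.1, by simp [h1]⟩⟩
  have B'_sub : ∀ i α s, B' i (α, s) ⊆ B i α := by
    intro i α s a ha
    rw [memB'] at ha
    refine (memB _ _ _).2 ⟨ha.1, ha.2.1, ?_⟩
    rw [ha.2.2]; split_ifs <;> norm_num
  have h01 : ∀ i a, (M i).cl a ⊆ (r i).cl a := by
    intro i a
    by_cases ha : ∃ α, a ∈ B i α
    · obtain ⟨α, ha⟩ := ha
      simp only [hM]
      rw [FinPartition.merge_cl_of_mem _ ha]
      intro b hb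
      rw [memB] at ha hb
      exact ha.1 ▸ h.mem_cl α a ha.2.1 b hb.2.1
    · simp only [hM]
      rw [FinPartition.merge_cl_of_notMem _ fun α hα => ha ⟨α, hα⟩]
      exact h.refine_cl i a
  have h12 : ∀ i a, (M' i).cl a ⊆ (M i).cl a := by
    intro i a
    by_cases ha : ∃ α, a ∈ B i α
    · obtain ⟨α, ha⟩ := ha
      obtain ⟨s, hs⟩ := sign_of_mem ha
      simp only [hM, hM']
      rw [FinPartition.merge_cl_of_mem _ ha, FinPartition.merge_cl_of_mem _ hs]
      exact B'_sub i α s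
    · simp only [hM, hM']
      rw [FinPartition.merge_cl_of_notMem _ fun α hα => ha ⟨α, hα⟩,
        FinPartition.merge_cl_of_notMem _ fun α hα => ha ⟨α.1, B'_sub i α.1 α.2 hα⟩]
  have h23 : ∀ i a, (r (i + 1)).cl a ⊆ (M' i).cl a := fun i a => FinPartition.cl_subset_merge _ a
  -- the difference of the two averages is the projection
  have hdiff : ∀ i a, ((M' i).avg f - (M i).avg f) a
      = ∑ α with lev α = i, φ α a • x α := by
    intro i a
    by_cases ha : ∃ α, a ∈ B i α
    · obtain ⟨α, ha⟩ := ha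
      obtain ⟨s, hs⟩ := sign_of_mem ha
      have ha' := (memB _ _ _).1 ha
      have hs' := (memB' _ _ _ _).1 hs
      have hsum : ∑ α' with lev α' = i, φ α' a • x α' = φ α a • x α := by
        refine Finset.sum_eq_single α ?_ ?_
        · intro α' hα' hne
          have hl : lev α' = lev α := (Finset.mem_filter.1 hα').2.trans ha'.1.symm
          rw [h.supp_left α' a (Finset.disjoint_right.1 (h.disj α' α hl hne) ha'.2.1), zero_smul]
        · intro h'
          exact absurd (by simpa using ha'.1) h'
      rw [hsum]
      simp only [Pi.sub_apply, FinPartition.avg, hM, hM']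
      rw [FinPartition.merge_cl_of_mem _ ha, FinPartition.merge_cl_of_mem _ hs]
      set A₁ := (S α).filter (φ α · = 1) with hA₁
      set A₂ := (S α).filter (φ α · = -1) with hA₂
      have hBU : B i α = A₁ ∪ A₂ := by
        ext b
        rw [memB, Finset.mem_union, Finset.mem_filter, Finset.mem_filter]
        rcases h.val_left α b with h1 | h1 | h1 <;> rw [h1] <;> norm_num [ha'.1]
      have hA12 : Disjoint A₁ A₂ := Finset.disjoint_filter.2 fun b _ h1 h2 => by
        rw [h1] at h2; norm_num at h2
      have hcard : (A₁.card : ℝ) = A₂.card := by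
        have h1 := sum_sign_smul (S := S α) (h.val_left α) fun _ => (1 : ℝ)
        simp only [smul_eq_mul, mul_one, Finset.sum_const, nsmul_eq_mul] at h1
        rw [h.sum_left] at h1
        linarith
      have hsq : ∑ b ∈ S α, φ α b ^ 2 = 2 * A₁.card := by
        have h1 := sum_sign_smul (S := S α) (h.val_left α) (φ α)
        simp only [smul_eq_mul, ← pow_two] at h1
        rw [h1, Finset.sum_congr rfl (g := fun _ => (1 : ℝ))
          (fun b hb => (Finset.mem_filter.1 hb).2), Finset.sum_congr (s₁ := A₂) rfl
          (g := fun _ => (-1 : ℝ)) (fun b hb => (Finset.mem_filter.1 hb).2)]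
        simp only [Finset.sum_const, nsmul_eq_mul, mul_one, mul_neg]
        rw [← hcard]
        ring
      have hpos : (A₁.card : ℝ) ≠ 0 := by
        intro h0
        have h1 : A₁ = ∅ := by simpa using h0
        have h2 : A₂ = ∅ := by rw [h0] at hcard; simpa using hcard.symm
        rw [hBU, h1, h2] at ha
        simp at ha
      have hBcard : ((B i α).card : ℝ) = 2 * A₁.card := by
        rw [hBU, Finset.card_union_of_disjoint hA12]
        push_cast
        rw [← hcard]
        ring
      rw [hBcard, hBU, Finset.sum_union hA12]
      simp only [hx]
      rw [hsq, sum_sign_smul (h.val_left α) f, hs'.2.2, ← hA₁, ← hA₂]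
      cases s
      · have hB2 : B' i (α, false) = A₂ := by
          ext b
          rw [memB', Finset.mem_filter]
          simp [ha'.1]
        rw [hB2, ← hcard]
        match_scalars <;> field_simp <;> norm_num
      · have hB1 : B' i (α, true) = A₁ := by
          ext b
          rw [memB', Finset.mem_filter]
          simp [ha'.1]
        rw [hB1]
        match_scalars <;> field_simp <;> norm_num
    · have hφ0 : ∀ α, lev α = i → φ α a = 0 := by
        intro α hl
        by_contra h0
        exact ha ⟨α, (memB _ _ _).2 ⟨hl, memS h0, h0⟩⟩
      rw [Finset.sum_eq_zero fun α hα => by rw [hφ0 α (Finset.mem_filter.1 hα).2, zero_smul]]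
      simp only [Pi.sub_apply, FinPartition.avg, hM, hM']
      rw [FinPartition.merge_cl_of_notMem _ fun α hα => ha ⟨α, hα⟩,
        FinPartition.merge_cl_of_notMem _ fun α hα => ha ⟨α.1, B'_sub i α.1 α.2 hα⟩, sub_self]
  -- The coefficient is `1` on the steps from `M i` to `M' i` and `0` on all others.
  set P : ℕ → FinPartition G := fun k =>
    if k % 3 = 0 then r (k / 3) else if k % 3 = 1 then M (k / 3) else M' (k / 3) with hPdef
  have P0 : ∀ i, P (3 * i) = r i := fun i => by
    simp [hPdef]
  have P1 : ∀ i, P (3 * i + 1) = M i := fun i => by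
    have h1 : (3 * i + 1) % 3 = 1 := by omega
    have h2 : (3 * i + 1) / 3 = i := by omega
    simp [hPdef, h1, h2]
  have P2 : ∀ i, P (3 * i + 2) = M' i := fun i => by
    have h1 : (3 * i + 2) % 3 = 2 := by omega
    have h2 : (3 * i + 2) / 3 = i := by omega
    simp [hPdef, h1, h2]
  have hPmono : ∀ k a, (P (k + 1)).cl a ⊆ (P k).cl a := by
    intro k a
    obtain ⟨i, hi⟩ : ∃ i, k = 3 * i ∨ k = 3 * i + 1 ∨ k = 3 * i + 2 := ⟨k / 3, by omega⟩
    rcases hi with rfl | rfl | rfl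
    · rw [P0, P1]; exact h01 i a
    · rw [P1, P2]; exact h12 i a
    · rw [P2, show 3 * i + 2 + 1 = 3 * (i + 1) by ring, P0]; exact h23 i a
  set N := Finset.univ.sup lev + 1 with hN
  have hmain := hβ.avg_transform hp P hPmono (3 * N) hf
    (c := fun k => if k % 3 = 1 then 1 else 0) (fun k => by split_ifs <;> simp)
  have hsum : ∀ L : ℕ, ∑ k ∈ Finset.range (3 * L), (if k % 3 = 1 then (1 : ℝ) else 0) •
      ((P (k + 1)).avg f - (P k).avg f) = ∑ i ∈ Finset.range L, ((M' i).avg f - (M i).avg f) := by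
    intro L
    induction L with
    | zero => simp
    | succ L ih =>
      rw [show 3 * (L + 1) = 3 * L + 1 + 1 + 1 by ring, Finset.sum_range_succ,
        Finset.sum_range_succ, Finset.sum_range_succ, ih, Finset.sum_range_succ,
        show 3 * L + 1 + 1 = 3 * L + 2 by ring, P1, P2]
      have h0 : (3 * L) % 3 ≠ 1 := by omega
      have h1 : (3 * L + 1) % 3 = 1 := by omega
      have h2 : (3 * L + 2) % 3 ≠ 1 := by omega
      simp [h1]
  rw [hsum] at hmain
  convert hmain using 2
  funext a
  rw [Finset.sum_apply]
  simp only [hdiff]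
  rw [Finset.sum_fiberwise_of_maps_to]
  intro α _
  exact Finset.mem_range.2 (Nat.lt_succ_of_le (Finset.le_sup (Finset.mem_univ α)))

/-- The shift operator `f ↦ ∑ c_α ψ_α ⟨φ_α, f⟩ / ‖φ_α‖²` costs two martingale transforms, one for
the projection onto the `φ_α`, the other for the passage from `φ_α` to `ψ_α`. -/
theorem IsShiftFamily.shift_le {𝕜 : Type*} [RCLike 𝕜] [NormedSpace 𝕜 X] [IsScalarTower ℝ 𝕜 X]
    {p : ℝ≥0∞} (hp : 1 ≤ p) {β : ℝ≥0∞} (hβ : IsDiscreteBound G p X β)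
    (h : IsShiftFamily r lev S φ ψ) {f : G → X} {F : Finset G} (hf : ∀ a ∉ F, f a = 0)
    {c : ι → 𝕜} (hc : ∀ α, ‖c α‖ ≤ 1) :
    eLpNorm (fun a => ∑ α, c α • ψ α a • (∑ b ∈ S α, φ α b ^ 2)⁻¹ • ∑ b ∈ S α, φ α b • f b) p
      Measure.count ≤ 2 * β ^ 2 * eLpNorm f p Measure.count := by
  refine (h.transfer hp hβ _ hc).trans ?_
  calc _ ≤ 2 * (β * (β * eLpNorm f p Measure.count)) := by
        gcongr
        exact h.projection hp hβ hf
    _ = _ := by ring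

end Shift

/-! ### Dyadic cubes in the integer lattice -/

section Lattice

variable {n : ℕ}

lemma Int.ediv_eq_iff_mem_Ico {a d q : ℤ} (hd : 0 < d) :
    a / d = q ↔ d * q ≤ a ∧ a < d * q + d := by
  rw [show d * q + d = (q + 1) * d by ring, mul_comm d q, ← Int.le_ediv_iff_mul_le hd,
    ← Int.ediv_lt_iff_lt_mul hd]
  omega

/-- The cube `[0, 2^k)ⁿ` of the lattice. -/
noncomputable def box (n k : ℕ) : Finset (Fin n → ℤ) :=
  Fintype.piFinset fun _ => Finset.Ico 0 (2 ^ k)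

lemma mem_box {k : ℕ} {b : Fin n → ℤ} : b ∈ box n k ↔ ∀ i, 0 ≤ b i ∧ b i < 2 ^ k := by
  simp [box]

lemma mem_box_iff_ediv {k : ℕ} {b : Fin n → ℤ} : b ∈ box n k ↔ ∀ i, b i / 2 ^ k = 0 := by
  rw [mem_box]
  refine forall_congr' fun i => ?_
  rw [Int.ediv_eq_iff_mem_Ico (by positivity)]
  simp

lemma card_box (n k : ℕ) : (box n k).card = (2 ^ k) ^ n := by
  have h : ((2 : ℤ) ^ k).toNat = 2 ^ k := by
    rw [show ((2 : ℤ) ^ k) = ((2 ^ k : ℕ) : ℤ) by push_cast; rfl, Int.toNat_natCast]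
  simp [box, h]

/-- The partition of the lattice into the translates by `y` of the dyadic cubes of side `2^k`. -/
noncomputable def grid (y : Fin n → ℤ) (k : ℕ) : FinPartition (Fin n → ℤ) where
  cl a := Fintype.piFinset fun i => Finset.Ico (y i + 2 ^ k * ((a i - y i) / 2 ^ k))
    (y i + 2 ^ k * ((a i - y i) / 2 ^ k) + 2 ^ k)
  mem_self a := by
    simp only [Fintype.mem_piFinset, Finset.mem_Ico]
    intro i
    have := (Int.ediv_eq_iff_mem_Ico (a := a i - y i) (d := 2 ^ k) (by positivity)).1 rfl
    omega
  cl_eq {a b} hb := by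
    simp only [Fintype.mem_piFinset, Finset.mem_Ico] at hb
    have : ∀ i, (b i - y i) / 2 ^ k = (a i - y i) / 2 ^ k := fun i =>
      (Int.ediv_eq_iff_mem_Ico (by positivity)).2 (by have := hb i; omega)
    simp only [this]

lemma mem_grid {y : Fin n → ℤ} {k : ℕ} {a b : Fin n → ℤ} :
    b ∈ (grid y k).cl a ↔ ∀ i, (b i - y i) / 2 ^ k = (a i - y i) / 2 ^ k := by
  simp only [grid, Fintype.mem_piFinset, Finset.mem_Ico]
  refine forall_congr' fun i => ?_
  rw [Int.ediv_eq_iff_mem_Ico (by positivity)]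
  omega

lemma ediv_two_pow_mono {a b : ℤ} {k l : ℕ} (hkl : k ≤ l) (h : a / 2 ^ k = b / 2 ^ k) :
    a / 2 ^ l = b / 2 ^ l := by
  obtain ⟨t, rfl⟩ := Nat.exists_eq_add_of_le hkl
  rw [pow_add, ← Int.ediv_ediv_of_nonneg (by positivity), h,
    Int.ediv_ediv_of_nonneg (by positivity)]

lemma grid_mono (y : Fin n → ℤ) {k l : ℕ} (hkl : k ≤ l) (a : Fin n → ℤ) :
    (grid y k).cl a ⊆ (grid y l).cl a := by
  intro b hb
  rw [mem_grid] at hb ⊢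
  exact fun i => ediv_two_pow_mono hkl (hb i)

/-- The union of the cube `[0, 2^{j+1})ⁿ` and its `m`-th neighbour. -/
noncomputable def twoBoxes (m : Fin n → ℤ) (j : ℕ) : Finset (Fin n → ℤ) :=
  box n (j + 1) ∪ (box n (j + 1)).map (addRightEmbedding fun i => 2 ^ (j + 1) * m i)

lemma mem_twoBoxes {m : Fin n → ℤ} {j : ℕ} {b : Fin n → ℤ} :
    b ∈ twoBoxes m j ↔ (∀ i, b i / 2 ^ (j + 1) = 0) ∨ ∀ i, b i / 2 ^ (j + 1) = m i := by
  rw [twoBoxes, Finset.mem_union, mem_box_iff_ediv, Finset.mem_map]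
  refine or_congr Iff.rfl ?_
  constructor
  · rintro ⟨c, hc, rfl⟩ i
    rw [mem_box_iff_ediv] at hc
    simp only [addRightEmbedding_apply, Pi.add_apply]
    rw [Int.add_mul_ediv_left _ _ (by positivity), hc i, zero_add]
  · intro h
    refine ⟨fun i => b i - 2 ^ (j + 1) * m i, ?_, ?_⟩
    · rw [mem_box_iff_ediv]
      intro i
      rw [sub_eq_add_neg, ← mul_neg, Int.add_mul_ediv_left _ _ (by positivity), h i]
      ring
    · funext i
      simp

/-- A pair of exchangeable functions on the union of the cube `[0, 2^{j+1})ⁿ` and its `m`-th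
neighbour: the data of one term of a shift operator. -/
structure IsExchangePair (m : Fin n → ℤ) (j : ℕ) (Φ Ψ : (Fin n → ℤ) → ℝ) : Prop where
  supp_left : ∀ b ∉ twoBoxes m j, Φ b = 0
  supp_right : ∀ b ∉ twoBoxes m j, Ψ b = 0
  const_left : ∀ a b : Fin n → ℤ, (∀ i, a i / 2 ^ j = b i / 2 ^ j) → Φ a = Φ b
  const_right : ∀ a b : Fin n → ℤ, (∀ i, a i / 2 ^ j = b i / 2 ^ j) → Ψ a = Ψ b
  val_left : ∀ a, Φ a = -1 ∨ Φ a = 0 ∨ Φ a = 1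
  val_right : ∀ a, Ψ a = -1 ∨ Ψ a = 0 ∨ Ψ a = 1
  sum_left : ∑ a ∈ twoBoxes m j, Φ a = 0
  sum_right : ∑ a ∈ twoBoxes m j, Ψ a = 0
  sq_left : ∑ a ∈ twoBoxes m j, Φ a ^ 2 = (2 ^ (j + 1)) ^ n
  sq_right : ∑ a ∈ twoBoxes m j, Ψ a ^ 2 = (2 ^ (j + 1)) ^ n
  sum_mixed : ∑ a ∈ twoBoxes m j, Φ a ^ 2 * Ψ a = ∑ a ∈ twoBoxes m j, Φ a * Ψ a ^ 2

/-- The cube with corner `z` and side `2^{j+1}` of the grid translated by `y` is good for the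
shift `m`, `|m|_∞ ≤ 2^L`, if it lies in the half of its ancestor of side `2^{j+L+2}` from which its
`m`-th neighbour stays inside the ancestor. -/
def IsGoodCube (m : Fin n → ℤ) (L : ℕ) (y : Fin n → ℤ) (j : ℕ) (z : Fin n → ℤ) : Prop :=
  ∀ i, (2 ^ (j + 1) : ℤ) ∣ z i - y i ∧
    (z i - y i) / 2 ^ (j + 1 + L) % 2 = if 0 ≤ m i then 0 else 1

/-- A point in the half `ε` of an interval of length `2D`, where `ε = 0` for `m ≥ 0` and `ε = 1` for
`m < 0`, stays in the interval after a translation by `m`, `|m| ≤ D`. -/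
lemma add_ediv_eq_of_good {a m D : ℤ} (hD : 0 < D) (hm : |m| ≤ D)
    (ha : a / D % 2 = if 0 ≤ m then 0 else 1) : (a + m) / (D * 2) = a / (D * 2) := by
  obtain ⟨h1, h2⟩ := (Int.ediv_eq_iff_mem_Ico (a := a) hD).1 rfl
  obtain ⟨hm1, hm2⟩ := abs_le.1 hm
  have h3 := Int.emod_add_mul_ediv (a / D) 2
  rw [← Int.ediv_ediv_of_nonneg hD.le (x := a), Int.ediv_eq_iff_mem_Ico (by positivity)]
  rw [ha] at h3
  have h4 : D * (a / D) = D * (if 0 ≤ m then 0 else 1) + D * 2 * (a / D / 2) := by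
    conv_lhs => rw [← h3]
    ring
  split_ifs at h4 with h
  · constructor <;> linarith
  · constructor <;> linarith

lemma IsGoodCube.ediv_eq {m : Fin n → ℤ} {L : ℕ} {y z : Fin n → ℤ} {j : ℕ}
    (hz : IsGoodCube m L y j z) {x : Fin n → ℤ}
    (hx : (fun i => x i - z i) ∈ twoBoxes m j) :
    (∀ i, (x i - y i) / 2 ^ (j + 1) = (z i - y i) / 2 ^ (j + 1)) ∨
      ∀ i, (x i - y i) / 2 ^ (j + 1) = (z i - y i) / 2 ^ (j + 1) + m i := by
  have key : ∀ i, (x i - y i) / 2 ^ (j + 1)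
      = (z i - y i) / 2 ^ (j + 1) + (x i - z i) / 2 ^ (j + 1) := by
    intro i
    obtain ⟨t, ht⟩ := (hz i).1
    rw [ht, Int.mul_ediv_cancel_left _ (by positivity),
      show x i - y i = (x i - z i) + 2 ^ (j + 1) * t by linarith,
      Int.add_mul_ediv_left _ _ (by positivity), add_comm]
  rcases mem_twoBoxes.1 hx with h | h
  · exact Or.inl fun i => by rw [key i, h i, add_zero]
  · exact Or.inr fun i => by rw [key i, h i]

/-- A good cube and its `m`-th neighbour have the same ancestor of side `2^{j+L+2}`. -/
lemma IsGoodCube.ancestor_eq {m : Fin n → ℤ} {L : ℕ} (hm : ∀ i, |m i| ≤ 2 ^ L)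
    {y z : Fin n → ℤ} {j : ℕ} (hz : IsGoodCube m L y j z) {x : Fin n → ℤ}
    (hx : (fun i => x i - z i) ∈ twoBoxes m j) (i : Fin n) :
    (x i - y i) / 2 ^ (j + L + 2) = (z i - y i) / 2 ^ (j + L + 2) := by
  have hpow : ∀ u : ℤ, u / 2 ^ (j + L + 2) = u / 2 ^ (j + 1) / (2 ^ L * 2) := fun u => by
    rw [Int.ediv_ediv_of_nonneg (by positivity)]
    congr 1
    ring
  rw [hpow, hpow]
  rcases hz.ediv_eq hx with h | h
  · rw [h i]
  · rw [h i]
    refine add_ediv_eq_of_good (by positivity) (hm i) ?_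
    rw [Int.ediv_ediv_of_nonneg (by positivity), ← pow_add]
    exact (hz i).2

lemma IsGoodCube.eq_of_ediv_eq {m : Fin n → ℤ} {L : ℕ} {y z z' : Fin n → ℤ} {j : ℕ}
    (hz : IsGoodCube m L y j z) (hz' : IsGoodCube m L y j z') {s : Fin n → ℤ}
    (h : ∀ i, (z' i - y i) / 2 ^ (j + 1) = (z i - y i) / 2 ^ (j + 1) + s i) :
    z' = fun i => z i + 2 ^ (j + 1) * s i := by
  funext i
  obtain ⟨t, ht⟩ := (hz i).1
  obtain ⟨t', ht'⟩ := (hz' i).1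
  have := h i
  rw [ht, ht', Int.mul_ediv_cancel_left _ (by positivity),
    Int.mul_ediv_cancel_left _ (by positivity)] at this
  have h1 : z' i = y i + 2 ^ (j + 1) * t' := by linarith
  have h2 : z i = y i + 2 ^ (j + 1) * t := by linarith
  rw [h1, h2, this]
  ring

variable {X : Type*} [NormedAddCommGroup X] [NormedSpace ℝ X]
  {𝕜 : Type*} [RCLike 𝕜] [NormedSpace 𝕜 X] [IsScalarTower ℝ 𝕜 X]

/-- Shifts of good cubes whose levels lie in one residue class modulo `L + 2`, and no two of which
are `m`-th neighbours of each other. -/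
lemma good_shift_le {p : ℝ≥0∞} (hp : 1 ≤ p) {β : ℝ≥0∞}
    (hβ : IsDiscreteBound (Fin n → ℤ) p X β) {m : Fin n → ℤ} {L : ℕ} (hm : ∀ i, |m i| ≤ 2 ^ L)
    {Φ Ψ : ℕ → (Fin n → ℤ) → ℝ} (hΦ : ∀ j, IsExchangePair m j (Φ j) (Ψ j)) (y : Fin n → ℤ)
    {E : Finset (ℕ × (Fin n → ℤ))} {ρ : ℕ} (hρ : ∀ e ∈ E, e.1 % (L + 2) = ρ)
    (hgood : ∀ e ∈ E, IsGoodCube m L y e.1 e.2)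
    (hsep : ∀ j z, (j, z) ∈ E → ∀ z', (j, z') ∈ E → z ≠ z' →
      z' ≠ fun i => z i + 2 ^ (j + 1) * m i)
    {f : (Fin n → ℤ) → X} {F : Finset (Fin n → ℤ)} (hf : ∀ a ∉ F, f a = 0)
    {c : ℕ × (Fin n → ℤ) → 𝕜} (hc : ∀ e, ‖c e‖ ≤ 1) :
    eLpNorm (fun a => ∑ e ∈ E, c e • Ψ e.1 (a - e.2) •
      (((2 : ℝ) ^ (e.1 + 1)) ^ n)⁻¹ • ∑ b ∈ F, Φ e.1 (b - e.2) • f b) p Measure.count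
      ≤ 2 * β ^ 2 * eLpNorm f p Measure.count := by
  classical
  -- Level `k` of the tree is the grid of side `2^{ρ + (L + 2)(N - k)}`. A cube of generation
  -- `j = ρ + (L + 2) q` is placed at level `N - 1 - q`: together with its neighbour it lies in one
  -- cube of side `2^{j + L + 2}`, and the functions are constant on the cubes of side `2^j` of the
  -- next level.
  set N := E.sup Prod.fst + 1 with hN
  have hjN : ∀ e ∈ E, e.1 < N := fun e he => Nat.lt_succ_of_le (Finset.le_sup (f := Prod.fst) he)
  set q : ℕ × (Fin n → ℤ) → ℕ := fun e => e.1 / (L + 2) with hq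
  have hqN : ∀ e ∈ E, q e < N := fun e he => (Nat.div_le_self _ _).trans_lt (hjN e he)
  have hje : ∀ e ∈ E, e.1 = ρ + (L + 2) * q e := by
    intro e he
    have := Nat.mod_add_div e.1 (L + 2)
    rw [hρ e he] at this
    exact this.symm
  have hlev : ∀ e ∈ E, ρ + (L + 2) * (N - (N - 1 - q e)) = e.1 + L + 2 := by
    intro e he
    have h1 : N - (N - 1 - q e) = q e + 1 := by have := hqN e he; omega
    rw [h1, hje e he]
    ring
  have hlev' : ∀ e ∈ E, ρ + (L + 2) * (N - (N - 1 - q e + 1)) = e.1 := by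
    intro e he
    have h1 : N - (N - 1 - q e + 1) = q e := by have := hqN e he; omega
    rw [h1, ← hje e he]
  set S : E → Finset (Fin n → ℤ) := fun e => (twoBoxes m e.1.1).map (addRightEmbedding e.1.2)
    with hS
  have memS : ∀ (e : E) a, a ∈ S e ↔ a - e.1.2 ∈ twoBoxes m e.1.1 := by
    intro e a
    simp only [hS, Finset.mem_map, addRightEmbedding_apply]
    constructor
    · rintro ⟨b, hb, rfl⟩
      simpa using hb
    · intro h
      exact ⟨_, h, sub_add_cancel _ _⟩
  have sumS : ∀ (e : E) (g : (Fin n → ℤ) → ℝ),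
      ∑ a ∈ S e, g (a - e.1.2) = ∑ b ∈ twoBoxes m e.1.1, g b := by
    intro e g
    simp [hS, Finset.sum_map]
  have hshift : ∀ (e : E) (a b : Fin n → ℤ),
      b ∈ (grid y (ρ + (L + 2) * (N - (N - 1 - q e + 1)))).cl a →
      ∀ i, (b - e.1.2) i / 2 ^ e.1.1 = (a - e.1.2) i / 2 ^ e.1.1 := by
    intro e a b hab i
    rw [hlev' e.1 e.2, mem_grid] at hab
    obtain ⟨t, ht⟩ := (hgood e.1 e.2 i).1
    have hpow : (2 : ℤ) ^ (e.1.1 + 1) * t = 2 ^ e.1.1 * (2 * t) := by ring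
    have h1 : ∀ x : Fin n → ℤ, (x - e.1.2) i / 2 ^ e.1.1 = (x i - y i) / 2 ^ e.1.1 + -(2 * t) := by
      intro x
      rw [← Int.add_mul_ediv_left _ _ (by positivity : (2 : ℤ) ^ e.1.1 ≠ 0)]
      congr 1
      simp only [Pi.sub_apply]
      linarith
    rw [h1, h1, hab i]
  have hfam : IsShiftFamily (ι := E) (fun k => grid y (ρ + (L + 2) * (N - k)))
      (fun e => N - 1 - q e) S (fun e a => Φ e.1.1 (a - e.1.2))
      (fun e a => Ψ e.1.1 (a - e.1.2)) := by
    refine ⟨fun k a => grid_mono y ?_ a, ?_, ?_, ?_, ?_, ?_, ?_, ?_, ?_, ?_, ?_, ?_, ?_⟩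
    · gcongr
      omega
    · intro e a ha
      exact (hΦ _).supp_left _ fun h => ha ((memS e a).2 h)
    · intro e a ha
      exact (hΦ _).supp_right _ fun h => ha ((memS e a).2 h)
    · intro e a ha b hb
      rw [hlev e.1 e.2, mem_grid]
      intro i
      rw [(hgood e.1 e.2).ancestor_eq hm ((memS e a).1 ha) i,
        (hgood e.1 e.2).ancestor_eq hm ((memS e b).1 hb) i]
    -- the pairs of cubes of one level are disjoint, as `hsep` excludes `m`-th neighbours
    · rintro ⟨⟨j, z⟩, he⟩ ⟨⟨j', z'⟩, he'⟩ hl hne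
      dsimp only at hl
      have hqe : q (j, z) = q (j', z') := by
        have h1 := hqN _ he
        have h2 := hqN _ he'
        omega
      have hjj : j = j' := by
        have h1 := hje _ he
        have h2 := hje _ he'
        rw [hqe] at h1
        exact h1.trans h2.symm
      subst hjj
      have hzz : z ≠ z' := fun h => hne (by subst h; rfl)
      rw [Finset.disjoint_left]
      intro x hx hx'
      rw [memS] at hx hx'
      have hg := hgood _ he
      have hg' := hgood _ he'
      rcases hg.ediv_eq hx with h | h <;> rcases hg'.ediv_eq hx' with h' | h'
      · refine hzz.symm ?_
        simpa using hg.eq_of_ediv_eq hg' (s := 0) fun i => by rw [← h' i, h i]; simp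
      · exact hsep j z' he' z he hzz.symm
          (hg'.eq_of_ediv_eq hg fun i => by rw [← h i, h' i])
      · exact hsep j z he z' he' hzz
          (hg.eq_of_ediv_eq hg' fun i => by rw [← h' i, h i])
      · refine hzz.symm ?_
        simpa using hg.eq_of_ediv_eq hg' (s := 0) fun i => by
          have := (h i).symm.trans (h' i)
          simp only [Pi.zero_apply]
          linarith
    · intro e a b hab
      exact (hΦ _).const_left _ _ (hshift e a b hab)
    · intro e a b hab
      exact (hΦ _).const_right _ _ (hshift e a b hab)
    · exact fun e a => (hΦ _).val_left _
    · exact fun e a => (hΦ _).val_right _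
    · exact fun e => (sumS e _).trans (hΦ _).sum_left
    · exact fun e => (sumS e _).trans (hΦ _).sum_right
    · intro e
      rw [sumS e fun a => Φ e.1.1 a ^ 2, sumS e fun a => Ψ e.1.1 a ^ 2, (hΦ _).sq_left,
        (hΦ _).sq_right]
    · intro e
      rw [sumS e fun a => Φ e.1.1 a ^ 2 * Ψ e.1.1 a, sumS e fun a => Φ e.1.1 a * Ψ e.1.1 a ^ 2,
        (hΦ _).sum_mixed]
  have hmain := hfam.shift_le hp hβ hf (c := fun e : E => c e.1) fun e => hc _
  refine le_trans (le_of_eq ?_) hmain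
  congr 1
  funext a
  rw [← Finset.sum_coe_sort E]
  refine Finset.sum_congr rfl fun e _ => ?_
  congr 2
  rw [sumS e fun a => Φ e.1.1 a ^ 2, (hΦ _).sq_left]
  congr 1
  have h1 : ∑ b ∈ F, Φ e.1.1 (b - e.1.2) • f b = ∑ b ∈ F ∪ S e, Φ e.1.1 (b - e.1.2) • f b := by
    refine Finset.sum_subset Finset.subset_union_left fun b _ hb => ?_
    rw [hf b hb, smul_zero]
  have h2 : ∑ b ∈ S e, Φ e.1.1 (b - e.1.2) • f b = ∑ b ∈ F ∪ S e, Φ e.1.1 (b - e.1.2) • f b := by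
    refine Finset.sum_subset Finset.subset_union_right fun b _ hb => ?_
    rw [hfam.supp_left e b hb, zero_smul]
  rw [h1, h2]

end Lattice

/-! ### Averaging over translated grids -/

section Averaging

variable {n : ℕ}

/-- In one coordinate a given cube of side `2^k` is compatible with the grid translated by `t` and
good for a proportion `2^{-k-1}` of all translations `t`. -/
lemma card_good_translations (k L w : ℕ) (x : ℤ) {ε : ℤ} (hε : ε = 0 ∨ ε = 1) :
    2 ^ (w + L) ≤ ((Finset.Ico (0 : ℤ) (2 ^ (k + L + 1 + w))).filter fun t =>
      (2 ^ k : ℤ) ∣ x - t ∧ (x - t) / 2 ^ (k + L) % 2 = ε).card := by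
  have hcard : (Finset.range (2 ^ w) ×ˢ Finset.range (2 ^ L)).card = 2 ^ (w + L) := by
    simp [pow_add]
  rw [← hcard]
  -- The distances `x - t` with the required divisibility and digit, within one period.
  set u : ℕ × ℕ → ℤ := fun s => 2 ^ k * (2 ^ L * (2 * s.1 + ε) + s.2) with hu
  have hA : (0 : ℤ) < 2 ^ k := by positivity
  have hB : (0 : ℤ) < 2 ^ L := by positivity
  have hW : (0 : ℤ) < 2 ^ w := by positivity
  have hpow : (2 : ℤ) ^ (k + L + 1 + w) = 2 ^ k * (2 ^ L * (2 * 2 ^ w)) := by ring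
  have hrange : ∀ s ∈ Finset.range (2 ^ w) ×ˢ Finset.range (2 ^ L),
      (s.1 : ℤ) + 1 ≤ 2 ^ w ∧ (s.2 : ℤ) + 1 ≤ 2 ^ L := by
    intro s hs
    rw [Finset.mem_product, Finset.mem_range, Finset.mem_range] at hs
    exact ⟨by exact_mod_cast hs.1, by exact_mod_cast hs.2⟩
  refine Finset.card_le_card_of_injOn (fun s => (x - u s) % 2 ^ (k + L + 1 + w)) ?_ ?_
  · intro s hs
    rw [Finset.mem_coe] at hs
    obtain ⟨h1, h2⟩ := hrange s hs
    have hmod := Int.emod_add_mul_ediv (x - u s) (2 ^ (k + L + 1 + w))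
    set t := (x - u s) % 2 ^ (k + L + 1 + w) with ht
    set e := (x - u s) / 2 ^ (k + L + 1 + w) with he
    have hxt : x - t = 2 ^ k * (s.2 + 2 ^ L * ((ε + 2 * (s.1 + 2 ^ w * e)))) := by
      have : x - t = u s + 2 ^ (k + L + 1 + w) * e := by linarith
      rw [this, hu, hpow]
      ring
    rw [Finset.coe_filter, Set.mem_ofPred_eq, Finset.mem_Ico]
    refine ⟨⟨Int.emod_nonneg _ (by positivity), Int.emod_lt_of_pos _ (by positivity)⟩, ?_, ?_⟩
    · rw [hxt]
      exact dvd_mul_right _ _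
    · rw [hxt, pow_add, ← Int.ediv_ediv_of_nonneg hA.le, Int.mul_ediv_cancel_left _ hA.ne',
        Int.add_mul_ediv_left _ _ hB.ne', Int.ediv_eq_zero_of_lt (by positivity) (by linarith),
        zero_add, Int.add_mul_emod_self_left]
      rcases hε with rfl | rfl <;> rfl
  · intro s hs s' hs' hss
    rw [Finset.mem_coe] at hs hs'
    obtain ⟨h1, h2⟩ := hrange s hs
    obtain ⟨h1', h2'⟩ := hrange s' hs'
    -- both values of `u` lie in the same period
    have hbound : ∀ s : ℕ × ℕ, (s.1 : ℤ) + 1 ≤ 2 ^ w → (s.2 : ℤ) + 1 ≤ 2 ^ L →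
        0 ≤ u s ∧ u s < 2 ^ (k + L + 1 + w) := by
      intro s h1 h2
      have hε0 : 0 ≤ ε := by rcases hε with h | h <;> simp [h]
      have hε1 : ε ≤ 1 := by rcases hε with h | h <;> simp [h]
      refine ⟨by positivity, ?_⟩
      rw [hpow]
      refine mul_lt_mul_of_pos_left ?_ hA
      have : (2 : ℤ) ^ L * (2 * s.1 + ε) ≤ 2 ^ L * (2 * 2 ^ w - 1) :=
        mul_le_mul_of_nonneg_left (by linarith) hB.le
      linarith
    have hb := hbound s h1 h2
    have hb' := hbound s' h1' h2'
    have huu : u s = u s' := by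
      have h3 : (x - u s) ≡ (x - u s') [ZMOD 2 ^ (k + L + 1 + w)] := hss
      have h4 := (Int.ModEq.refl x).sub h3
      rw [sub_sub_cancel, sub_sub_cancel] at h4
      have h5 : u s % 2 ^ (k + L + 1 + w) = u s' % 2 ^ (k + L + 1 + w) := h4
      rwa [Int.emod_eq_of_lt hb.1 hb.2, Int.emod_eq_of_lt hb'.1 hb'.2] at h5
    have h6 : (2 : ℤ) ^ L * (2 * s.1 + ε) + s.2 = 2 ^ L * (2 * s'.1 + ε) + s'.2 :=
      mul_left_cancel₀ hA.ne' huu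
    have h7 : (s.2 : ℤ) = s'.2 := by
      have h8 := congrArg (· % (2 ^ L : ℤ)) h6
      simp only [Int.mul_add_emod_self_left] at h8
      rwa [Int.emod_eq_of_lt (by positivity) (by linarith),
        Int.emod_eq_of_lt (by positivity) (by linarith)] at h8
    have h9 : (s.1 : ℤ) = s'.1 := by
      rw [h7] at h6
      have := mul_left_cancel₀ hB.ne' (add_right_cancel h6)
      linarith
    exact Prod.ext (by exact_mod_cast h9) (by exact_mod_cast h7)

lemma card_isGoodCube (m : Fin n → ℤ) (L j w : ℕ) (z : Fin n → ℤ)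
    [DecidablePred fun y => IsGoodCube m L y j z] :
    (2 ^ (w + L)) ^ n
      ≤ ((box n (j + 1 + L + 1 + w)).filter fun y => IsGoodCube m L y j z).card := by
  classical
  have hset : ((box n (j + 1 + L + 1 + w)).filter fun y => IsGoodCube m L y j z)
      = Fintype.piFinset fun i => (Finset.Ico (0 : ℤ) (2 ^ (j + 1 + L + 1 + w))).filter fun t =>
        (2 ^ (j + 1) : ℤ) ∣ z i - t ∧
          (z i - t) / 2 ^ (j + 1 + L) % 2 = if 0 ≤ m i then 0 else 1 := by
    ext y
    simp only [Finset.mem_filter, box, Fintype.mem_piFinset, IsGoodCube, forall_and]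
  rw [hset, Fintype.card_piFinset]
  calc (2 ^ (w + L)) ^ n = ∏ _i : Fin n, 2 ^ (w + L) := by simp
    _ ≤ _ := Finset.prod_le_prod' fun i _ =>
      card_good_translations (j + 1) L w (z i) (by split_ifs <;> simp)

/-- A two-colouring of the cubes of one level such that `m`-th neighbours, `m ≠ 0`, have different
colours. -/
lemma exists_colouring (m : Fin n → ℤ) (y : Fin n → ℤ) :
    ∃ col : ℕ → (Fin n → ℤ) → Bool, ∀ j z z', z ≠ z' →
      (∀ i, (2 ^ (j + 1) : ℤ) ∣ z i - y i) → col j z = col j z' →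
      z' ≠ fun i => z i + 2 ^ (j + 1) * m i := by
  by_cases hm : ∃ i, m i ≠ 0
  · obtain ⟨i, hi⟩ := hm
    -- the colour is the parity of the number of steps of length `m i` in the `i`-th coordinate
    refine ⟨fun j z => decide (Even ((z i - y i) / 2 ^ (j + 1) / m i)), ?_⟩
    rintro j z z' - hz hcol rfl
    obtain ⟨t, ht⟩ := hz i
    simp only [decide_eq_decide] at hcol
    have h1 : z i + 2 ^ (j + 1) * m i - y i = 2 ^ (j + 1) * (t + m i) := by linarith
    rw [h1, ht, Int.mul_ediv_cancel_left _ (by positivity),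
      Int.mul_ediv_cancel_left _ (by positivity), Int.add_ediv_of_dvd_right (dvd_refl _),
      Int.ediv_self hi, Int.even_add_one] at hcol
    tauto
  · push Not at hm
    exact ⟨fun _ _ => true, fun j z z' hne _ _ h => hne (by rw [h]; simp [hm])⟩

lemma eLpNorm_sum_le_of_discrete {G κ X : Type*} [NormedAddCommGroup X] [MeasurableSpace G]
    [Countable G] [MeasurableSingletonClass G] {p : ℝ≥0∞} (hp : 1 ≤ p) (s : Finset κ)
    (g : κ → G → X) :
    eLpNorm (fun a => ∑ i ∈ s, g i a) p Measure.count
      ≤ ∑ i ∈ s, eLpNorm (g i) p Measure.count := by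
  have : (fun a => ∑ i ∈ s, g i a) = ∑ i ∈ s, g i := by
    funext a
    rw [Finset.sum_apply]
  rw [this]
  exact eLpNorm_sum_le (fun i _ => StronglyMeasurable.of_discrete.aestronglyMeasurable) hp

variable {X : Type*} [NormedAddCommGroup X] [NormedSpace ℝ X]
  {𝕜 : Type*} [RCLike 𝕜] [NormedSpace 𝕜 X] [IsScalarTower ℝ 𝕜 X]

/-- The shift operator on the good cubes of one translated grid: the levels are sorted into
`L + 2` residue classes, and each class into two colours. -/
lemma good_shift_le_of_grid {p : ℝ≥0∞} (hp : 1 ≤ p) {β : ℝ≥0∞}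
    (hβ : IsDiscreteBound (Fin n → ℤ) p X β) {m : Fin n → ℤ} {L : ℕ} (hm : ∀ i, |m i| ≤ 2 ^ L)
    {Φ Ψ : ℕ → (Fin n → ℤ) → ℝ} (hΦ : ∀ j, IsExchangePair m j (Φ j) (Ψ j)) (y : Fin n → ℤ)
    {E : Finset (ℕ × (Fin n → ℤ))} (hgood : ∀ e ∈ E, IsGoodCube m L y e.1 e.2)
    {f : (Fin n → ℤ) → X} {F : Finset (Fin n → ℤ)} (hf : ∀ a ∉ F, f a = 0)
    {c : ℕ × (Fin n → ℤ) → 𝕜} (hc : ∀ e, ‖c e‖ ≤ 1) :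
    eLpNorm (fun a => ∑ e ∈ E, c e • Ψ e.1 (a - e.2) •
      (((2 : ℝ) ^ (e.1 + 1)) ^ n)⁻¹ • ∑ b ∈ F, Φ e.1 (b - e.2) • f b) p Measure.count
      ≤ (L + 2 : ℕ) * (2 * (2 * β ^ 2 * eLpNorm f p Measure.count)) := by
  classical
  obtain ⟨col, hcol⟩ := exists_colouring m y
  set T : ℕ × (Fin n → ℤ) → (Fin n → ℤ) → X := fun e a => c e • Ψ e.1 (a - e.2) •
      (((2 : ℝ) ^ (e.1 + 1)) ^ n)⁻¹ • ∑ b ∈ F, Φ e.1 (b - e.2) • f b with hT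
  have hsplit : (fun a => ∑ e ∈ E, T e a) = fun a => ∑ s ∈ Finset.range (L + 2) ×ˢ Finset.univ,
      ∑ e ∈ E with (e.1 % (L + 2), col e.1 e.2) = s, T e a := by
    funext a
    rw [Finset.sum_fiberwise_of_maps_to]
    intro e _
    simp [Nat.mod_lt]
  rw [hsplit]
  refine (eLpNorm_sum_le_of_discrete hp _ _).trans ?_
  have hone : ∀ s ∈ Finset.range (L + 2) ×ˢ (Finset.univ : Finset Bool),
      eLpNorm (fun a => ∑ e ∈ E with (e.1 % (L + 2), col e.1 e.2) = s, T e a) p Measure.count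
        ≤ 2 * β ^ 2 * eLpNorm f p Measure.count := by
    intro s _
    refine good_shift_le hp hβ hm hΦ y (ρ := s.1) ?_ ?_ ?_ hf hc
    · intro e he
      rw [← (Finset.mem_filter.1 he).2]
    · exact fun e he => hgood e (Finset.mem_filter.1 he).1
    · intro j z hz z' hz' hne
      rw [Finset.mem_filter] at hz hz'
      refine hcol j z z' hne (fun i => (hgood _ hz.1 i).1) ?_
      have := hz.2.trans hz'.2.symm
      exact (Prod.ext_iff.1 this).2
  refine (Finset.sum_le_card_nsmul _ _ _ hone).trans (le_of_eq ?_)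
  simp only [Finset.card_product, Finset.card_range, Finset.card_univ, Fintype.card_bool,
    nsmul_eq_mul, Nat.cast_mul, Nat.cast_ofNat]
  ring

open Classical in
/-- The weights by which the number of grids for which a cube is good is made independent of the
cube. -/
lemma exists_grid_weights (m : Fin n → ℤ) (L N : ℕ) :
    ∃ γ : ℕ → (Fin n → ℤ) → ℝ, (∀ j z, |γ j z| ≤ 1) ∧ ∀ j < N, ∀ z, (((2 : ℝ) ^ (j + 1)) ^ n)⁻¹
      = ((box n (N + L + 1)).card : ℝ)⁻¹ * 2 ^ n *
        (((box n (N + L + 1)).filter fun y => IsGoodCube m L y j z).card * γ j z) := by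
  set Y := box n (N + L + 1) with hY
  have hYpos : (0 : ℝ) < Y.card := by
    rw [hY, card_box]
    positivity
  set cnt : ℕ → (Fin n → ℤ) → ℝ := fun j z => (Y.filter fun y => IsGoodCube m L y j z).card
    with hcnt
  -- A proportion of at least `2^{-n} |Q|⁻¹` of the grids is good for a given cube of volume `|Q|`,
  -- hence the weights that normalise the proportion to this value are at most `1`.
  have hcount : ∀ j < N, ∀ z, (Y.card : ℝ) ≤ ((2 : ℝ) ^ (j + 1)) ^ n * 2 ^ n * cnt j z := by
    intro j hj z
    obtain ⟨w, hw⟩ := Nat.exists_eq_add_of_le (Nat.succ_le_of_lt hj)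
    have hNw : N + L + 1 = j + 1 + L + 1 + w := by omega
    have h1 := card_isGoodCube m L j w z
    rw [← hNw] at h1
    have h2 : ((2 : ℝ) ^ (w + L)) ^ n ≤ cnt j z := by
      simp only [hcnt]
      exact_mod_cast h1
    calc (Y.card : ℝ) = ((2 : ℝ) ^ (j + 1)) ^ n * 2 ^ n * (2 ^ (w + L)) ^ n := by
          rw [hY, card_box, hNw]
          push_cast
          rw [← mul_pow, ← mul_pow]
          congr 1
          ring
      _ ≤ _ := by gcongr
  have hcntpos : ∀ j < N, ∀ z, 0 < cnt j z := by
    intro j hj z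
    have h0 : 0 ≤ cnt j z := Nat.cast_nonneg _
    rcases h0.eq_or_lt with h | h
    · have := hcount j hj z
      rw [← h, mul_zero] at this
      linarith
    · exact h
  refine ⟨fun j z => if j < N then Y.card / (((2 : ℝ) ^ (j + 1)) ^ n * 2 ^ n * cnt j z) else 0,
    fun j z => ?_, fun j hj z => ?_⟩
  · dsimp only
    split_ifs with hj
    · have := hcntpos j hj z
      rw [abs_of_nonneg (by positivity)]
      exact div_le_one_of_le₀ (hcount j hj z) (by positivity)
    · simp
  · have h1 := hcntpos j hj z
    have h2 : (0 : ℝ) < ((2 : ℝ) ^ (j + 1)) ^ n := by positivity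
    simp only [if_pos hj]
    change _ = _ * _ * (cnt j z * _)
    field_simp

/-- The average over all cubes of the lattice of a shift operator: since each cube is good for a
fixed proportion of the translated grids, the average over all cubes is an average, over the
translated grids, of operators on good cubes only. -/
theorem average_shift_le {p : ℝ≥0∞} (hp : 1 ≤ p) {β : ℝ≥0∞}
    (hβ : IsDiscreteBound (Fin n → ℤ) p X β) {m : Fin n → ℤ} {L : ℕ} (hm : ∀ i, |m i| ≤ 2 ^ L)
    {Φ Ψ : ℕ → (Fin n → ℤ) → ℝ} (hΦ : ∀ j, IsExchangePair m j (Φ j) (Ψ j)) (N : ℕ)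
    (Z : Finset (Fin n → ℤ))
    {f : (Fin n → ℤ) → X} {F : Finset (Fin n → ℤ)} (hf : ∀ a ∉ F, f a = 0)
    {c : ℕ → (Fin n → ℤ) → 𝕜} (hc : ∀ j z, ‖c j z‖ ≤ 1) :
    eLpNorm (fun a => ∑ j ∈ Finset.range N, ∑ z ∈ Z, (((2 : ℝ) ^ (j + 1)) ^ n)⁻¹ •
      c j z • Ψ j (a - z) • (((2 : ℝ) ^ (j + 1)) ^ n)⁻¹ • ∑ b ∈ F, Φ j (b - z) • f b) p
        Measure.count
      ≤ 2 ^ n * ((L + 2 : ℕ) * (2 * (2 * β ^ 2 * eLpNorm f p Measure.count))) := by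
  classical
  obtain ⟨γ, hγ1, hγ⟩ := exists_grid_weights m L N
  have hYpos : (0 : ℝ) < (box n (N + L + 1)).card := by
    rw [card_box]
    positivity
  generalize box n (N + L + 1) = Y at hγ hYpos
  have hc' : ∀ e : ℕ × (Fin n → ℤ), ‖(γ e.1 e.2 : 𝕜) * c e.1 e.2‖ ≤ 1 := by
    intro e
    rw [norm_mul, RCLike.norm_ofReal]
    exact mul_le_one₀ (hγ1 _ _) (norm_nonneg _) (hc _ _)
  let T : ℕ × (Fin n → ℤ) → (Fin n → ℤ) → X := fun e a =>
    ((γ e.1 e.2 : 𝕜) * c e.1 e.2) • Ψ e.1 (a - e.2) •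
      (((2 : ℝ) ^ (e.1 + 1)) ^ n)⁻¹ • ∑ b ∈ F, Φ e.1 (b - e.2) • f b
  let V : (Fin n → ℤ) → (Fin n → ℤ) → X := fun y a =>
    ∑ e ∈ Finset.range N ×ˢ Z with IsGoodCube m L y e.1 e.2, T e a
  have hrep : (fun a => ∑ j ∈ Finset.range N, ∑ z ∈ Z, (((2 : ℝ) ^ (j + 1)) ^ n)⁻¹ •
      c j z • Ψ j (a - z) • (((2 : ℝ) ^ (j + 1)) ^ n)⁻¹ • ∑ b ∈ F, Φ j (b - z) • f b)
      = ((Y.card : ℝ)⁻¹ * 2 ^ n) • fun a => ∑ y ∈ Y, V y a := by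
    funext a
    rw [Pi.smul_apply, ← Finset.sum_product']
    simp only [V, Finset.sum_filter]
    rw [Finset.sum_comm, Finset.smul_sum]
    refine Finset.sum_congr rfl fun e he => ?_
    have hj : e.1 < N := Finset.mem_range.1 (Finset.mem_product.1 he).1
    rw [← Finset.sum_filter, Finset.sum_const, ← Nat.cast_smul_eq_nsmul ℝ]
    simp only [T]
    generalize (((2 : ℝ) ^ (e.1 + 1)) ^ n)⁻¹ • ∑ b ∈ F, Φ e.1 (b - e.2) • f b = x
    rw [mul_smul ((γ e.1 e.2 : ℝ) : 𝕜) (c e.1 e.2), ← RCLike.real_smul_eq_coe_smul, smul_smul,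
      smul_smul, hγ e.1 hj e.2]
    congr 1
    ring
  rw [hrep, eLpNorm_const_smul]
  have hgrid : ∀ y ∈ Y, eLpNorm (V y) p Measure.count
      ≤ (L + 2 : ℕ) * (2 * (2 * β ^ 2 * eLpNorm f p Measure.count)) := fun y _ =>
    good_shift_le_of_grid hp hβ hm hΦ y (fun e he => (Finset.mem_filter.1 he).2) hf hc'
  have hsum := (eLpNorm_sum_le_of_discrete hp Y V).trans (Finset.sum_le_card_nsmul _ _ _ hgrid)
  generalize ((L + 2 : ℕ) * (2 * (2 * β ^ 2 * eLpNorm f p Measure.count)) : ℝ≥0∞) = B at hsum ⊢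
  have hscale : ‖(Y.card : ℝ)⁻¹ * 2 ^ n‖ₑ * Y.card = 2 ^ n := by
    rw [Real.enorm_eq_ofReal (by positivity), ← ENNReal.ofReal_natCast,
      ← ENNReal.ofReal_mul (by positivity),
      show (Y.card : ℝ)⁻¹ * 2 ^ n * Y.card = 2 ^ n by field_simp,
      ENNReal.ofReal_pow (by norm_num)]
    norm_num
  calc _ ≤ ‖(Y.card : ℝ)⁻¹ * 2 ^ n‖ₑ * (Y.card • B) := mul_le_mul_right hsum _
    _ = _ := by rw [nsmul_eq_mul, ← mul_assoc, hscale]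

end Averaging

/-! ### Discrete Haar functions -/

section Signs

variable {n : ℕ}

/-- The values of the one-dimensional functions `h⁰` and `h¹` of `[0, 2)`, without the
normalisation, on `[q, q + 1)`. -/
noncomputable def signOne (e : Fin 2) (q : ℤ) : ℝ :=
  if q = 0 then 1 else if q = 1 then (if e = 0 then 1 else -1) else 0

/-- The values `±1` of the Haar function with signature `θ` of the lattice cube `[0, 2^{j+1})ⁿ`,
extended by `0`. For `θ = 0` this is the indicator function of the cube. -/
noncomputable def sg (θ : Fin n → Fin 2) (j : ℕ) (b : Fin n → ℤ) : ℝ :=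
  ∏ i, signOne (θ i) (b i / 2 ^ j)

lemma ediv_two_pow_succ (b : ℤ) (j : ℕ) : b / 2 ^ (j + 1) = b / 2 ^ j / 2 := by
  rw [pow_succ, Int.ediv_ediv_of_nonneg (by positivity)]

lemma sg_congr (θ : Fin n → Fin 2) {j : ℕ} {a b : Fin n → ℤ}
    (h : ∀ i, a i / 2 ^ j = b i / 2 ^ j) : sg θ j a = sg θ j b := by
  simp only [sg, h]

lemma sg_eq_zero (θ : Fin n → Fin 2) {j : ℕ} {b : Fin n → ℤ} (h : b ∉ box n (j + 1)) :
    sg θ j b = 0 := by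
  rw [mem_box_iff_ediv] at h
  push Not at h
  obtain ⟨i, hi⟩ := h
  refine Finset.prod_eq_zero (Finset.mem_univ i) ?_
  rw [ediv_two_pow_succ] at hi
  unfold signOne
  rw [if_neg (by rintro h; rw [h] at hi; exact hi rfl),
    if_neg (by rintro h; rw [h] at hi; exact hi rfl)]

lemma sg_eq_one_or (θ : Fin n → Fin 2) {j : ℕ} {b : Fin n → ℤ} (h : b ∈ box n (j + 1)) :
    sg θ j b = 1 ∨ sg θ j b = -1 := by
  rw [mem_box_iff_ediv] at h
  refine Finset.prod_induction _ (fun x : ℝ => x = 1 ∨ x = -1) ?_ (Or.inl rfl) ?_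
  · rintro _ _ (rfl | rfl) (rfl | rfl) <;> norm_num
  · intro i _
    have hi := h i
    rw [ediv_two_pow_succ] at hi
    have : b i / 2 ^ j = 0 ∨ b i / 2 ^ j = 1 := by omega
    unfold signOne
    rcases this with h | h <;> rw [h] <;> by_cases he : θ i = 0 <;> simp [he]

lemma sg_zero_of_mem {j : ℕ} {b : Fin n → ℤ} (h : b ∈ box n (j + 1)) : sg 0 j b = 1 := by
  rw [mem_box_iff_ediv] at h
  refine Finset.prod_eq_one fun i _ => ?_
  have hi := h i
  rw [ediv_two_pow_succ] at hi
  have : b i / 2 ^ j = 0 ∨ b i / 2 ^ j = 1 := by omega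
  unfold signOne
  rcases this with h | h <;> rw [h] <;> simp

lemma sg_mul_self (θ : Fin n → Fin 2) (j : ℕ) (b : Fin n → ℤ) :
    sg θ j b * sg θ j b = sg 0 j b := by
  by_cases h : b ∈ box n (j + 1)
  · rw [sg_zero_of_mem h]
    rcases sg_eq_one_or θ h with h | h <;> rw [h] <;> norm_num
  · rw [sg_eq_zero θ h, sg_eq_zero 0 h, mul_zero]

lemma sum_signOne (j : ℕ) {e : Fin 2} (he : e ≠ 0) :
    ∑ x ∈ Finset.Ico (0 : ℤ) (2 ^ (j + 1)), signOne e (x / 2 ^ j) = 0 := by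
  have hpos : (0 : ℤ) < 2 ^ j := by positivity
  have hval : ∀ x ∈ Finset.Ico (0 : ℤ) (2 ^ (j + 1)),
      signOne e (x / 2 ^ j) = if x < 2 ^ j then 1 else -1 := by
    intro x hx
    rw [Finset.mem_Ico, pow_succ] at hx
    split_ifs with h
    · rw [Int.ediv_eq_zero_of_lt hx.1 h]
      simp [signOne]
    · rw [(Int.ediv_eq_iff_mem_Ico (q := 1) hpos).2 (by constructor <;> linarith)]
      simp [signOne, he]
  rw [Finset.sum_congr rfl hval]
  -- the two halves of the interval are exchanged
  refine Finset.sum_involution (fun x _ => if x < 2 ^ j then x + 2 ^ j else x - 2 ^ j) ?_ ?_ ?_ ?_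
  · intro x hx
    rw [Finset.mem_Ico, pow_succ] at hx
    by_cases h : x < 2 ^ j
    · rw [if_pos h, if_pos h, if_neg (by linarith)]
      norm_num
    · rw [if_neg h, if_neg h, if_pos (by linarith)]
      norm_num
  · intro x _ _
    split_ifs <;> linarith
  · intro x hx
    rw [Finset.mem_Ico, pow_succ] at hx ⊢
    split_ifs with h <;> constructor <;> linarith
  · intro x hx
    rw [Finset.mem_Ico, pow_succ] at hx
    by_cases h : x < 2 ^ j
    · simp only [if_pos h]
      rw [if_neg (by linarith)]
      ring
    · simp only [if_neg h]
      rw [if_pos (by linarith)]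
      ring

lemma sum_sg {θ : Fin n → Fin 2} (hθ : θ ≠ 0) (j : ℕ) : ∑ b ∈ box n (j + 1), sg θ j b = 0 := by
  obtain ⟨i, hi⟩ := Function.ne_iff.1 hθ
  rw [box]
  simp only [sg]
  rw [← Finset.prod_univ_sum (fun _ => Finset.Ico (0 : ℤ) (2 ^ (j + 1)))
    fun i x => signOne (θ i) (x / 2 ^ j)]
  exact Finset.prod_eq_zero (Finset.mem_univ i) (sum_signOne j hi)

lemma sum_sg_zero (j : ℕ) : ∑ b ∈ box n (j + 1), sg 0 j b = (2 ^ (j + 1)) ^ n := by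
  rw [Finset.sum_congr rfl fun b hb => sg_zero_of_mem hb]
  simp [card_box]

/-- The translate of a lattice function by `2^{j+1} m`. -/
def trans (m : Fin n → ℤ) (j : ℕ) (g : (Fin n → ℤ) → ℝ) (b : Fin n → ℤ) : ℝ :=
  g fun i => b i - 2 ^ (j + 1) * m i

lemma trans_zero (j : ℕ) (g : (Fin n → ℤ) → ℝ) : trans 0 j g = g := by
  funext b
  simp [trans]

lemma sum_twoBoxes (m : Fin n → ℤ) {j : ℕ} {g : (Fin n → ℤ) → ℝ}
    (hg : ∀ b ∉ box n (j + 1), g b = 0) :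
    ∑ b ∈ twoBoxes m j, g b = ∑ b ∈ box n (j + 1), g b :=
  (Finset.sum_subset Finset.subset_union_left fun b _ hb => hg b hb).symm

lemma trans_eq_zero {m : Fin n → ℤ} {j : ℕ} {g : (Fin n → ℤ) → ℝ}
    (hg : ∀ b ∉ box n (j + 1), g b = 0) {b : Fin n → ℤ}
    (hb : b ∉ (box n (j + 1)).map (addRightEmbedding fun i => 2 ^ (j + 1) * m i)) :
    trans m j g b = 0 := by
  refine hg _ fun h => hb (Finset.mem_map.2 ⟨_, h, ?_⟩)
  funext i
  simp

lemma sum_twoBoxes_trans (m : Fin n → ℤ) {j : ℕ} {g : (Fin n → ℤ) → ℝ}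
    (hg : ∀ b ∉ box n (j + 1), g b = 0) :
    ∑ b ∈ twoBoxes m j, trans m j g b = ∑ b ∈ box n (j + 1), g b := by
  rw [twoBoxes, ← Finset.sum_subset Finset.subset_union_right fun b _ hb => trans_eq_zero hg hb,
    Finset.sum_map]
  refine Finset.sum_congr rfl fun b _ => congrArg g ?_
  funext i
  simp

lemma trans_congr (m : Fin n → ℤ) {j : ℕ} {g : (Fin n → ℤ) → ℝ}
    (hg : ∀ a b : Fin n → ℤ, (∀ i, a i / 2 ^ j = b i / 2 ^ j) → g a = g b)
    (a b : Fin n → ℤ) (h : ∀ i, a i / 2 ^ j = b i / 2 ^ j) : trans m j g a = trans m j g b := by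
  refine hg _ _ fun i => ?_
  have key : ∀ x : ℤ, (x - 2 ^ (j + 1) * m i) / 2 ^ j = x / 2 ^ j - 2 * m i := by
    intro x
    rw [show x - 2 ^ (j + 1) * m i = x + 2 ^ j * (-(2 * m i)) by ring,
      Int.add_mul_ediv_left _ _ (by positivity)]
    ring
  rw [key, key, h i]

lemma mul_trans_eq_zero {m : Fin n → ℤ} (hm : m ≠ 0) {j : ℕ} {g g' : (Fin n → ℤ) → ℝ}
    (hg : ∀ b ∉ box n (j + 1), g b = 0) (hg' : ∀ b ∉ box n (j + 1), g' b = 0) (b : Fin n → ℤ) :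
    g b * trans m j g' b = 0 := by
  by_cases hb : b ∈ box n (j + 1)
  · refine mul_eq_zero_of_right _ (hg' _ fun h => hm ?_)
    rw [mem_box_iff_ediv] at hb h
    funext i
    have := h i
    rw [sub_eq_add_neg, ← mul_neg, Int.add_mul_ediv_left _ _ (by positivity), hb i] at this
    simpa using this
  · rw [hg b hb, zero_mul]

lemma sg_mem (θ : Fin n → Fin 2) (j : ℕ) (b : Fin n → ℤ) :
    sg θ j b = -1 ∨ sg θ j b = 0 ∨ sg θ j b = 1 := by
  by_cases h : b ∈ box n (j + 1)
  · rcases sg_eq_one_or θ h with h | h <;> simp [h]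
  · simp [sg_eq_zero θ h]

lemma IsExchangePair.symm {m : Fin n → ℤ} {j : ℕ} {Φ Ψ : (Fin n → ℤ) → ℝ}
    (h : IsExchangePair m j Φ Ψ) : IsExchangePair m j Ψ Φ where
  supp_left := h.supp_right
  supp_right := h.supp_left
  const_left := h.const_right
  const_right := h.const_left
  val_left := h.val_right
  val_right := h.val_left
  sum_left := h.sum_right
  sum_right := h.sum_left
  sq_left := h.sq_right
  sq_right := h.sq_left
  sum_mixed := by
    simp only [fun a => mul_comm (Ψ a ^ 2) (Φ a), fun a => mul_comm (Ψ a) (Φ a ^ 2)]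
    exact h.sum_mixed.symm

lemma notMem_twoBoxes {m : Fin n → ℤ} {j : ℕ} {b : Fin n → ℤ} (hb : b ∉ twoBoxes m j) :
    b ∉ box n (j + 1) ∧
      b ∉ (box n (j + 1)).map (addRightEmbedding fun i => 2 ^ (j + 1) * m i) := by
  rwa [twoBoxes, Finset.mem_union, not_or] at hb

/-- Two cancellative Haar functions, one of them on the `m`-th neighbour. -/
lemma isExchangePair_haar {η θ : Fin n → Fin 2} (hη : η ≠ 0) (hθ : θ ≠ 0) (m : Fin n → ℤ)
    (j : ℕ) : IsExchangePair m j (sg θ j) (trans m j (sg η j)) where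
  supp_left b hb := sg_eq_zero θ (notMem_twoBoxes hb).1
  supp_right b hb := trans_eq_zero (fun _ => sg_eq_zero η) (notMem_twoBoxes hb).2
  const_left _ _ h := sg_congr θ h
  const_right := trans_congr m fun _ _ h => sg_congr η h
  val_left := sg_mem θ j
  val_right _ := sg_mem η j _
  sum_left := by rw [sum_twoBoxes m fun _ => sg_eq_zero θ, sum_sg hθ]
  sum_right := by rw [sum_twoBoxes_trans m fun _ => sg_eq_zero η, sum_sg hη]
  sq_left := by
    simp only [sq, sg_mul_self]
    rw [sum_twoBoxes m fun _ => sg_eq_zero 0, sum_sg_zero]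
  sq_right := by
    have h : ∀ a, trans m j (sg η j) a ^ 2 = trans m j (sg 0 j) a := fun a => by
      rw [sq, trans, sg_mul_self, trans]
    simp only [h]
    rw [sum_twoBoxes_trans m fun _ => sg_eq_zero 0, sum_sg_zero]
  sum_mixed := by
    by_cases hm : m = 0
    · subst hm
      have hz : ∀ θ η : Fin n → Fin 2, ∀ a, sg θ j a ^ 2 * sg η j a = sg η j a := by
        intro θ η a
        rw [sq, sg_mul_self]
        by_cases h : a ∈ box n (j + 1)
        · rw [sg_zero_of_mem h, one_mul]
        · rw [sg_eq_zero η h, mul_zero]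
      simp only [trans_zero, hz, fun a => mul_comm (sg θ j a) (sg η j a ^ 2)]
      rw [sum_twoBoxes 0 fun _ => sg_eq_zero θ, sum_twoBoxes 0 fun _ => sg_eq_zero η, sum_sg hθ,
        sum_sg hη]
    · refine Finset.sum_congr rfl fun a _ => ?_
      have h := mul_trans_eq_zero hm (fun _ => sg_eq_zero θ (j := j))
        (fun _ => sg_eq_zero η (j := j)) a
      linear_combination (sg θ j a - trans m j (sg η j) a) * h

/-- The indicator function of the part of the cube where the Haar function has the sign `δ`. -/
noncomputable def half (δ : ℝ) (θ : Fin n → Fin 2) (j : ℕ) (b : Fin n → ℤ) : ℝ :=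
  (sg 0 j b + δ * sg θ j b) / 2

lemma half_eq_zero (δ : ℝ) (θ : Fin n → Fin 2) {j : ℕ} {b : Fin n → ℤ} (h : b ∉ box n (j + 1)) :
    half δ θ j b = 0 := by
  simp [half, sg_eq_zero _ h]

lemma half_congr (δ : ℝ) (θ : Fin n → Fin 2) {j : ℕ} {a b : Fin n → ℤ}
    (h : ∀ i, a i / 2 ^ j = b i / 2 ^ j) : half δ θ j a = half δ θ j b := by
  rw [half, half, sg_congr 0 h, sg_congr θ h]

lemma half_mem {δ : ℝ} (hδ : δ = 1 ∨ δ = -1) (θ : Fin n → Fin 2) (j : ℕ) (b : Fin n → ℤ) :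
    (half δ θ j b = 0 ∨ half δ θ j b = 1) ∧ sg θ j b * half δ θ j b = δ * half δ θ j b ∧
      sg θ j b ^ 2 * half δ θ j b = half δ θ j b := by
  unfold half
  by_cases h : b ∈ box n (j + 1)
  · rw [sg_zero_of_mem h]
    rcases sg_eq_one_or θ h with h | h <;> rcases hδ with rfl | rfl <;> rw [h] <;> norm_num
  · simp [sg_eq_zero _ h]

lemma sum_half (δ : ℝ) {θ : Fin n → Fin 2} (hθ : θ ≠ 0) (j : ℕ) :
    ∑ b ∈ box n (j + 1), half δ θ j b = (2 ^ (j + 1)) ^ n / 2 := by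
  simp only [half]
  rw [← Finset.sum_div, Finset.sum_add_distrib, ← Finset.mul_sum, sum_sg_zero, sum_sg hθ]
  simp

/-- A cancellative Haar function of a cube and the difference of a half of the cube and the
corresponding half of its `m`-th neighbour. -/
lemma isExchangePair_half {δ : ℝ} (hδ : δ = 1 ∨ δ = -1) {θ : Fin n → Fin 2} (hθ : θ ≠ 0)
    {m : Fin n → ℤ} (hm : m ≠ 0) (j : ℕ) :
    IsExchangePair m j (sg θ j) (fun b => δ * (half δ θ j b - trans m j (half δ θ j) b)) := by
  have hs : ∀ b ∉ box n (j + 1), half δ θ j b = 0 := fun _ => half_eq_zero δ θ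
  have hδ2 : δ ^ 2 = 1 := by rcases hδ with rfl | rfl <;> norm_num
  have hh := half_mem hδ θ j
  have hp := mul_trans_eq_zero hm hs hs
  have hp' := mul_trans_eq_zero hm (fun _ => sg_eq_zero θ (j := j)) hs
  have hsq : ∀ b, half δ θ j b ^ 2 = half δ θ j b := fun b => by
    rcases (hh b).1 with h | h <;> rw [h] <;> norm_num
  refine ⟨fun b hb => sg_eq_zero θ (notMem_twoBoxes hb).1, ?_, fun _ _ h => sg_congr θ h, ?_,
    sg_mem θ j, ?_, ?_, ?_, ?_, ?_, ?_⟩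
  · intro b hb
    rw [hs b (notMem_twoBoxes hb).1, trans_eq_zero hs (notMem_twoBoxes hb).2, sub_zero, mul_zero]
  · intro a b h
    rw [half_congr δ θ h, trans_congr m (fun _ _ h => half_congr δ θ h) a b h]
  · intro b
    have h1 := (hh b).1
    have h2 : trans m j (half δ θ j) b = 0 ∨ trans m j (half δ θ j) b = 1 := (hh _).1
    rcases h1 with h1 | h1 <;> rcases h2 with h2 | h2 <;> rw [h1, h2] <;>
      rcases hδ with rfl | rfl <;> norm_num
  · rw [sum_twoBoxes m fun _ => sg_eq_zero θ, sum_sg hθ]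
  · rw [← Finset.mul_sum, Finset.sum_sub_distrib, sum_twoBoxes m hs, sum_twoBoxes_trans m hs]
    simp
  · simp only [sq, sg_mul_self]
    rw [sum_twoBoxes m fun _ => sg_eq_zero 0, sum_sg_zero]
  · have h : ∀ b, (δ * (half δ θ j b - trans m j (half δ θ j) b)) ^ 2
        = half δ θ j b + trans m j (half δ θ j) b := by
      intro b
      have h2 : trans m j (half δ θ j) b ^ 2 = trans m j (half δ θ j) b := hsq _
      linear_combination (half δ θ j b - trans m j (half δ θ j) b) ^ 2 * hδ2 - 2 * hp b
        + hsq b + h2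
    simp only [h]
    rw [Finset.sum_add_distrib, sum_twoBoxes m hs, sum_twoBoxes_trans m hs, sum_half δ hθ]
    ring
  · refine Finset.sum_congr rfl fun b _ => ?_
    have h1 := (hh b).2.1
    have h2 := (hh b).2.2
    linear_combination δ * h2 - h1 - δ * sg θ j b * hp' b
      - sg θ j b * (half δ θ j b - trans m j (half δ θ j) b) ^ 2 * hδ2 + 2 * sg θ j b * hp b
      - sg θ j b * hsq b - trans m j (half δ θ j) b * hp' b

lemma sg_zero_sub_trans (θ : Fin n → Fin 2) (m : Fin n → ℤ) (j : ℕ) (b : Fin n → ℤ) :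
    trans m j (sg 0 j) b - sg 0 j b
      = (-1) * (half (-1) θ j b - trans m j (half (-1) θ j) b)
        - 1 * (half 1 θ j b - trans m j (half 1 θ j) b) := by
  simp only [half, trans]
  ring

end Signs

/-! ### Kernels of shift operators -/

section Kernels

variable {n : ℕ}

/-- The kernel `∑ⱼ ∑_z |Q|⁻³ c_j(z) Ψ_j(a - z) Φ_j(b - z)`, where `|Q| = 2^{(j+1)n}` is the volume
of the cubes of generation `j`. -/
noncomputable def shiftKernel {𝕜 : Type*} [RCLike 𝕜] (N : ℕ) (Z : Finset (Fin n → ℤ))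
    (c : ℕ → (Fin n → ℤ) → 𝕜) (Ψ Φ : ℕ → (Fin n → ℤ) → ℝ) (a b : Fin n → ℤ) : 𝕜 :=
  ∑ j ∈ Finset.range N, ∑ z ∈ Z,
    ((((2 ^ (j + 1)) ^ n)⁻¹ ^ 3 * (Ψ j (a - z) * Φ j (b - z)) : ℝ) : 𝕜) * c j z

lemma eLpNorm_sub_kernel_le {X 𝕜 : Type*} [NormedAddCommGroup X] [RCLike 𝕜] [NormedSpace 𝕜 X]
    {p : ℝ≥0∞} (hp : 1 ≤ p) (k₁ k₂ : (Fin n → ℤ) → (Fin n → ℤ) → 𝕜)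
    (F : Finset (Fin n → ℤ)) (f : (Fin n → ℤ) → X) {B : ℝ≥0∞}
    (h₁ : eLpNorm (fun a => ∑ b ∈ F, k₁ a b • f b) p Measure.count ≤ B)
    (h₂ : eLpNorm (fun a => ∑ b ∈ F, k₂ a b • f b) p Measure.count ≤ B) :
    eLpNorm (fun a => ∑ b ∈ F, (k₁ a b - k₂ a b) • f b) p Measure.count ≤ 2 * B := by
  have h : (fun a => ∑ b ∈ F, (k₁ a b - k₂ a b) • f b)
      = (fun a => ∑ b ∈ F, k₁ a b • f b) - fun a => ∑ b ∈ F, k₂ a b • f b := by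
    funext a
    simp [sub_smul]
  rw [h, two_mul]
  refine (eLpNorm_sub_le ?_ ?_ hp).trans (add_le_add h₁ h₂) <;>
  exact StronglyMeasurable.of_discrete.aestronglyMeasurable

variable {X : Type*} [NormedAddCommGroup X] [NormedSpace ℝ X]
  {𝕜 : Type*} [RCLike 𝕜] [NormedSpace 𝕜 X] [IsScalarTower ℝ 𝕜 X]

/-- The bound for a family of exchange pairs, for coefficients of size at most `C |Q|`. -/
lemma shiftKernel_le {p : ℝ≥0∞} (hp : 1 ≤ p) {β : ℝ≥0∞}
    (hβ : IsDiscreteBound (Fin n → ℤ) p X β) {m : Fin n → ℤ} {L : ℕ} (hm : ∀ i, |m i| ≤ 2 ^ L)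
    {Φ Ψ : ℕ → (Fin n → ℤ) → ℝ} (hΦ : ∀ j, IsExchangePair m j (Φ j) (Ψ j)) (N : ℕ)
    (Z : Finset (Fin n → ℤ))
    {f : (Fin n → ℤ) → X} {F : Finset (Fin n → ℤ)} (hf : ∀ a ∉ F, f a = 0)
    {C : ℝ≥0} {c : ℕ → (Fin n → ℤ) → 𝕜} (hc : ∀ j z, ‖c j z‖ ≤ (2 ^ (j + 1)) ^ n * C) :
    eLpNorm (fun a => ∑ b ∈ F, shiftKernel N Z c Ψ Φ a b • f b) p Measure.count
      ≤ C * (2 ^ n * ((L + 2 : ℕ) * (2 * (2 * β ^ 2 * eLpNorm f p Measure.count)))) := by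
  by_cases hC : C = 0
  · have : (fun a => ∑ b ∈ F, shiftKernel N Z c Ψ Φ a b • f b) = 0 := by
      funext a
      refine Finset.sum_eq_zero fun b _ => ?_
      rw [shiftKernel, Finset.sum_eq_zero, zero_smul]
      intro j _
      refine Finset.sum_eq_zero fun z _ => ?_
      have := hc j z
      rw [hC, NNReal.coe_zero, mul_zero, norm_le_zero_iff] at this
      rw [this, mul_zero]
    rw [this]
    simp
  have hC0 : (0 : ℝ) < C := by positivity
  let c' : ℕ → (Fin n → ℤ) → 𝕜 := fun j z => ((((2 ^ (j + 1)) ^ n * C)⁻¹ : ℝ) : 𝕜) * c j z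
  have hc' : ∀ j z, ‖c' j z‖ ≤ 1 := by
    intro j z
    simp only [c']
    rw [norm_mul, RCLike.norm_ofReal, abs_of_nonneg (by positivity),
      inv_mul_le_iff₀ (by positivity), mul_one]
    exact hc j z
  have hrep : (fun a => ∑ b ∈ F, shiftKernel N Z c Ψ Φ a b • f b)
      = (C : ℝ) • fun a => ∑ j ∈ Finset.range N, ∑ z ∈ Z, (((2 : ℝ) ^ (j + 1)) ^ n)⁻¹ •
      c' j z • Ψ j (a - z) • (((2 : ℝ) ^ (j + 1)) ^ n)⁻¹ • ∑ b ∈ F, Φ j (b - z) • f b := by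
    funext a
    simp only [Pi.smul_apply, shiftKernel, Finset.sum_smul]
    rw [Finset.sum_comm, Finset.smul_sum]
    refine Finset.sum_congr rfl fun j _ => ?_
    rw [Finset.sum_comm, Finset.smul_sum]
    refine Finset.sum_congr rfl fun z _ => ?_
    simp only [Finset.smul_sum]
    refine Finset.sum_congr rfl fun b _ => ?_
    simp only [RCLike.real_smul_eq_coe_smul (K := 𝕜) (E := X), smul_smul, c']
    congr 1
    push_cast
    have h1 : ((2 : 𝕜) ^ (j + 1)) ^ n ≠ 0 := pow_ne_zero _ (pow_ne_zero _ two_ne_zero)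
    have h2 : ((C : ℝ) : 𝕜) ≠ 0 := by exact_mod_cast hC0.ne'
    field_simp
  rw [hrep, eLpNorm_const_smul]
  refine mul_le_mul' (le_of_eq ?_) (average_shift_le hp hβ hm hΦ N Z hf hc')
  rw [Real.enorm_eq_ofReal hC0.le, ENNReal.ofReal_coe_nnreal]

/-- The kernel of an operator with two cancellative Haar functions. -/
lemma haarKernel_le {p : ℝ≥0∞} (hp : 1 ≤ p) {β : ℝ≥0∞}
    (hβ : IsDiscreteBound (Fin n → ℤ) p X β) {η θ : Fin n → Fin 2} (hη : η ≠ 0) (hθ : θ ≠ 0)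
    {m : Fin n → ℤ} {L : ℕ} (hm : ∀ i, |m i| ≤ 2 ^ L) (N : ℕ) (Z : Finset (Fin n → ℤ))
    {f : (Fin n → ℤ) → X} {F : Finset (Fin n → ℤ)} (hf : ∀ a ∉ F, f a = 0)
    {C : ℝ≥0} {c : ℕ → (Fin n → ℤ) → 𝕜} (hc : ∀ j z, ‖c j z‖ ≤ (2 ^ (j + 1)) ^ n * C) :
    eLpNorm (fun a => ∑ b ∈ F,
      shiftKernel N Z c (fun j => trans m j (sg η j)) (fun j => sg θ j) a b • f b) p Measure.count
      ≤ 2 * (C * (2 ^ n * ((L + 2 : ℕ) * (2 * (2 * β ^ 2 * eLpNorm f p Measure.count))))) :=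
  (shiftKernel_le hp hβ hm (isExchangePair_haar hη hθ m) N Z hf hc).trans
    (le_mul_of_one_le_left' (by norm_num))

/-- The kernel of an operator with the difference of the indicator functions of two cubes in the
range. -/
lemma diffKernel_le {p : ℝ≥0∞} (hp : 1 ≤ p) {β : ℝ≥0∞}
    (hβ : IsDiscreteBound (Fin n → ℤ) p X β) {θ : Fin n → Fin 2} (hθ : θ ≠ 0)
    {m : Fin n → ℤ} {L : ℕ} (hm : ∀ i, |m i| ≤ 2 ^ L) (N : ℕ) (Z : Finset (Fin n → ℤ))
    {f : (Fin n → ℤ) → X} {F : Finset (Fin n → ℤ)} (hf : ∀ a ∉ F, f a = 0)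
    {C : ℝ≥0} {c : ℕ → (Fin n → ℤ) → 𝕜} (hc : ∀ j z, ‖c j z‖ ≤ (2 ^ (j + 1)) ^ n * C) :
    eLpNorm (fun a => ∑ b ∈ F, shiftKernel N Z c
      (fun j b => trans m j (sg 0 j) b - sg 0 j b) (fun j => sg θ j) a b • f b) p Measure.count
      ≤ 2 * (C * (2 ^ n * ((L + 2 : ℕ) * (2 * (2 * β ^ 2 * eLpNorm f p Measure.count))))) := by
  by_cases hm0 : m = 0
  · have h : ∀ a b, shiftKernel N Z c (fun j b => trans m j (sg 0 j) b - sg 0 j b)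
        (fun j => sg θ j) a b = 0 := fun a b =>
      Finset.sum_eq_zero fun j _ => Finset.sum_eq_zero fun z _ => by
        simp [hm0, trans_zero]
    simp only [h, zero_smul, Finset.sum_const_zero]
    simp
  -- The indicator function of the cube is the sum of those of the halves where `h^θ` is positive
  -- and negative; each half minus its translate is exchangeable with `h^θ`.
  have hsplit : ∀ a b, shiftKernel N Z c (fun j b => trans m j (sg 0 j) b - sg 0 j b)
      (fun j => sg θ j) a b
      = shiftKernel N Z c (fun j b => (-1) * (half (-1) θ j b - trans m j (half (-1) θ j) b))
          (fun j => sg θ j) a b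
        - shiftKernel N Z c (fun j b => 1 * (half 1 θ j b - trans m j (half 1 θ j) b))
          (fun j => sg θ j) a b := by
    intro a b
    simp only [shiftKernel, ← Finset.sum_sub_distrib, sg_zero_sub_trans θ, ← sub_mul]
    refine Finset.sum_congr rfl fun j _ => Finset.sum_congr rfl fun z _ => ?_
    push_cast
    ring
  simp only [hsplit]
  exact eLpNorm_sub_kernel_le hp _ _ F f
    (shiftKernel_le hp hβ hm (isExchangePair_half (Or.inr rfl) hθ hm0) N Z hf hc)
    (shiftKernel_le hp hβ hm (isExchangePair_half (Or.inl rfl) hθ hm0) N Z hf hc)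

/-- The kernel of an operator with the difference of the indicator functions of two cubes in the
domain. -/
lemma diffKernel_transpose_le {p : ℝ≥0∞} (hp : 1 ≤ p) {β : ℝ≥0∞}
    (hβ : IsDiscreteBound (Fin n → ℤ) p X β) {η : Fin n → Fin 2} (hη : η ≠ 0)
    {m : Fin n → ℤ} {L : ℕ} (hm : ∀ i, |m i| ≤ 2 ^ L) (N : ℕ) (Z : Finset (Fin n → ℤ))
    {f : (Fin n → ℤ) → X} {F : Finset (Fin n → ℤ)} (hf : ∀ a ∉ F, f a = 0)
    {C : ℝ≥0} {c : ℕ → (Fin n → ℤ) → 𝕜} (hc : ∀ j z, ‖c j z‖ ≤ (2 ^ (j + 1)) ^ n * C) :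
    eLpNorm (fun a => ∑ b ∈ F, shiftKernel N Z c (fun j => sg η j)
      (fun j b => trans m j (sg 0 j) b - sg 0 j b) a b • f b) p Measure.count
      ≤ 2 * (C * (2 ^ n * ((L + 2 : ℕ) * (2 * (2 * β ^ 2 * eLpNorm f p Measure.count))))) := by
  by_cases hm0 : m = 0
  · have h : ∀ a b, shiftKernel N Z c (fun j => sg η j)
        (fun j b => trans m j (sg 0 j) b - sg 0 j b) a b = 0 := fun a b =>
      Finset.sum_eq_zero fun j _ => Finset.sum_eq_zero fun z _ => by
        simp [hm0, trans_zero]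
    simp only [h, zero_smul, Finset.sum_const_zero]
    simp
  have hsplit : ∀ a b, shiftKernel N Z c (fun j => sg η j)
      (fun j b => trans m j (sg 0 j) b - sg 0 j b) a b
      = shiftKernel N Z c (fun j => sg η j)
          (fun j b => (-1) * (half (-1) η j b - trans m j (half (-1) η j) b)) a b
        - shiftKernel N Z c (fun j => sg η j)
          (fun j b => 1 * (half 1 η j b - trans m j (half 1 η j) b)) a b := by
    intro a b
    simp only [shiftKernel, ← Finset.sum_sub_distrib, sg_zero_sub_trans η, ← sub_mul]
    refine Finset.sum_congr rfl fun j _ => Finset.sum_congr rfl fun z _ => ?_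
    push_cast
    ring
  simp only [hsplit]
  exact eLpNorm_sub_kernel_le hp _ _ F f
    (shiftKernel_le hp hβ hm (fun j => (isExchangePair_half (Or.inr rfl) hη hm0 j).symm) N Z hf hc)
    (shiftKernel_le hp hβ hm (fun j => (isExchangePair_half (Or.inl rfl) hη hm0 j).symm) N Z hf hc)

end Kernels

/-! ### Representation of a kernel by averages of Haar shifts -/

section Representation

variable {n : ℕ} {𝕜 : Type*} [RCLike 𝕜]

/-- The coordinatewise remainder modulo `2^k`. -/
def rmd (k : ℕ) (x : Fin n → ℤ) : Fin n → ℤ := fun i => x i % 2 ^ k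

/-- The coordinatewise quotient by `2^k`. -/
def quo (k : ℕ) (x : Fin n → ℤ) : Fin n → ℤ := fun i => x i / 2 ^ k

lemma rmd_mem_box (k : ℕ) (x : Fin n → ℤ) : rmd k x ∈ box n k :=
  mem_box.2 fun _ => ⟨Int.emod_nonneg _ (by positivity), Int.emod_lt_of_pos _ (by positivity)⟩

lemma rmd_eq_self {k : ℕ} {x : Fin n → ℤ} (h : x ∈ box n k) : rmd k x = x := by
  funext i
  obtain ⟨h1, h2⟩ := mem_box.1 h i
  exact Int.emod_eq_of_lt h1 h2

lemma rmd_eq_sub (k : ℕ) (x : Fin n → ℤ) : rmd k x = fun i => x i - 2 ^ k * quo k x i := by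
  funext i
  simp only [rmd, quo]
  have := Int.emod_add_mul_ediv (x i) (2 ^ k)
  linarith

lemma rmd_rmd_add {k l : ℕ} (h : k ≤ l) (x y : Fin n → ℤ) :
    rmd k (x + rmd l y) = rmd k (x + y) := by
  funext i
  obtain ⟨d, rfl⟩ := Nat.exists_eq_add_of_le h
  refine Int.emod_emod_of_dvd _ dvd_rfl |>.symm.trans ?_
  simp only [rmd, Pi.add_apply]
  rw [Int.emod_emod_of_dvd _ dvd_rfl, Int.add_emod,
    Int.emod_emod_of_dvd _ (by rw [pow_add]; exact dvd_mul_right _ _),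
    ← Int.add_emod]

/-- The sum of a kernel against the Haar functions with signatures `η` and `θ` of the lattice
cubes of side `2^{j+1}` with corners `w` and `z`. -/
noncomputable def haarSum (t : (Fin n → ℤ) → (Fin n → ℤ) → 𝕜) (η θ : Fin n → Fin 2) (j : ℕ)
    (w z : Fin n → ℤ) : 𝕜 :=
  ∑ u ∈ box n (j + 1), ∑ v ∈ box n (j + 1), ((sg η j u * sg θ j v : ℝ) : 𝕜) * t (w + u) (z + v)

/-- The sum of a kernel over the product of the lattice cubes of side `2^k` with corners `w`
and `z`. -/
noncomputable def boxSum (t : (Fin n → ℤ) → (Fin n → ℤ) → 𝕜) (k : ℕ) (w z : Fin n → ℤ) : 𝕜 :=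
  ∑ u ∈ box n k, ∑ v ∈ box n k, t (w + u) (z + v)

lemma haarSum_zero (t : (Fin n → ℤ) → (Fin n → ℤ) → 𝕜) (j : ℕ) (w z : Fin n → ℤ) :
    haarSum t 0 0 j w z = boxSum t (j + 1) w z := by
  refine Finset.sum_congr rfl fun u hu => Finset.sum_congr rfl fun v hv => ?_
  rw [sg_zero_of_mem hu, sg_zero_of_mem hv]
  simp

lemma sum_sg_mul_sg {j : ℕ} {u₀ u : Fin n → ℤ} (h₀ : u₀ ∈ box n (j + 1)) (h : u ∈ box n (j + 1)) :
    ∑ η, sg η j u₀ * sg η j u = if quo j u = quo j u₀ then 2 ^ n else 0 := by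
  simp only [sg, ← Finset.prod_mul_distrib]
  have hsum := Finset.prod_univ_sum (fun _ : Fin n => (Finset.univ : Finset (Fin 2)))
    fun i e => signOne e (u₀ i / 2 ^ j) * signOne e (u i / 2 ^ j)
  rw [Fintype.piFinset_univ] at hsum
  rw [← hsum]
  rw [mem_box_iff_ediv] at h h₀
  have hone : ∀ i, ∑ e : Fin 2, signOne e (u₀ i / 2 ^ j) * signOne e (u i / 2 ^ j)
      = if u i / 2 ^ j = u₀ i / 2 ^ j then 2 else 0 := by
    intro i
    have h1 := h i
    have h2 := h₀ i
    rw [ediv_two_pow_succ] at h1 h2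
    have h1' : u i / 2 ^ j = 0 ∨ u i / 2 ^ j = 1 := by omega
    have h2' : u₀ i / 2 ^ j = 0 ∨ u₀ i / 2 ^ j = 1 := by omega
    rw [Fin.sum_univ_two]
    rcases h1' with h1 | h1 <;> rcases h2' with h2 | h2 <;> rw [h1, h2] <;>
      norm_num [signOne]
  rw [Finset.prod_congr rfl fun i _ => hone i]
  split_ifs with hq
  · rw [Finset.prod_congr rfl fun i _ => if_pos (show u i / 2 ^ j = u₀ i / 2 ^ j from
      congrFun hq i)]
    simp
  · obtain ⟨i, hi⟩ := Function.ne_iff.1 hq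
    exact Finset.prod_eq_zero (Finset.mem_univ i) (if_neg hi)

lemma sum_box_quo_eq {M : Type*} [AddCommMonoid M] {j : ℕ} {u₀ : Fin n → ℤ}
    (h₀ : u₀ ∈ box n (j + 1)) (F : (Fin n → ℤ) → M) :
    ∑ u ∈ box n (j + 1) with quo j u = quo j u₀, F u
      = ∑ u ∈ box n j, F (u₀ - rmd j u₀ + u) := by
  have hr := rmd_eq_sub j u₀
  refine Finset.sum_nbij' (fun u => u - (u₀ - rmd j u₀)) (fun u => u₀ - rmd j u₀ + u) ?_ ?_ ?_ ?_ ?_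
  · intro u hu
    rw [Finset.mem_filter] at hu
    rw [mem_box_iff_ediv]
    intro i
    have hq := congrFun hu.2 i
    simp only [quo] at hq
    simp only [hr, Pi.sub_apply, quo, sub_sub_cancel]
    rw [sub_eq_add_neg, ← mul_neg, Int.add_mul_ediv_left _ _ (by positivity), hq]
    ring
  · intro u hu
    rw [mem_box_iff_ediv] at hu
    have hq : quo j (u₀ - rmd j u₀ + u) = quo j u₀ := by
      funext i
      simp only [quo, hr, Pi.sub_apply, Pi.add_apply, sub_sub_cancel]
      rw [add_comm, Int.add_mul_ediv_left _ _ (by positivity), hu i, zero_add]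
    rw [Finset.mem_filter]
    refine ⟨mem_box_iff_ediv.2 fun i => ?_, hq⟩
    rw [ediv_two_pow_mono (Nat.le_succ j) (congrFun hq i)]
    exact mem_box_iff_ediv.1 h₀ i
  · intro u _
    abel
  · intro u _
    abel
  · intro u _
    congr 1
    abel

/-- The Haar expansion of a kernel on the product of two cubes. -/
lemma sum_haarSum (t : (Fin n → ℤ) → (Fin n → ℤ) → 𝕜) {j : ℕ} {u₀ v₀ : Fin n → ℤ}
    (hu : u₀ ∈ box n (j + 1)) (hv : v₀ ∈ box n (j + 1)) (w z : Fin n → ℤ) :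
    ∑ η, ∑ θ, ((sg η j u₀ * sg θ j v₀ : ℝ) : 𝕜) * haarSum t η θ j w z
      = 4 ^ n * boxSum t j (w + u₀ - rmd j u₀) (z + v₀ - rmd j v₀) := by
  have key : ∀ u ∈ box n (j + 1), ∀ v ∈ box n (j + 1),
      ∑ η, ∑ θ, ((sg η j u₀ * sg θ j v₀ : ℝ) : 𝕜) *
        (((sg η j u * sg θ j v : ℝ) : 𝕜) * t (w + u) (z + v))
      = if quo j u = quo j u₀ then (if quo j v = quo j v₀ then 4 ^ n * t (w + u) (z + v) else 0)
        else 0 := by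
    intro u hu' v hv'
    have h1 : ∀ η θ : Fin n → Fin 2, ((sg η j u₀ * sg θ j v₀ : ℝ) : 𝕜) *
        (((sg η j u * sg θ j v : ℝ) : 𝕜) * t (w + u) (z + v))
        = (((sg η j u₀ * sg η j u) * (sg θ j v₀ * sg θ j v) : ℝ) : 𝕜) * t (w + u) (z + v) := by
      intro η θ
      push_cast
      ring
    simp only [h1, ← Finset.sum_mul, ← RCLike.ofReal_sum]
    rw [← Finset.sum_mul_sum, sum_sg_mul_sg hu hu', sum_sg_mul_sg hv hv']
    split_ifs
    · push_cast
      rw [← mul_pow]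
      norm_num
    · simp
    · simp
    · simp
  simp only [haarSum, Finset.mul_sum]
  rw [Finset.sum_congr rfl fun η _ => Finset.sum_comm, Finset.sum_comm]
  rw [Finset.sum_congr rfl fun u _ => Finset.sum_congr rfl fun η _ => Finset.sum_comm,
    Finset.sum_congr rfl fun u _ => Finset.sum_comm]
  rw [Finset.sum_congr rfl fun u hu => Finset.sum_congr rfl fun v hv => key u hu v hv]
  have h2 : ∀ u, (∑ v ∈ box n (j + 1), if quo j u = quo j u₀ then
      (if quo j v = quo j v₀ then 4 ^ n * t (w + u) (z + v) else 0) else 0)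
      = if quo j u = quo j u₀ then ∑ v ∈ box n (j + 1) with quo j v = quo j v₀,
        4 ^ n * t (w + u) (z + v) else 0 := by
    intro u
    split_ifs
    · rw [Finset.sum_filter]
    · simp
  simp only [h2]
  rw [← Finset.sum_filter, sum_box_quo_eq hu]
  simp only [sum_box_quo_eq hv, boxSum, Finset.mul_sum, add_assoc, add_sub_assoc]

lemma sum_box_rmd (k : ℕ) (F : (Fin n → ℤ) → 𝕜) :
    ∑ v ∈ box n (k + 1), F (rmd k v) = 2 ^ n * ∑ v ∈ box n k, F v := by
  rw [← Finset.sum_fiberwise_of_maps_to (g := rmd k) (t := box n k) fun v _ => rmd_mem_box k v,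
    Finset.mul_sum]
  refine Finset.sum_congr rfl fun v hv => ?_
  rw [Finset.sum_congr rfl fun x hx => by rw [(Finset.mem_filter.1 hx).2], Finset.sum_const]
  have hfib : (box n (k + 1)).filter (fun x => rmd k x = v)
      = Fintype.piFinset fun i => {v i, v i + 2 ^ k} := by
    ext x
    simp only [Finset.mem_filter, mem_box, Fintype.mem_piFinset, Finset.mem_insert,
      Finset.mem_singleton, funext_iff, ← forall_and]
    refine forall_congr' fun i => ?_
    obtain ⟨h1, h2⟩ := mem_box.1 hv i
    simp only [rmd]
    rw [pow_succ]
    constructor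
    · rintro ⟨⟨h3, h4⟩, h5⟩
      have h6 := Int.emod_add_mul_ediv (x i) (2 ^ k)
      have h7 : x i / 2 ^ k = 0 ∨ x i / 2 ^ k = 1 := by
        have h8 := Int.ediv_nonneg h3 (show (0 : ℤ) ≤ 2 ^ k by positivity)
        have h9 := Int.ediv_lt_of_lt_mul (show (0 : ℤ) < 2 ^ k by positivity)
          (show x i < 2 * 2 ^ k by linarith)
        omega
      rcases h7 with h7 | h7 <;> rw [h7, h5] at h6
      · left; linarith
      · right; linarith
    · rintro (h | h) <;> rw [h]
      · exact ⟨⟨h1, by linarith⟩, Int.emod_eq_of_lt h1 h2⟩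
      · refine ⟨⟨by positivity, by linarith⟩, ?_⟩
        rw [Int.add_emod_right, Int.emod_eq_of_lt h1 h2]
  have hcard : ((box n (k + 1)).filter (fun x => rmd k x = v)).card = 2 ^ n := by
    rw [hfib, Fintype.card_piFinset]
    have : ∀ i, ({v i, v i + 2 ^ k} : Finset ℤ).card = 2 := fun i =>
      Finset.card_pair (by have : (0 : ℤ) < 2 ^ k := by positivity
                           linarith)
    simp [this]
  rw [hcard, nsmul_eq_mul]
  push_cast
  rfl

/-- The average, over all grids of cubes of side `2^k`, of the conditional expectations of the
kernel with respect to the products of two cubes of the same grid. -/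
noncomputable def gridAvg (t : (Fin n → ℤ) → (Fin n → ℤ) → 𝕜) (k : ℕ) (a b : Fin n → ℤ) : 𝕜 :=
  (((2 ^ k) ^ n)⁻¹ ^ 3 : 𝕜) * ∑ v ∈ box n k, boxSum t k (a - rmd k (a - b + v)) (b - v)

/-- The part with signatures `η` and `θ` of the difference of two consecutive averages of the
kernel. -/
noncomputable def haarPart (t : (Fin n → ℤ) → (Fin n → ℤ) → 𝕜) (η θ : Fin n → Fin 2) (j : ℕ)
    (a b : Fin n → ℤ) : 𝕜 :=
  (((2 ^ (j + 1)) ^ n)⁻¹ ^ 3 : 𝕜) * ∑ v ∈ box n (j + 1),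
    ((sg η j (rmd (j + 1) (a - b + v)) * sg θ j v : ℝ) : 𝕜) *
      haarSum t η θ j (a - rmd (j + 1) (a - b + v)) (b - v)

lemma gridAvg_zero (t : (Fin n → ℤ) → (Fin n → ℤ) → 𝕜) (a b : Fin n → ℤ) :
    gridAvg t 0 a b = t a b := by
  have hbox : box n 0 = {0} := by
    ext x
    simp only [mem_box, Finset.mem_singleton, funext_iff, pow_zero, Pi.zero_apply]
    exact forall_congr' fun i => by omega
  have hr : ∀ x : Fin n → ℤ, rmd 0 x = 0 := fun x => by
    funext i
    simp [rmd]
  simp [gridAvg, boxSum, hbox, hr]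

lemma sum_haarPart (t : (Fin n → ℤ) → (Fin n → ℤ) → 𝕜) (j : ℕ) (a b : Fin n → ℤ) :
    ∑ η, ∑ θ, haarPart t η θ j a b = gridAvg t j a b := by
  simp only [haarPart, ← Finset.mul_sum]
  rw [Finset.sum_congr rfl fun η _ => Finset.sum_comm, Finset.sum_comm]
  have h : ∀ v ∈ box n (j + 1), ∑ η, ∑ θ,
      ((sg η j (rmd (j + 1) (a - b + v)) * sg θ j v : ℝ) : 𝕜) *
        haarSum t η θ j (a - rmd (j + 1) (a - b + v)) (b - v)
      = 4 ^ n * boxSum t j (a - rmd j (a - b + rmd j v)) (b - rmd j v) := by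
    intro v hv
    rw [sum_haarSum t (rmd_mem_box _ _) hv]
    have h1 : rmd j (rmd (j + 1) (a - b + v)) = rmd j (a - b + rmd j v) := by
      have h2 := rmd_rmd_add (Nat.le_succ j) 0 (a - b + v)
      rw [zero_add, zero_add] at h2
      rw [h2, rmd_rmd_add le_rfl]
    rw [h1, sub_add_cancel, sub_add_cancel]
  rw [Finset.sum_congr rfl h,
    sum_box_rmd j fun v => 4 ^ n * boxSum t j (a - rmd j (a - b + v)) (b - v), ← Finset.mul_sum,
    gridAvg, ← mul_assoc, ← mul_assoc]
  congr 1
  have h4 : (4 : 𝕜) ^ n = 2 ^ n * 2 ^ n := by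
    rw [← mul_pow]
    norm_num
  rw [h4]
  have h2 : (2 : 𝕜) ≠ 0 := two_ne_zero
  field_simp
  ring

lemma haarPart_zero (t : (Fin n → ℤ) → (Fin n → ℤ) → 𝕜) (j : ℕ) (a b : Fin n → ℤ) :
    haarPart t 0 0 j a b = gridAvg t (j + 1) a b := by
  rw [haarPart, gridAvg]
  congr 1
  refine Finset.sum_congr rfl fun v hv => ?_
  rw [sg_zero_of_mem hv, sg_zero_of_mem (rmd_mem_box _ _), haarSum_zero]
  simp

/-- The representation of a kernel by its cancellative parts and the average over large cubes. -/
lemma eq_sum_haarPart (t : (Fin n → ℤ) → (Fin n → ℤ) → 𝕜) (N : ℕ) (a b : Fin n → ℤ) :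
    t a b = (∑ e ∈ (Finset.univ : Finset ((Fin n → Fin 2) × (Fin n → Fin 2))).erase (0, 0),
      ∑ j ∈ Finset.range N, haarPart t e.1 e.2 j a b) + gridAvg t N a b := by
  induction N with
  | zero => simp [gridAvg_zero]
  | succ N ih =>
    have h : gridAvg t N a b = gridAvg t (N + 1) a b +
        ∑ e ∈ (Finset.univ : Finset ((Fin n → Fin 2) × (Fin n → Fin 2))).erase (0, 0),
          haarPart t e.1 e.2 N a b := by
      rw [← sum_haarPart, ← Fintype.sum_prod_type' (f := fun η θ => haarPart t η θ N a b),
        ← haarPart_zero]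
      have hs := Finset.add_sum_erase Finset.univ
        (fun e : (Fin n → Fin 2) × (Fin n → Fin 2) => haarPart t e.1 e.2 N a b)
        (Finset.mem_univ ((0, 0) : (Fin n → Fin 2) × (Fin n → Fin 2)))
      exact hs.symm
    rw [ih, h]
    simp only [Finset.sum_range_succ, Finset.sum_add_distrib]
    ring

end Representation

/-! ### Decay of the averages over large cubes -/

section Decay

variable {n : ℕ} {𝕜 : Type*} [RCLike 𝕜]

/-- The discrete form of the hypotheses on the operator, for the matrix `t` of its pairings with
the cells of a fixed grid: the Haar coefficients are bounded by `Cf`, the operator and its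
transpose annihilate constants, and the averages over large centred cubes vanish. -/
structure IsLatticeKernel (t : (Fin n → ℤ) → (Fin n → ℤ) → 𝕜)
    (Cf : (Fin n → Fin 2) → (Fin n → Fin 2) → (Fin n → ℤ) → ℝ≥0) : Prop where
  bound : ∀ η θ : Fin n → Fin 2, (η, θ) ≠ (0, 0) → ∀ (j : ℕ) (z m : Fin n → ℤ),
    ‖haarSum t η θ j (fun i => z i + 2 ^ (j + 1) * m i) z‖ ≤ (2 ^ (j + 1)) ^ n * Cf η θ m
  hasSum_left : ∀ θ : Fin n → Fin 2, θ ≠ 0 → ∀ (j : ℕ) (z : Fin n → ℤ),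
    HasSum (fun m : Fin n → ℤ => haarSum t 0 θ j (fun i => z i + 2 ^ (j + 1) * m i) z) 0
  hasSum_right : ∀ η : Fin n → Fin 2, η ≠ 0 → ∀ (j : ℕ) (w : Fin n → ℤ),
    HasSum (fun m : Fin n → ℤ => haarSum t η 0 j w (fun i => w i + 2 ^ (j + 1) * m i)) 0
  tendsto_centered : Tendsto (fun k : ℕ =>
    boxSum t (k + 1) (fun _ => -2 ^ k) (fun _ => -2 ^ k) / (((2 ^ (k + 1)) ^ n) ^ 2 : 𝕜))
    atTop (𝓝 0)

/-- The sum of the coefficient bounds over all signatures. -/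
noncomputable def totalCoeff (Cf : (Fin n → Fin 2) → (Fin n → Fin 2) → (Fin n → ℤ) → ℝ≥0)
    (m : Fin n → ℤ) : ℝ≥0 :=
  ∑ e ∈ (Finset.univ : Finset ((Fin n → Fin 2) × (Fin n → Fin 2))).erase (0, 0), Cf e.1 e.2 m

variable {t : (Fin n → ℤ) → (Fin n → ℤ) → 𝕜}
  {Cf : (Fin n → Fin 2) → (Fin n → Fin 2) → (Fin n → ℤ) → ℝ≥0}

lemma abs_sg_le_one (θ : Fin n → Fin 2) (j : ℕ) (b : Fin n → ℤ) : |sg θ j b| ≤ 1 := by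
  rcases sg_mem θ j b with h | h | h <;> rw [h] <;> norm_num

/-- The difference between the averages over a product of cubes and over a product of their children
is bounded by the Haar coefficients with non-trivial signature. -/
lemma IsLatticeKernel.norm_boxSum_sub_le (ht : IsLatticeKernel t Cf) {j : ℕ}
    {u₀ v₀ : Fin n → ℤ} (hu : u₀ ∈ box n (j + 1)) (hv : v₀ ∈ box n (j + 1))
    {w z m : Fin n → ℤ} (hw : w = fun i => z i + 2 ^ (j + 1) * m i) :
    ‖4 ^ n * boxSum t j (w + u₀ - rmd j u₀) (z + v₀ - rmd j v₀) - boxSum t (j + 1) w z‖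
      ≤ (2 ^ (j + 1)) ^ n * totalCoeff Cf m := by
  have hs := Finset.add_sum_erase Finset.univ
    (fun e : (Fin n → Fin 2) × (Fin n → Fin 2) =>
      ((sg e.1 j u₀ * sg e.2 j v₀ : ℝ) : 𝕜) * haarSum t e.1 e.2 j w z)
    (Finset.mem_univ ((0, 0) : (Fin n → Fin 2) × (Fin n → Fin 2)))
  rw [← sum_haarSum t hu hv,
    ← Fintype.sum_prod_type' (f := fun η θ => ((sg η j u₀ * sg θ j v₀ : ℝ) : 𝕜) *
      haarSum t η θ j w z), ← hs]
  simp only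
  rw [sg_zero_of_mem hu, sg_zero_of_mem hv, haarSum_zero, mul_one, RCLike.ofReal_one, one_mul,
    add_sub_cancel_left, totalCoeff, NNReal.coe_sum, Finset.mul_sum]
  refine norm_sum_le_of_le _ fun e he => ?_
  rw [norm_mul, RCLike.norm_ofReal, abs_mul, hw]
  refine (mul_le_of_le_one_left (norm_nonneg _) (mul_le_one₀ (abs_sg_le_one _ _ _)
    (abs_nonneg _) (abs_sg_le_one _ _ _))).trans ?_
  exact ht.bound e.1 e.2 (Finset.ne_of_mem_erase he) j z m

/-- The average of the kernel over the product of the dyadic cubes of side `2^k` around the two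
points. -/
noncomputable def dyadicAvg (t : (Fin n → ℤ) → (Fin n → ℤ) → 𝕜) (k : ℕ) (a b : Fin n → ℤ) : 𝕜 :=
  (((2 ^ k) ^ n) ^ 2 : 𝕜)⁻¹ * boxSum t k (a - rmd k a) (b - rmd k b)

lemma dyadicAvg_zero (a b : Fin n → ℤ) : dyadicAvg t 0 a b = t a b := by
  have hbox : box n 0 = {0} := by
    ext x
    simp only [mem_box, Finset.mem_singleton, funext_iff, pow_zero, Pi.zero_apply]
    exact forall_congr' fun i => by omega
  have hr : ∀ x : Fin n → ℤ, rmd 0 x = 0 := fun x => by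
    funext i
    simp [rmd]
  simp [dyadicAvg, boxSum, hbox, hr]

lemma rmd_rmd {k l : ℕ} (h : k ≤ l) (x : Fin n → ℤ) : rmd k (rmd l x) = rmd k x := by
  have := rmd_rmd_add h 0 x
  rwa [zero_add, zero_add] at this

lemma norm_two_pow_inv (k : ℕ) : ‖((((2 : 𝕜) ^ k) ^ n) ^ 2)⁻¹‖ = (((2 ^ k) ^ n) ^ 2)⁻¹ := by
  rw [norm_inv, norm_pow, norm_pow, norm_pow, RCLike.norm_ofNat]

lemma IsLatticeKernel.norm_dyadicAvg_sub_le (ht : IsLatticeKernel t Cf) (k : ℕ)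
    (a b : Fin n → ℤ) : ‖dyadicAvg t k a b - dyadicAvg t (k + 1) a b‖
      ≤ ((2 ^ (k + 1)) ^ n)⁻¹ * totalCoeff Cf (quo (k + 1) a - quo (k + 1) b) := by
  have h := ht.norm_boxSum_sub_le (rmd_mem_box (k + 1) a) (rmd_mem_box (k + 1) b)
    (w := a - rmd (k + 1) a) (z := b - rmd (k + 1) b) (m := quo (k + 1) a - quo (k + 1) b) (by
      funext i
      simp only [rmd_eq_sub, Pi.sub_apply]
      ring)
  rw [rmd_rmd (Nat.le_succ k), rmd_rmd (Nat.le_succ k), sub_add_cancel, sub_add_cancel] at h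
  have h2 : (2 : 𝕜) ≠ 0 := two_ne_zero
  have h4 : (4 : 𝕜) ^ n = 2 ^ n * 2 ^ n := by
    rw [← mul_pow]
    norm_num
  have hrep : dyadicAvg t k a b - dyadicAvg t (k + 1) a b = (((2 ^ (k + 1)) ^ n) ^ 2 : 𝕜)⁻¹ *
      (4 ^ n * boxSum t k (a - rmd k a) (b - rmd k b)
        - boxSum t (k + 1) (a - rmd (k + 1) a) (b - rmd (k + 1) b)) := by
    rw [dyadicAvg, dyadicAvg, mul_sub, ← mul_assoc]
    congr 2
    rw [h4]
    field_simp
    ring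
  rw [hrep, norm_mul, norm_two_pow_inv]
  refine (mul_le_mul_of_nonneg_left h (by positivity)).trans (le_of_eq ?_)
  field_simp

/-- The dyadic grid does not exhaust the lattice by cubes around the origin, hence for every `k` the
average is compared with that over the centred cube of side `2^{k+1}`, which is a union of dyadic
cubes of side `2^k`. -/
lemma IsLatticeKernel.tendsto_dyadicAvg (hn : 0 < n) (ht : IsLatticeKernel t Cf)
    (a b : Fin n → ℤ) : Tendsto (fun k => dyadicAvg t k a b) atTop (𝓝 0) := by
  rw [tendsto_zero_iff_norm_tendsto_zero]
  have hlim : Tendsto (fun k : ℕ => ‖boxSum t (k + 1) (fun _ => -2 ^ k) (fun _ => -2 ^ k) /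
      (((2 ^ (k + 1)) ^ n) ^ 2 : 𝕜)‖ + ((2 ^ (k + 1)) ^ n : ℝ)⁻¹ * totalCoeff Cf 0)
      atTop (𝓝 (0 + 0 * totalCoeff Cf 0)) := by
    refine ((tendsto_zero_iff_norm_tendsto_zero.1 ht.tendsto_centered)).add
      (Tendsto.mul_const _ ?_)
    refine tendsto_inv_atTop_zero.comp ((tendsto_pow_atTop hn.ne').comp ?_)
    exact (tendsto_pow_atTop_atTop_of_one_lt one_lt_two).comp (tendsto_add_atTop_nat 1)
  rw [zero_mul, zero_add] at hlim
  refine tendsto_of_tendsto_of_tendsto_of_le_of_le' tendsto_const_nhds hlim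
    (Eventually.of_forall fun _ => norm_nonneg _) ?_
  have hev : ∀ x : Fin n → ℤ, ∀ᶠ k : ℕ in atTop, x + (fun _ => 2 ^ k) ∈ box n (k + 1) := by
    intro x
    have h1 : ∀ i, ∀ᶠ k : ℕ in atTop, |x i| < 2 ^ k := fun i => by
      have := (tendsto_pow_atTop_atTop_of_one_lt (one_lt_two : (1 : ℤ) < 2)).eventually_gt_atTop |x i|
      exact this
    filter_upwards [eventually_all.2 h1] with k hk
    refine mem_box.2 fun i => ?_
    obtain ⟨h2, h3⟩ := abs_lt.1 (hk i)
    simp only [Pi.add_apply]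
    rw [pow_succ]
    constructor <;> linarith
  filter_upwards [hev a, hev b] with k hka hkb
  have h := ht.norm_boxSum_sub_le hka hkb (w := fun _ => -2 ^ k) (z := fun _ => -2 ^ k) (m := 0)
    (by simp)
  have hr : ∀ x : Fin n → ℤ, (fun _ => -2 ^ k : Fin n → ℤ) + (x + fun _ => 2 ^ k)
      - rmd k (x + fun _ => 2 ^ k) = x - rmd k x := by
    intro x
    funext i
    simp [rmd]
  rw [hr, hr] at h
  have h2 : (2 : 𝕜) ≠ 0 := two_ne_zero
  have h4 : (4 : 𝕜) ^ n = 2 ^ n * 2 ^ n := by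
    rw [← mul_pow]
    norm_num
  generalize hB : boxSum t (k + 1) (fun _ => -2 ^ k) (fun _ => -2 ^ k) = B at h ⊢
  have hrep : dyadicAvg t k a b = B / (((2 ^ (k + 1)) ^ n) ^ 2 : 𝕜) +
      (((2 ^ (k + 1)) ^ n) ^ 2 : 𝕜)⁻¹ * (4 ^ n * boxSum t k (a - rmd k a) (b - rmd k b) - B) := by
    rw [dyadicAvg, h4]
    field_simp
    ring
  rw [hrep]
  refine (norm_add_le _ _).trans (add_le_add le_rfl ?_)
  rw [norm_mul, norm_two_pow_inv]
  refine (mul_le_mul_of_nonneg_left h (by positivity)).trans (le_of_eq ?_)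
  field_simp

/-- A summable function of the cube of side `2^l` containing a point, summed over a cube of side
`2^N`. -/
lemma sum_box_quo_le {g : (Fin n → ℤ) → ℝ≥0} {S : ℝ} (hS : ∀ s : Finset (Fin n → ℤ),
    ∑ m ∈ s, (g m : ℝ) ≤ S) (N l : ℕ) (w q : Fin n → ℤ) :
    ∑ u ∈ box n N, (g (quo l (w + u) - q) : ℝ) ≤ (2 ^ N) ^ n * S ∧
      ∑ u ∈ box n N, (g (quo l (w + u) - q) : ℝ) ≤ (2 ^ l) ^ n * S := by
  classical
  constructor
  · refine (Finset.sum_le_card_nsmul _ _ S fun u _ => ?_).trans (le_of_eq ?_)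
    · simpa using hS {quo l (w + u) - q}
    · rw [card_box, nsmul_eq_mul]
      push_cast
      rfl
  · rw [← Finset.sum_fiberwise_of_maps_to (g := fun u => quo l (w + u) - q)
      (t := (box n N).image fun u => quo l (w + u) - q)
      fun u hu => Finset.mem_image_of_mem _ hu]
    refine le_trans ?_ (mul_le_mul_of_nonneg_left
      (hS ((box n N).image fun u => quo l (w + u) - q)) (by positivity))
    rw [Finset.mul_sum]
    refine Finset.sum_le_sum fun m _ => ?_
    rw [Finset.sum_congr rfl fun u hu => by rw [(Finset.mem_filter.1 hu).2], Finset.sum_const,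
      nsmul_eq_mul]
    refine mul_le_mul_of_nonneg_right ?_ (NNReal.coe_nonneg _)
    have hcard : ((box n N).filter fun u => quo l (w + u) - q = m).card ≤ (box n l).card := by
      refine Finset.card_le_card_of_injOn (fun u => rmd l (w + u)) (fun u _ => rmd_mem_box _ _) ?_
      intro u hu u' hu' h
      have h1 := (Finset.mem_filter.1 hu).2
      have h2 := (Finset.mem_filter.1 hu').2
      have h3 : quo l (w + u) = quo l (w + u') := by
        rw [← sub_left_inj (a := q), h1, h2]
      simp only [rmd_eq_sub, h3] at h
      funext i
      have := congrFun h i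
      simp only [Pi.add_apply] at this
      linarith
    rw [card_box] at hcard
    exact_mod_cast hcard

/-- Sums over cubes of a kernel with cancellation grow hardly faster than the volume. -/
lemma IsLatticeKernel.norm_boxSum_le (hn : 0 < n) (ht : IsLatticeKernel t Cf) {S : ℝ}
    (hS : ∀ s : Finset (Fin n → ℤ), ∑ m ∈ s, (totalCoeff Cf m : ℝ) ≤ S) (N : ℕ)
    (w z : Fin n → ℤ) : ‖boxSum t N w z‖ ≤ (N + 1) * ((2 ^ N) ^ n * S) := by
  have hS0 : 0 ≤ S := by simpa using hS ∅
  set D : ℕ → ℝ := fun k => (2 ^ k) ^ n with hD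
  have hDpos : ∀ k, 0 < D k := fun k => by
    simp only [hD]
    positivity
  set A : ℕ → ℝ := fun k => ∑ v ∈ box n N, ∑ u ∈ box n N, (D (k + 1))⁻¹ *
    totalCoeff Cf (quo (k + 1) (w + u) - quo (k + 1) (z + v)) with hA
  have hAle : ∀ k x, (∀ v ∈ box n N, ∑ u ∈ box n N, (totalCoeff Cf
      (quo (k + 1) (w + u) - quo (k + 1) (z + v)) : ℝ) ≤ x * S) →
      A k ≤ D N * ((D (k + 1))⁻¹ * (x * S)) := by
    intro k x hx
    refine (Finset.sum_le_card_nsmul _ _ ((D (k + 1))⁻¹ * (x * S)) fun v hv => ?_).trans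
      (le_of_eq ?_)
    · rw [← Finset.mul_sum]
      exact mul_le_mul_of_nonneg_left (hx v hv) (inv_nonneg.2 (hDpos _).le)
    · rw [card_box, nsmul_eq_mul]
      push_cast
      rfl
  -- Each of the `N` scales below `2^N` contributes at most the volume, and the scales above `2^N`
  -- contribute a geometric series.
  have hsmall : ∀ k, A k ≤ D N * S := fun k => by
    refine (hAle k (D (k + 1)) fun v _ => (sum_box_quo_le hS N (k + 1) w _).2).trans (le_of_eq ?_)
    have := (hDpos (k + 1)).ne'
    field_simp
  have hlarge : ∀ i, A (N + i) ≤ D N * S * (1 / 2 / 2 ^ i) := fun i => by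
    refine (hAle _ (D N) fun v _ => (sum_box_quo_le hS N _ w _).1).trans ?_
    have h1 : D (N + i + 1) = D N * (2 ^ (i + 1)) ^ n := by
      simp only [hD]
      rw [add_assoc, pow_add, mul_pow]
    have h2 : (2 : ℝ) ^ (i + 1) ≤ (2 ^ (i + 1)) ^ n :=
      le_self_pow₀ (one_le_pow₀ one_le_two) hn.ne'
    have h3 : ((2 : ℝ) ^ (i + 1)) ^ n ≠ 0 := by positivity
    have hN := hDpos N
    calc D N * ((D (N + i + 1))⁻¹ * (D N * S)) = D N * S * ((2 ^ (i + 1)) ^ n)⁻¹ := by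
          rw [h1]
          field_simp
      _ ≤ D N * S * (2 ^ (i + 1))⁻¹ := by gcongr
      _ = _ := by
          rw [pow_succ]
          field_simp
  have hgeo : ∀ M, ∑ i ∈ Finset.range M, (1 / 2 / 2 ^ i : ℝ) ≤ 1 := fun M =>
    (Summable.sum_le_tsum _ (fun i _ => by positivity) (summable_geometric_two' 1)).trans
      (tsum_geometric_two' 1).le
  have hbound : ∀ M, ‖boxSum t N w z‖ ≤ (N + 1) * (D N * S) +
      ∑ u ∈ box n N, ∑ v ∈ box n N, ‖dyadicAvg t (N + M) (w + u) (z + v)‖ := by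
    intro M
    have hpt : ∀ a b, ‖t a b‖ ≤ ∑ k ∈ Finset.range (N + M), (D (k + 1))⁻¹ *
        totalCoeff Cf (quo (k + 1) a - quo (k + 1) b) + ‖dyadicAvg t (N + M) a b‖ := by
      intro a b
      have htel := Finset.sum_range_sub' (fun k => dyadicAvg t k a b) (N + M)
      rw [dyadicAvg_zero] at htel
      rw [← sub_add_cancel (t a b) (dyadicAvg t (N + M) a b), ← htel]
      exact (norm_add_le _ _).trans (add_le_add
        (norm_sum_le_of_le _ fun k _ => ht.norm_dyadicAvg_sub_le k a b) le_rfl)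
    have hsum : ‖boxSum t N w z‖ ≤ ∑ u ∈ box n N, ∑ v ∈ box n N,
        (∑ k ∈ Finset.range (N + M), (D (k + 1))⁻¹ *
        totalCoeff Cf (quo (k + 1) (w + u) - quo (k + 1) (z + v))
          + ‖dyadicAvg t (N + M) (w + u) (z + v)‖) :=
      norm_sum_le_of_le _ fun u _ => norm_sum_le_of_le _ fun v _ => hpt _ _
    refine hsum.trans ?_
    simp only [Finset.sum_add_distrib]
    refine add_le_add ?_ le_rfl
    have hswap : ∑ u ∈ box n N, ∑ v ∈ box n N, ∑ k ∈ Finset.range (N + M), (D (k + 1))⁻¹ *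
        (totalCoeff Cf (quo (k + 1) (w + u) - quo (k + 1) (z + v)) : ℝ)
        = ∑ k ∈ Finset.range (N + M), A k := by
      simp only [hA]
      rw [Finset.sum_comm, Finset.sum_comm' (s := Finset.range (N + M)) (t' := box n N)
        (s' := fun _ => Finset.range (N + M)) (t := fun _ => box n N) (by tauto)]
      refine Finset.sum_congr rfl fun v _ => Finset.sum_comm
    rw [hswap, Finset.sum_range_add]
    calc _ ≤ ∑ k ∈ Finset.range N, D N * S + ∑ i ∈ Finset.range M, D N * S * (1 / 2 / 2 ^ i) :=
          add_le_add (Finset.sum_le_sum fun k _ => hsmall k)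
            (Finset.sum_le_sum fun i _ => hlarge i)
      _ ≤ N * (D N * S) + D N * S * 1 := by
          rw [Finset.sum_const, Finset.card_range, nsmul_eq_mul, ← Finset.mul_sum]
          exact add_le_add le_rfl (mul_le_mul_of_nonneg_left (hgeo M)
            (mul_nonneg (hDpos N).le hS0))
      _ = _ := by ring
  have hlim : Tendsto (fun M => (N + 1) * (D N * S) +
      ∑ u ∈ box n N, ∑ v ∈ box n N, ‖dyadicAvg t (N + M) (w + u) (z + v)‖) atTop
      (𝓝 ((N + 1) * (D N * S) + ∑ u ∈ box n N, ∑ v ∈ box n N, 0)) := by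
    refine tendsto_const_nhds.add (tendsto_finsetSum _ fun u _ => tendsto_finsetSum _ fun v _ => ?_)
    have h := (tendsto_zero_iff_norm_tendsto_zero.1 (ht.tendsto_dyadicAvg hn (w + u) (z + v)))
    have h' := h.comp (tendsto_add_atTop_nat N)
    simpa only [Function.comp_def, add_comm _ N] using h'
  simp only [Finset.sum_const_zero, add_zero] at hlim
  exact ge_of_tendsto' hlim hbound

/-- The average over the grids divides a sum over pairs of cubes of side `2^N`, of order `N |Q|`, by
`|Q|²`. -/
lemma IsLatticeKernel.tendsto_gridAvg (hn : 0 < n) (ht : IsLatticeKernel t Cf) {S : ℝ}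
    (hS : ∀ s : Finset (Fin n → ℤ), ∑ m ∈ s, (totalCoeff Cf m : ℝ) ≤ S) (a b : Fin n → ℤ) :
    Tendsto (fun N => gridAvg t N a b) atTop (𝓝 0) := by
  have hS0 : 0 ≤ S := by simpa using hS ∅
  have hbound : ∀ N, ‖gridAvg t N a b‖ ≤ ((N : ℝ) ^ 1 * (1 / 2) ^ N + (1 / 2) ^ N) * S := by
    intro N
    rw [gridAvg, norm_mul]
    have h1 : ‖((((2 : 𝕜) ^ N) ^ n)⁻¹ ^ 3)‖ = (((2 : ℝ) ^ N) ^ n)⁻¹ ^ 3 := by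
      rw [norm_pow, norm_inv, norm_pow, norm_pow, RCLike.norm_ofNat]
    have h2 := norm_sum_le_of_le (box n N) fun v _ => ht.norm_boxSum_le hn hS N
      (a - rmd N (a - b + v)) (b - v)
    rw [Finset.sum_const, card_box, nsmul_eq_mul] at h2
    rw [h1]
    refine (mul_le_mul_of_nonneg_left h2 (by positivity)).trans ?_
    have h3 : (2 : ℝ) ^ N ≤ (2 ^ N) ^ n := le_self_pow₀ (one_le_pow₀ one_le_two) hn.ne'
    calc _ = ((N : ℝ) + 1) * S * ((2 ^ N) ^ n)⁻¹ := by
          push_cast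
          field_simp
      _ ≤ ((N : ℝ) + 1) * S * (2 ^ N)⁻¹ := by gcongr
      _ = _ := by
          rw [one_div, inv_pow]
          ring
  refine squeeze_zero_norm hbound ?_
  have h1 := tendsto_pow_const_mul_const_pow_of_lt_one 1 (r := 1 / 2) (by norm_num) (by norm_num)
  have h2 := tendsto_pow_atTop_nhds_zero_of_lt_one (r := (1 / 2 : ℝ)) (by norm_num) (by norm_num)
  simpa using (h1.add h2).mul_const S

end Decay

/-! ### The estimate on the lattice -/

section Series

variable {n : ℕ} {𝕜 : Type*} [RCLike 𝕜]

lemma hasSum_of_eq {ι : Type*} {f g : ι → 𝕜} {x : 𝕜} (h : HasSum f x) (hfg : ∀ i, g i = f i) :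
    HasSum g x := by
  rwa [funext hfg]

lemma hasSum_trans_mul {j : ℕ} {g : (Fin n → ℤ) → ℝ} (hg : ∀ b ∉ box n (j + 1), g b = 0)
    (x : Fin n → ℤ) (s : (Fin n → ℤ) → 𝕜) :
    HasSum (fun m => ((trans m j g x : ℝ) : 𝕜) * s m)
      (((g (rmd (j + 1) x) : ℝ) : 𝕜) * s (quo (j + 1) x)) := by
  have h : ((g (rmd (j + 1) x) : ℝ) : 𝕜) * s (quo (j + 1) x)
      = ((trans (quo (j + 1) x) j g x : ℝ) : 𝕜) * s (quo (j + 1) x) := by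
    rw [rmd_eq_sub, trans]
  rw [h]
  refine hasSum_single _ fun m hm => ?_
  rw [trans, hg, RCLike.ofReal_zero, zero_mul]
  intro hx
  refine hm ?_
  rw [mem_box_iff_ediv] at hx
  funext i
  have := hx i
  rw [sub_eq_add_neg, ← mul_neg, Int.add_mul_ediv_left _ _ (by positivity)] at this
  simp only [quo]
  linarith

lemma sum_eq_sum_box_sub {k : ℕ} {b : Fin n → ℤ} {Z : Finset (Fin n → ℤ)}
    (hZ : ∀ v ∈ box n k, b - v ∈ Z) {g : (Fin n → ℤ) → 𝕜} (hg : ∀ z, b - z ∉ box n k → g z = 0) :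
    ∑ z ∈ Z, g z = ∑ v ∈ box n k, g (b - v) := by
  classical
  rw [← Finset.sum_subset (s₁ := (box n k).image fun v => b - v)
    (Finset.image_subset_iff.2 hZ) fun z _ hz => hg z fun h => hz
      (Finset.mem_image.2 ⟨b - z, h, sub_sub_cancel b z⟩),
    Finset.sum_image fun v _ v' _ h => sub_right_injective h]

/-- The pairs of cubes of one grid around two points, parametrised by either of the cubes. -/
lemma sum_box_exchange (k : ℕ) (a b : Fin n → ℤ)
    (g : (Fin n → ℤ) → (Fin n → ℤ) → 𝕜) :
    ∑ v ∈ box n k, g (rmd k (a - b + v)) v = ∑ u ∈ box n k, g u (rmd k (b - a + u)) := by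
  have h : ∀ x y : Fin n → ℤ, ∀ v ∈ box n k, rmd k (y - x + rmd k (x - y + v)) = v := by
    intro x y v hv
    rw [rmd_rmd_add le_rfl, show y - x + (x - y + v) = v by abel, rmd_eq_self hv]
  refine Finset.sum_nbij' (fun v => rmd k (a - b + v)) (fun u => rmd k (b - a + u))
    (fun v _ => rmd_mem_box _ _) (fun u _ => rmd_mem_box _ _) (h a b) (h b a) ?_
  intro v hv
  rw [h a b v hv]

variable (t : (Fin n → ℤ) → (Fin n → ℤ) → 𝕜)

lemma add_quo_eq (k : ℕ) (a z : Fin n → ℤ) :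
    (fun i => z i + 2 ^ k * quo k (a - z) i) = a - rmd k (a - z) := by
  funext i
  simp only [rmd_eq_sub, Pi.sub_apply]
  ring

/-- The representation of the cancellative part by shift operators: the series over `m` is finite at
any two points, since only the neighbour that contains `a` contributes. -/
lemma hasSum_haarKernel (η θ : Fin n → Fin 2) {N : ℕ} {Z : Finset (Fin n → ℤ)} (a : Fin n → ℤ)
    {b : Fin n → ℤ} (hZ : ∀ j < N, ∀ v ∈ box n (j + 1), b - v ∈ Z) :
    HasSum (fun m => shiftKernel N Z
      (fun j z => haarSum t η θ j (fun i => z i + 2 ^ (j + 1) * m i) z)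
      (fun j => trans m j (sg η j)) (fun j => sg θ j) a b)
      (∑ j ∈ Finset.range N, haarPart t η θ j a b) := by
  have hj : ∀ j ∈ Finset.range N, haarPart t η θ j a b = ∑ z ∈ Z,
      ((((2 ^ (j + 1)) ^ n)⁻¹ ^ 3 * sg θ j (b - z) : ℝ) : 𝕜) *
        (((sg η j (rmd (j + 1) (a - z)) : ℝ) : 𝕜) *
          haarSum t η θ j (fun i => z i + 2 ^ (j + 1) * quo (j + 1) (a - z) i) z) := by
    intro j hj
    rw [sum_eq_sum_box_sub (hZ j (Finset.mem_range.1 hj)) fun z hz => by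
      rw [sg_eq_zero θ hz, mul_zero, RCLike.ofReal_zero, zero_mul], haarPart, Finset.mul_sum]
    refine Finset.sum_congr rfl fun v _ => ?_
    rw [add_quo_eq, sub_sub_cancel, show a - (b - v) = a - b + v by abel]
    push_cast
    ring
  rw [Finset.sum_congr rfl hj]
  refine hasSum_sum fun j _ => hasSum_sum fun z _ => ?_
  refine hasSum_of_eq ((hasSum_trans_mul (fun _ => sg_eq_zero η) (a - z) fun m =>
    haarSum t η θ j (fun i => z i + 2 ^ (j + 1) * m i) z).mul_left
    ((((2 ^ (j + 1)) ^ n)⁻¹ ^ 3 * sg θ j (b - z) : ℝ) : 𝕜)) fun m => ?_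
  push_cast
  ring

/-- Since the operator annihilates constants, the subtraction of the indicator function of the
cube itself does not change the sum. -/
lemma hasSum_diffKernel {θ : Fin n → Fin 2} (h0 : ∀ (j : ℕ) (z : Fin n → ℤ),
      HasSum (fun m : Fin n → ℤ => haarSum t 0 θ j (fun i => z i + 2 ^ (j + 1) * m i) z) 0)
    {N : ℕ} {Z : Finset (Fin n → ℤ)} (a : Fin n → ℤ)
    {b : Fin n → ℤ} (hZ : ∀ j < N, ∀ v ∈ box n (j + 1), b - v ∈ Z) :
    HasSum (fun m => shiftKernel N Z
      (fun j z => haarSum t 0 θ j (fun i => z i + 2 ^ (j + 1) * m i) z)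
      (fun j b => trans m j (sg 0 j) b - sg 0 j b) (fun j => sg θ j) a b)
      (∑ j ∈ Finset.range N, haarPart t 0 θ j a b) := by
  have h1 := hasSum_haarKernel t 0 θ a hZ
  have h2 : HasSum (fun m : Fin n → ℤ => ∑ j ∈ Finset.range N, ∑ z ∈ Z,
      ((((2 ^ (j + 1)) ^ n)⁻¹ ^ 3 * (sg 0 j (a - z) * sg θ j (b - z)) : ℝ) : 𝕜) *
        haarSum t 0 θ j (fun i => z i + 2 ^ (j + 1) * m i) z) 0 := by
    have h := hasSum_sum fun j (_ : j ∈ Finset.range N) => hasSum_sum fun z (_ : z ∈ Z) =>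
      (h0 j z).mul_left ((((2 ^ (j + 1)) ^ n)⁻¹ ^ 3 * (sg 0 j (a - z) * sg θ j (b - z)) : ℝ) : 𝕜)
    simpa only [mul_zero, Finset.sum_const_zero] using h
  have h3 := h1.sub h2
  rw [sub_zero] at h3
  refine hasSum_of_eq h3 fun m => ?_
  simp only [shiftKernel, ← Finset.sum_sub_distrib, ← sub_mul]
  refine Finset.sum_congr rfl fun j _ => Finset.sum_congr rfl fun z _ => ?_
  push_cast
  ring

/-- The case of a cancellative Haar function in the range: the cubes are parametrised by the one
that contains `a`, and the neighbours lie in the domain. -/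
lemma hasSum_diffKernel_transpose {η : Fin n → Fin 2} (h0 : ∀ (j : ℕ) (w : Fin n → ℤ),
      HasSum (fun m : Fin n → ℤ => haarSum t η 0 j w (fun i => w i + 2 ^ (j + 1) * m i)) 0)
    {N : ℕ} {Z : Finset (Fin n → ℤ)} {a : Fin n → ℤ}
    (b : Fin n → ℤ) (hZ : ∀ j < N, ∀ v ∈ box n (j + 1), a - v ∈ Z) :
    HasSum (fun m => shiftKernel N Z
      (fun j w => haarSum t η 0 j w (fun i => w i + 2 ^ (j + 1) * m i))
      (fun j => sg η j) (fun j b => trans m j (sg 0 j) b - sg 0 j b) a b)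
      (∑ j ∈ Finset.range N, haarPart t η 0 j a b) := by
  have hj : ∀ j ∈ Finset.range N, haarPart t η 0 j a b = ∑ w ∈ Z,
      ((((2 ^ (j + 1)) ^ n)⁻¹ ^ 3 * sg η j (a - w) : ℝ) : 𝕜) *
        (((sg 0 j (rmd (j + 1) (b - w)) : ℝ) : 𝕜) *
          haarSum t η 0 j w (fun i => w i + 2 ^ (j + 1) * quo (j + 1) (b - w) i)) := by
    intro j hj
    rw [sum_eq_sum_box_sub (hZ j (Finset.mem_range.1 hj)) fun z hz => by
      rw [sg_eq_zero η hz, mul_zero, RCLike.ofReal_zero, zero_mul], haarPart, Finset.mul_sum]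
    have hex := sum_box_exchange (j + 1) a b fun u v =>
      (((2 ^ (j + 1)) ^ n)⁻¹ ^ 3 : 𝕜) * (((sg η j u * sg 0 j v : ℝ) : 𝕜) *
        haarSum t η 0 j (a - u) (b - v))
    rw [hex]
    refine Finset.sum_congr rfl fun u _ => ?_
    rw [add_quo_eq, sub_sub_cancel, show b - (a - u) = b - a + u by abel]
    push_cast
    ring
  have h1 : HasSum (fun m : Fin n → ℤ => ∑ j ∈ Finset.range N, ∑ w ∈ Z,
      ((((2 ^ (j + 1)) ^ n)⁻¹ ^ 3 * sg η j (a - w) : ℝ) : 𝕜) *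
        (((trans m j (sg 0 j) (b - w) : ℝ) : 𝕜) *
          haarSum t η 0 j w (fun i => w i + 2 ^ (j + 1) * m i)))
      (∑ j ∈ Finset.range N, haarPart t η 0 j a b) := by
    rw [Finset.sum_congr rfl hj]
    exact hasSum_sum fun j _ => hasSum_sum fun w _ =>
      (hasSum_trans_mul (fun _ => sg_eq_zero 0) (b - w) fun m =>
        haarSum t η 0 j w (fun i => w i + 2 ^ (j + 1) * m i)).mul_left _
  have h2 : HasSum (fun m : Fin n → ℤ => ∑ j ∈ Finset.range N, ∑ w ∈ Z,
      ((((2 ^ (j + 1)) ^ n)⁻¹ ^ 3 * (sg η j (a - w) * sg 0 j (b - w)) : ℝ) : 𝕜) *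
        haarSum t η 0 j w (fun i => w i + 2 ^ (j + 1) * m i)) 0 := by
    have h := hasSum_sum fun j (_ : j ∈ Finset.range N) => hasSum_sum fun w (_ : w ∈ Z) =>
      (h0 j w).mul_left ((((2 ^ (j + 1)) ^ n)⁻¹ ^ 3 * (sg η j (a - w) * sg 0 j (b - w)) : ℝ) : 𝕜)
    simpa only [mul_zero, Finset.sum_const_zero] using h
  have h3 := h1.sub h2
  rw [sub_zero] at h3
  refine hasSum_of_eq h3 fun m => ?_
  simp only [shiftKernel, ← Finset.sum_sub_distrib]
  refine Finset.sum_congr rfl fun j _ => Finset.sum_congr rfl fun z _ => ?_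
  push_cast
  ring

end Series

section Lattice

variable {n : ℕ}

/-- The least `L` with `|m|_∞ ≤ 2^L`. -/
noncomputable def shiftLevel (m : Fin n → ℤ) : ℕ :=
  Nat.clog 2 (Finset.univ.sup fun i => (m i).natAbs)

lemma abs_le_shiftLevel (m : Fin n → ℤ) (i : Fin n) : |m i| ≤ 2 ^ shiftLevel m := by
  have h1 : (m i).natAbs ≤ Finset.univ.sup fun i => (m i).natAbs :=
    Finset.le_sup (f := fun i => (m i).natAbs) (Finset.mem_univ i)
  have h2 := h1.trans (Nat.le_pow_clog one_lt_two _)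
  rw [Int.abs_eq_natAbs]
  exact_mod_cast h2

lemma shiftLevel_le (m : Fin n → ℤ) :
    ((shiftLevel m + 2 : ℕ) : ℝ) ≤ 4 * (1 + Real.posLog (latticeNorm m)) := by
  have hpos : 0 ≤ Real.posLog (latticeNorm m) := Real.posLog_nonneg
  rw [shiftLevel]
  set M := Finset.univ.sup fun i => (m i).natAbs with hM
  have hMle : (M : ℝ) ≤ latticeNorm m := by
    have h0 : 0 ≤ latticeNorm m := Real.sqrt_nonneg _
    rw [← Nat.le_floor_iff h0]
    refine Finset.sup_le fun i _ => Nat.le_floor ?_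
    rw [latticeNorm, Nat.cast_natAbs, Int.cast_abs]
    refine Real.abs_le_sqrt ?_
    exact Finset.single_le_sum (f := fun i => (m i : ℝ) ^ 2) (fun i _ => sq_nonneg _)
      (Finset.mem_univ i)
  rcases Nat.lt_or_ge 1 M with h1 | h1
  · have h2 := Nat.pow_pred_clog_lt_self one_lt_two h1
    have h3 : ((2 : ℝ) ^ (Nat.clog 2 M).pred) ≤ M := by exact_mod_cast h2.le
    have h4 := Real.log_le_log (by positivity) (h3.trans hMle)
    rw [Real.log_pow] at h4
    have h5 : Real.log (latticeNorm m) ≤ Real.posLog (latticeNorm m) := le_max_right _ _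
    have h6 : 1 / 2 ≤ Real.log 2 := by
      have := Real.log_two_gt_d9
      linarith
    have h7 := Nat.clog_pos one_lt_two h1
    obtain ⟨l, hl⟩ := Nat.exists_eq_succ_of_ne_zero h7.ne'
    rw [hl, Nat.pred_succ] at h4
    rw [hl]
    push_cast
    have h8 : (l : ℝ) * (1 / 2) ≤ l * Real.log 2 :=
      mul_le_mul_of_nonneg_left h6 (Nat.cast_nonneg l)
    linarith
  · rw [Nat.clog_of_right_le_one h1]
    push_cast
    linarith

/-- Pointwise limits of functions with a common finite support. -/
lemma eLpNorm_count_le_of_tendsto {G X ι : Type*} [MeasurableSpace G] [MeasurableSingletonClass G]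
    [NormedAddCommGroup X] {p : ℝ≥0∞} (hp0 : p ≠ 0) (hp : p ≠ ∞) {l : Filter ι} [l.NeBot]
    {Λ : Finset G} {u : ι → G → X} {U : G → X} (hu : ∀ i, ∀ a ∉ Λ, u i a = 0)
    (hU : ∀ a, Tendsto (fun i => u i a) l (𝓝 (U a))) {B : ℝ≥0∞}
    (hB : ∀ i, eLpNorm (u i) p Measure.count ≤ B) : eLpNorm U p Measure.count ≤ B := by
  have hUs : ∀ a ∉ Λ, U a = 0 := fun a ha => by
    have h := hU a
    simp only [hu _ a ha] at h
    exact tendsto_nhds_unique h tendsto_const_nhds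
  rw [eLpNorm_count_of_support hp0 hp hUs]
  refine le_of_tendsto (f := fun i => eLpNorm (u i) p Measure.count) (x := l) ?_
    (Eventually.of_forall hB)
  simp only [fun i => eLpNorm_count_of_support hp0 hp (hu i)]
  refine (ENNReal.continuous_rpow_const.tendsto _).comp (tendsto_finsetSum _ fun a _ => ?_)
  exact (ENNReal.continuous_rpow_const.tendsto _).comp ((hU a).enorm)

variable {X 𝕜 : Type*} [NormedAddCommGroup X] [RCLike 𝕜] [NormedSpace 𝕜 X]

lemma eLpNorm_hasSum_kernel_le {p : ℝ≥0∞} (hp1 : 1 ≤ p) (hp : p ≠ ∞)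
    {k : (Fin n → ℤ) → (Fin n → ℤ) → (Fin n → ℤ) → 𝕜} {R : (Fin n → ℤ) → (Fin n → ℤ) → 𝕜}
    {F Λ : Finset (Fin n → ℤ)} (f : (Fin n → ℤ) → X)
    (h : ∀ a ∈ Λ, ∀ b ∈ F, HasSum (fun m => k m a b) (R a b)) {B : (Fin n → ℤ) → ℝ≥0∞}
    (hB : ∀ m, eLpNorm (fun a => ∑ b ∈ F, k m a b • f b) p Measure.count ≤ B m) :
    eLpNorm ((Λ : Set (Fin n → ℤ)).indicator fun a => ∑ b ∈ F, R a b • f b) p Measure.count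
      ≤ ∑' m, B m := by
  classical
  refine eLpNorm_count_le_of_tendsto (l := atTop) (Λ := Λ) (zero_lt_one.trans_le hp1).ne' hp
    (u := fun s : Finset (Fin n → ℤ) => (Λ : Set (Fin n → ℤ)).indicator
      fun a => ∑ m ∈ s, ∑ b ∈ F, k m a b • f b)
    (fun s a ha => Set.indicator_of_notMem (by simpa using ha) _) (fun a => ?_) fun s => ?_
  · by_cases ha : a ∈ Λ
    · simp only [Set.indicator_of_mem (Finset.mem_coe.2 ha)]
      exact hasSum_sum fun b hb => (h a ha b hb).smul_const (f b)
    · simp only [Set.indicator_of_notMem (fun h => ha (Finset.mem_coe.1 h))]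
      exact tendsto_const_nhds
  · refine (eLpNorm_indicator_le _).trans ?_
    exact (eLpNorm_sum_le_of_discrete hp1 s _).trans
      ((Finset.sum_le_sum fun m _ => hB m).trans (ENNReal.sum_le_tsum s))

end Lattice

section LatticeTheorem

variable {n : ℕ}

lemma tsum_shift_bound_le {Cf : (Fin n → ℤ) → ℝ≥0} {C : ℝ≥0}
    (hC : ∑' m, ENNReal.ofReal (1 + Real.posLog (latticeNorm m)) * (Cf m : ℝ≥0∞) ≤ C)
    (D : ℝ≥0∞) :
    ∑' m, 2 * ((Cf m : ℝ≥0∞) * (2 ^ n * ((shiftLevel m + 2 : ℕ) * (2 * (2 * D)))))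
      ≤ 32 * 2 ^ n * C * D := by
  have h : ∀ m, 2 * ((Cf m : ℝ≥0∞) * (2 ^ n * ((shiftLevel m + 2 : ℕ) * (2 * (2 * D)))))
      ≤ 32 * 2 ^ n * D *
        (ENNReal.ofReal (1 + Real.posLog (latticeNorm m)) * (Cf m : ℝ≥0∞)) := by
    intro m
    have h1 : ((shiftLevel m + 2 : ℕ) : ℝ≥0∞)
        ≤ 4 * ENNReal.ofReal (1 + Real.posLog (latticeNorm m)) := by
      have h2 := ENNReal.ofReal_le_ofReal (shiftLevel_le m)
      rw [ENNReal.ofReal_natCast, ENNReal.ofReal_mul (by norm_num)] at h2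
      simpa using h2
    calc _ ≤ 2 * ((Cf m : ℝ≥0∞) * (2 ^ n *
          (4 * ENNReal.ofReal (1 + Real.posLog (latticeNorm m)) * (2 * (2 * D))))) := by gcongr
      _ = _ := by ring
  refine (ENNReal.tsum_le_tsum h).trans ?_
  rw [ENNReal.tsum_mul_left]
  calc _ ≤ 32 * 2 ^ n * D * (C : ℝ≥0∞) := by gcongr
    _ = _ := by ring

lemma latticeNorm_neg (m : Fin n → ℤ) : latticeNorm (-m) = latticeNorm m := by
  simp [latticeNorm]

lemma sum_totalCoeff_le {Cf : (Fin n → Fin 2) → (Fin n → Fin 2) → (Fin n → ℤ) → ℝ≥0} {C : ℝ≥0}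
    (hC : ∀ η θ : Fin n → Fin 2, (η, θ) ≠ (0, 0) →
      ∑' m, ENNReal.ofReal (1 + Real.posLog (latticeNorm m)) * (Cf η θ m : ℝ≥0∞) ≤ C)
    (s : Finset (Fin n → ℤ)) :
    ∑ m ∈ s, (totalCoeff Cf m : ℝ) ≤ ∑ _e ∈ (Finset.univ :
      Finset ((Fin n → Fin 2) × (Fin n → Fin 2))).erase (0, 0), (C : ℝ) := by
  simp only [totalCoeff, NNReal.coe_sum]
  rw [Finset.sum_comm]
  refine Finset.sum_le_sum fun e he => ?_
  have h := hC e.1 e.2 (Finset.ne_of_mem_erase he)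
  have h1 : ∑ m ∈ s, (Cf e.1 e.2 m : ℝ≥0∞) ≤ C := by
    refine le_trans (Finset.sum_le_sum fun m _ => ?_) ((ENNReal.sum_le_tsum s).trans h)
    refine le_mul_of_one_le_left' ?_
    rw [← ENNReal.ofReal_one]
    exact ENNReal.ofReal_le_ofReal (by linarith [Real.posLog_nonneg (x := latticeNorm m)])
  exact_mod_cast h1

variable {X 𝕜 : Type*} [NormedAddCommGroup X] [NormedSpace ℝ X] [RCLike 𝕜] [NormedSpace 𝕜 X]
  [IsScalarTower ℝ 𝕜 X]

/-- Each cancellative part of the kernel is a series of shift operators, whose norms are summable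
by the assumption on the Haar coefficients. -/
lemma IsLatticeKernel.haarPart_le {t : (Fin n → ℤ) → (Fin n → ℤ) → 𝕜}
    {Cf : (Fin n → Fin 2) → (Fin n → Fin 2) → (Fin n → ℤ) → ℝ≥0} (ht : IsLatticeKernel t Cf)
    {C : ℝ≥0} (hC : ∀ η θ : Fin n → Fin 2, (η, θ) ≠ (0, 0) →
      ∑' m, ENNReal.ofReal (1 + Real.posLog (latticeNorm m)) * (Cf η θ m : ℝ≥0∞) ≤ C)
    {p : ℝ≥0∞} (hp1 : 1 ≤ p) (hp : p ≠ ∞) {β : ℝ≥0∞} (hβ : IsDiscreteBound (Fin n → ℤ) p X β)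
    {f : (Fin n → ℤ) → X} {F : Finset (Fin n → ℤ)} (hf : ∀ a ∉ F, f a = 0)
    (Λ : Finset (Fin n → ℤ)) (N : ℕ) {η θ : Fin n → Fin 2} (hηθ : (η, θ) ≠ (0, 0)) :
    eLpNorm ((Λ : Set (Fin n → ℤ)).indicator fun a => ∑ b ∈ F,
      (∑ j ∈ Finset.range N, haarPart t η θ j a b) • f b) p Measure.count
      ≤ 32 * 2 ^ n * C * (β ^ 2 * eLpNorm f p Measure.count) := by
  classical
  have hZ : ∀ F : Finset (Fin n → ℤ), ∃ Z : Finset (Fin n → ℤ), ∀ b ∈ F, ∀ j < N,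
      ∀ v ∈ box n (j + 1), b - v ∈ Z := fun F =>
    ⟨(Finset.range N).biUnion fun j => Finset.image₂ (fun b v => b - v) F (box n (j + 1)),
      fun b hb j hj v hv => Finset.mem_biUnion.2
        ⟨j, Finset.mem_range.2 hj, Finset.mem_image₂_of_mem hb hv⟩⟩
  by_cases hη : η = 0
  · subst hη
    have hθ : θ ≠ 0 := fun h => hηθ (by rw [h])
    obtain ⟨Z, hZ⟩ := hZ F
    refine (eLpNorm_hasSum_kernel_le hp1 hp f
      (fun a _ b hb => hasSum_diffKernel t (ht.hasSum_left θ hθ) a (hZ b hb)) fun m =>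
        diffKernel_le hp1 hβ hθ (abs_le_shiftLevel m) N Z hf fun j z =>
          ht.bound 0 θ hηθ j z m).trans ?_
    simp only [mul_assoc (2 : ℝ≥0∞) (β ^ 2)]
    exact tsum_shift_bound_le (hC 0 θ hηθ) _
  by_cases hθ : θ = 0
  · subst hθ
    obtain ⟨Z, hZ⟩ := hZ Λ
    refine (eLpNorm_hasSum_kernel_le hp1 hp f
      (fun a ha b _ => hasSum_diffKernel_transpose t (ht.hasSum_right η hη) b (hZ a ha)) fun m =>
        -- here the neighbour is the cube in the domain, so that `m` changes its sign
        diffKernel_transpose_le hp1 hβ hη (abs_le_shiftLevel m) N Z hf (C := Cf η 0 (-m))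
          fun j z => ?_).trans ?_
    · have h := ht.bound η 0 hηθ j (fun i => z i + 2 ^ (j + 1) * m i) (-m)
      simpa using h
    · simp only [mul_assoc (2 : ℝ≥0∞) (β ^ 2)]
      refine tsum_shift_bound_le (Cf := fun m => Cf η 0 (-m)) ?_ _
      rw [← (Equiv.neg (Fin n → ℤ)).tsum_eq]
      simpa [latticeNorm_neg] using hC η 0 hηθ
  · obtain ⟨Z, hZ⟩ := hZ F
    refine (eLpNorm_hasSum_kernel_le hp1 hp f
      (fun a _ b hb => hasSum_haarKernel t η θ a (hZ b hb)) fun m =>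
        haarKernel_le hp1 hβ hη hθ (abs_le_shiftLevel m) N Z hf fun j z =>
          ht.bound η θ hηθ j z m).trans ?_
    simp only [mul_assoc (2 : ℝ≥0∞) (β ^ 2)]
    exact tsum_shift_bound_le (hC η θ hηθ) _

/-- The `T(1)` theorem on the lattice. -/
theorem IsLatticeKernel.eLpNorm_le (hn : 0 < n) {t : (Fin n → ℤ) → (Fin n → ℤ) → 𝕜}
    {Cf : (Fin n → Fin 2) → (Fin n → Fin 2) → (Fin n → ℤ) → ℝ≥0} (ht : IsLatticeKernel t Cf)
    {C : ℝ≥0} (hC : ∀ η θ : Fin n → Fin 2, (η, θ) ≠ (0, 0) →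
      ∑' m, ENNReal.ofReal (1 + Real.posLog (latticeNorm m)) * (Cf η θ m : ℝ≥0∞) ≤ C)
    {p : ℝ≥0∞} (hp1 : 1 ≤ p) (hp : p ≠ ∞) {β : ℝ≥0∞} (hβ : IsDiscreteBound (Fin n → ℤ) p X β)
    {f : (Fin n → ℤ) → X} {F : Finset (Fin n → ℤ)} (hf : ∀ a ∉ F, f a = 0)
    (Λ : Finset (Fin n → ℤ)) :
    eLpNorm ((Λ : Set (Fin n → ℤ)).indicator fun a => ∑ b ∈ F, t a b • f b) p Measure.count
      ≤ 32 * 8 ^ n * C * (β ^ 2 * eLpNorm f p Measure.count) := by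
  classical
  set E := (Finset.univ : Finset ((Fin n → Fin 2) × (Fin n → Fin 2))).erase (0, 0) with hE
  refine eLpNorm_count_le_of_tendsto (l := atTop) (Λ := Λ) (zero_lt_one.trans_le hp1).ne' hp
    (u := fun N : ℕ => (Λ : Set (Fin n → ℤ)).indicator fun a => ∑ b ∈ F,
      (∑ e ∈ E, ∑ j ∈ Finset.range N, haarPart t e.1 e.2 j a b) • f b)
    (fun s a ha => Set.indicator_of_notMem (by simpa using ha) _) (fun a => ?_) fun N => ?_
  · by_cases ha : a ∈ Λ
    · simp only [Set.indicator_of_mem (Finset.mem_coe.2 ha)]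
      refine tendsto_finsetSum _ fun b _ => Tendsto.smul_const ?_ _
      have h := (tendsto_const_nhds (x := t a b)).sub
        (ht.tendsto_gridAvg hn (sum_totalCoeff_le hC) a b)
      rw [sub_zero] at h
      refine h.congr fun N => ?_
      rw [eq_sum_haarPart t N a b, add_sub_cancel_right]
    · simp only [Set.indicator_of_notMem (fun h => ha (Finset.mem_coe.1 h))]
      exact tendsto_const_nhds
  · have hsum : ((Λ : Set (Fin n → ℤ)).indicator fun a => ∑ b ∈ F,
        (∑ e ∈ E, ∑ j ∈ Finset.range N, haarPart t e.1 e.2 j a b) • f b)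
        = fun a => ∑ e ∈ E, (Λ : Set (Fin n → ℤ)).indicator (fun a => ∑ b ∈ F,
          (∑ j ∈ Finset.range N, haarPart t e.1 e.2 j a b) • f b) a := by
      funext a
      by_cases ha : a ∈ (Λ : Set (Fin n → ℤ))
      · simp only [Set.indicator_of_mem ha, Finset.sum_smul]
        rw [Finset.sum_comm]
      · simp only [Set.indicator_of_notMem ha, Finset.sum_const_zero]
    rw [hsum]
    refine (eLpNorm_sum_le_of_discrete hp1 E _).trans
      ((Finset.sum_le_card_nsmul _ _ _ fun e he =>
        ht.haarPart_le hC hp1 hp hβ hf Λ N (Finset.ne_of_mem_erase he)).trans ?_)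
    -- the constant: at most `4ⁿ` pairs of signatures, each with the bound `32 · 2ⁿ C β²`
    have hcard : E.card ≤ 4 ^ n := by
      refine (Finset.card_le_card (Finset.erase_subset _ _)).trans (le_of_eq ?_)
      rw [Finset.card_univ, Fintype.card_prod, Fintype.card_fun, Fintype.card_fin, Fintype.card_fin,
        ← mul_pow]
      norm_num
    rw [nsmul_eq_mul]
    have hcard' : (E.card : ℝ≥0∞) ≤ 4 ^ n := by exact_mod_cast hcard
    calc _ ≤ 4 ^ n * (32 * 2 ^ n * (C : ℝ≥0∞) * (β ^ 2 * eLpNorm f p Measure.count)) := by gcongr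
      _ = _ := by
        have h8 : (8 : ℝ≥0∞) ^ n = 4 ^ n * 2 ^ n := by
          rw [← mul_pow]
          norm_num
        rw [h8]
        ring

end LatticeTheorem

/-! ### Discretisation of the operator -/

section Discretisation

variable {n : ℕ}

/-- The cube with corner `2^{-M} z` and side `2^{-M} s`. -/
noncomputable def gridCube (M : ℕ) (z : Fin n → ℤ) (s : ℕ) (hs : 0 < s) : Cube n :=
  (fun i => z i / 2 ^ M, ⟨s / 2 ^ M, Set.mem_Ioi.2 (by positivity)⟩)

lemma mem_gridCube {M : ℕ} {z : Fin n → ℤ} {s : ℕ} {hs : 0 < s} {y : Fin n → ℝ} :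
    y ∈ (gridCube M z s hs).toSet ↔
      gridMap n M y - z ∈ Fintype.piFinset fun _ : Fin n => Finset.Ico (0 : ℤ) s := by
  have h2 : (0 : ℝ) < 2 ^ M := by positivity
  simp only [Cube.toSet, Set.mem_ofPred_eq, gridCube, Cube.corner, Cube.side, Set.mem_Ico,
    Fintype.mem_piFinset, Finset.mem_Ico, Pi.sub_apply, gridMap]
  refine forall_congr' fun i => ?_
  rw [sub_nonneg, Int.le_floor, sub_lt_iff_lt_add, Int.floor_lt, ← add_div, div_le_iff₀ h2,
    lt_div_iff₀ h2, mul_comm]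
  push_cast
  rw [add_comm (s : ℝ)]

variable {𝕜 : Type*} [RCLike 𝕜]

lemma ind_cell_apply (M : ℕ) (a : Fin n → ℤ) (y : Fin n → ℝ) :
    (ind 𝕜 (cell M a) : (Fin n → ℝ) → 𝕜) y = if gridMap n M y = a then 1 else 0 := by
  change cubeIndicator 𝕜 (cell M a) y = _
  split_ifs with h
  · rw [cubeIndicator, Set.indicator_of_mem (mem_cell.2 h), Pi.one_apply]
  · rw [cubeIndicator, Set.indicator_of_notMem fun h' => h (mem_cell.1 h')]

lemma sum_ind_cell_apply (M : ℕ) (z : Fin n → ℤ) (B : Finset (Fin n → ℤ)) (c : (Fin n → ℤ) → 𝕜)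
    (y : Fin n → ℝ) :
    ((∑ v ∈ B, c v • ind 𝕜 (cell M (z + v)) : StepFun 𝕜 n) : (Fin n → ℝ) → 𝕜) y
      = if gridMap n M y - z ∈ B then c (gridMap n M y - z) else 0 := by
  rw [Submodule.coe_sum, Finset.sum_apply]
  have h : ∀ v, ((c v • ind 𝕜 (cell M (z + v)) : StepFun 𝕜 n) : (Fin n → ℝ) → 𝕜) y
      = if gridMap n M y - z = v then c v else 0 := by
    intro v
    rw [Submodule.coe_smul, Pi.smul_apply, ind_cell_apply, smul_eq_mul, mul_ite, mul_one, mul_zero]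
    exact if_congr sub_eq_iff_eq_add'.symm rfl rfl
  simp only [h]
  rw [Finset.sum_ite_eq]

lemma ind_gridCube (M : ℕ) (z : Fin n → ℤ) (s : ℕ) (hs : 0 < s) :
    ind 𝕜 (gridCube M z s hs)
      = ∑ v ∈ Fintype.piFinset fun _ : Fin n => Finset.Ico (0 : ℤ) s, ind 𝕜 (cell M (z + v)) := by
  have h1 := sum_ind_cell_apply (𝕜 := 𝕜) M z
    (Fintype.piFinset fun _ : Fin n => Finset.Ico (0 : ℤ) s) fun _ => 1
  simp only [one_smul] at h1
  refine Subtype.ext (funext fun y => ?_)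
  rw [h1]
  change cubeIndicator 𝕜 (gridCube M z s hs) y = _
  split_ifs with h
  · rw [cubeIndicator, Set.indicator_of_mem (mem_gridCube.2 h), Pi.one_apply]
  · rw [cubeIndicator, Set.indicator_of_notMem fun h' => h (mem_gridCube.1 h')]

/-- The cube with corner `2^{-M} z` and side `2^{k - M}`. -/
noncomputable def dyadicCube (M : ℕ) (z : Fin n → ℤ) (k : ℕ) : Cube n :=
  gridCube M z (2 ^ k) (by positivity)

lemma dyadicCube_side (M : ℕ) (z : Fin n → ℤ) (k : ℕ) :
    (dyadicCube M z k).side = 2 ^ k / 2 ^ M := by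
  simp [dyadicCube, gridCube, Cube.side]

lemma dyadicCube_shift (M : ℕ) (z : Fin n → ℤ) (k : ℕ) (m : Fin n → ℤ) :
    (dyadicCube M z k).shift m = dyadicCube M (fun i => z i + 2 ^ k * m i) k := by
  refine Prod.ext (funext fun i => ?_) rfl
  change (z i : ℝ) / 2 ^ M + (dyadicCube M z k).side * m i
    = ((z i + 2 ^ k * m i : ℤ) : ℝ) / 2 ^ M
  rw [dyadicCube_side]
  push_cast
  ring

lemma ind_dyadicCube (M : ℕ) (z : Fin n → ℤ) (k : ℕ) :
    ind 𝕜 (dyadicCube M z k) = ∑ v ∈ box n k, ind 𝕜 (cell M (z + v)) := by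
  rw [dyadicCube, ind_gridCube, box]
  simp

lemma haarOne_dyadic (e : Fin 2) (M j : ℕ) (z : ℤ) (y : ℝ) :
    haarOne 𝕜 e (z / 2 ^ M) (2 ^ (j + 1) / 2 ^ M) y
      = (((Real.sqrt (2 ^ (j + 1) / 2 ^ M))⁻¹ * signOne e ((⌊2 ^ M * y⌋ - z) / 2 ^ j) : ℝ) : 𝕜) := by
  have h2 : (0 : ℝ) < 2 ^ M := by positivity
  have hmem : ∀ q : ℤ, y ∈ Set.Ico ((z : ℝ) / 2 ^ M + q * (2 ^ j / 2 ^ M))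
      ((z : ℝ) / 2 ^ M + q * (2 ^ j / 2 ^ M) + 2 ^ j / 2 ^ M) ↔ (⌊2 ^ M * y⌋ - z) / 2 ^ j = q := by
    intro q
    rw [Int.ediv_eq_iff_mem_Ico (by positivity), le_sub_iff_add_le, Int.le_floor,
      sub_lt_iff_lt_add, Int.floor_lt, Set.mem_Ico, mul_div_assoc', ← add_div, ← add_div,
      div_le_iff₀ h2, lt_div_iff₀ h2, mul_comm y]
    push_cast
    constructor <;> rintro ⟨h1, h3⟩ <;> constructor <;> linarith
  have h0 := hmem 0
  have h1 := hmem 1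
  rw [Int.cast_zero, zero_mul, add_zero] at h0
  rw [Int.cast_one, one_mul] at h1
  have hhalf : (2 : ℝ) ^ (j + 1) / 2 ^ M / 2 = 2 ^ j / 2 ^ M := by
    rw [pow_succ]
    ring
  rw [haarOne_eq_sum e (by positivity) y, Fin.sum_univ_two, hhalf]
  simp only [if_true, one_ne_zero, if_false, or_true, or_false, add_zero]
  classical
  rw [Set.indicator_apply, Set.indicator_apply]
  simp only [h0, h1, Pi.one_apply, signOne]
  by_cases hq0 : (⌊2 ^ M * y⌋ - z) / 2 ^ j = 0
  · simp [hq0]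
  · by_cases hq1 : (⌊2 ^ M * y⌋ - z) / 2 ^ j = 1
    · by_cases he : e = 0 <;> simp [hq1, he]
    · simp [hq0, hq1]

/-- The normalising factor `ℓ^{-n/2}` of the Haar functions of the cubes of side
`ℓ = 2^{j + 1 - M}`. -/
noncomputable def haarNorm (n M j : ℕ) : ℝ := (Real.sqrt (2 ^ (j + 1) / 2 ^ M))⁻¹ ^ n

lemma haarNorm_ne_zero (n M j : ℕ) : haarNorm n M j ≠ 0 := by
  unfold haarNorm
  positivity

lemma haarNorm_sq (n M j : ℕ) :
    haarNorm n M j * haarNorm n M j = (2 ^ M) ^ n / (2 ^ (j + 1)) ^ n := by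
  rw [haarNorm, ← mul_pow, ← mul_inv, Real.mul_self_sqrt (by positivity), inv_div, div_pow]

lemma haar_dyadicCube (θ : Fin n → Fin 2) (M j : ℕ) (z : Fin n → ℤ) :
    haar 𝕜 θ (dyadicCube M z (j + 1)) = ((haarNorm n M j : ℝ) : 𝕜) •
      ∑ v ∈ box n (j + 1), ((sg θ j v : ℝ) : 𝕜) • ind 𝕜 (cell M (z + v)) := by
  refine Subtype.ext (funext fun y => ?_)
  rw [Submodule.coe_smul, Pi.smul_apply, sum_ind_cell_apply]
  have h : (if gridMap n M y - z ∈ box n (j + 1) then ((sg θ j (gridMap n M y - z) : ℝ) : 𝕜)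
      else 0) = ((sg θ j (gridMap n M y - z) : ℝ) : 𝕜) := by
    split_ifs with h
    · rfl
    · rw [sg_eq_zero θ h, RCLike.ofReal_zero]
  rw [h]
  change haarFun 𝕜 θ (dyadicCube M z (j + 1)) y = _
  rw [haarFun, dyadicCube_side, smul_eq_mul, ← RCLike.ofReal_mul, haarNorm, sg,
    ← Fin.prod_const n (Real.sqrt (2 ^ (j + 1) / 2 ^ M))⁻¹, ← Finset.prod_mul_distrib,
    RCLike.ofReal_prod]
  exact Finset.prod_congr rfl fun i _ => haarOne_dyadic (θ i) M j (z i) (y i)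

/-- The matrix of the operator with respect to the cells of side `2^{-M}`. -/
noncomputable def cellKernel (T : StepOperator 𝕜 n) (M : ℕ) (a b : Fin n → ℤ) : 𝕜 :=
  (2 ^ M) ^ n * T (ind 𝕜 (cell M b)) (ind 𝕜 (cell M a))

variable (T : StepOperator 𝕜 n)

lemma boxSum_cellKernel (M k : ℕ) (w z : Fin n → ℤ) : boxSum (cellKernel T M) k w z
    = (2 ^ M) ^ n * T (ind 𝕜 (dyadicCube M z k)) (ind 𝕜 (dyadicCube M w k)) := by
  rw [ind_dyadicCube, ind_dyadicCube, map_sum, Finset.mul_sum, boxSum]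
  refine Finset.sum_congr rfl fun u _ => ?_
  rw [map_sum, LinearMap.sum_apply, Finset.mul_sum]
  rfl

lemma haar_pairing (η θ : Fin n → Fin 2) (M j : ℕ) (w z : Fin n → ℤ) :
    T (haar 𝕜 θ (dyadicCube M z (j + 1))) (haar 𝕜 η (dyadicCube M w (j + 1)))
      = (((2 ^ (j + 1)) ^ n)⁻¹ : 𝕜) * haarSum (cellKernel T M) η θ j w z := by
  have hc : (((2 ^ (j + 1)) ^ n)⁻¹ : 𝕜) * (2 ^ M) ^ n
      = ((haarNorm n M j : ℝ) : 𝕜) * ((haarNorm n M j : ℝ) : 𝕜) := by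
    rw [← RCLike.ofReal_mul, haarNorm_sq]
    push_cast
    rw [mul_comm, div_eq_mul_inv]
  rw [haar_dyadicCube, haar_dyadicCube, map_smul, map_smul, LinearMap.smul_apply, smul_eq_mul,
    smul_eq_mul, ← mul_assoc, ← hc, mul_assoc, map_sum, haarSum, Finset.mul_sum]
  congr 1
  refine Finset.sum_congr rfl fun u _ => ?_
  rw [map_smul, map_sum, LinearMap.sum_apply, smul_eq_mul, Finset.mul_sum, Finset.mul_sum]
  refine Finset.sum_congr rfl fun v _ => ?_
  rw [map_smul, LinearMap.smul_apply, smul_eq_mul, cellKernel]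
  push_cast
  ring

lemma haarSum_left (θ : Fin n → Fin 2) (M j : ℕ) (w z : Fin n → ℤ) :
    haarSum (cellKernel T M) 0 θ j w z = ((2 ^ M) ^ n / ((haarNorm n M j : ℝ) : 𝕜)) *
      T (haar 𝕜 θ (dyadicCube M z (j + 1))) (ind 𝕜 (dyadicCube M w (j + 1))) := by
  have hc : ((haarNorm n M j : ℝ) : 𝕜) ≠ 0 := by
    exact_mod_cast haarNorm_ne_zero n M j
  rw [haar_dyadicCube, ind_dyadicCube, map_smul, LinearMap.smul_apply, smul_eq_mul, ← mul_assoc,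
    div_mul_cancel₀ _ hc, map_sum, haarSum, Finset.mul_sum]
  refine Finset.sum_congr rfl fun u hu => ?_
  rw [map_sum, LinearMap.sum_apply, Finset.mul_sum]
  refine Finset.sum_congr rfl fun v _ => ?_
  rw [map_smul, LinearMap.smul_apply, smul_eq_mul, cellKernel, sg_zero_of_mem hu, one_mul]
  ring

lemma haarSum_right (η : Fin n → Fin 2) (M j : ℕ) (w z : Fin n → ℤ) :
    haarSum (cellKernel T M) η 0 j w z = ((2 ^ M) ^ n / ((haarNorm n M j : ℝ) : 𝕜)) *
      T (ind 𝕜 (dyadicCube M z (j + 1))) (haar 𝕜 η (dyadicCube M w (j + 1))) := by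
  have hc : ((haarNorm n M j : ℝ) : 𝕜) ≠ 0 := by
    exact_mod_cast haarNorm_ne_zero n M j
  rw [haar_dyadicCube, ind_dyadicCube, map_smul, smul_eq_mul, ← mul_assoc,
    div_mul_cancel₀ _ hc, map_sum, haarSum, Finset.mul_sum]
  refine Finset.sum_congr rfl fun u _ => ?_
  rw [map_smul, map_sum, LinearMap.sum_apply, smul_eq_mul, Finset.mul_sum, Finset.mul_sum]
  refine Finset.sum_congr rfl fun v hv => ?_
  rw [cellKernel, sg_zero_of_mem hv, mul_one]
  ring

/-- The suprema of the Haar coefficients over all cubes. -/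
noncomputable def haarCoeff (η θ : Fin n → Fin 2) (m : Fin n → ℤ) : ℝ≥0 :=
  (⨆ I : Cube n, ‖T (haar 𝕜 θ I) (haar 𝕜 η (I.shift m))‖ₑ).toNNReal

variable {T}

lemma HaarCoefficientBound.coe_haarCoeff {C : ℝ≥0} (hT : HaarCoefficientBound T C)
    {η θ : Fin n → Fin 2} (h : (η, θ) ≠ (0, 0)) (m : Fin n → ℤ) :
    (haarCoeff T η θ m : ℝ≥0∞) = ⨆ I : Cube n, ‖T (haar 𝕜 θ I) (haar 𝕜 η (I.shift m))‖ₑ := by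
  refine ENNReal.coe_toNNReal fun htop => ?_
  have h1 := (ENNReal.le_tsum m).trans (hT η θ h)
  rw [htop, ENNReal.mul_top] at h1
  · exact ENNReal.coe_ne_top (top_le_iff.1 h1)
  · exact (ENNReal.ofReal_pos.2 (by linarith [Real.posLog_nonneg (x := latticeNorm m)])).ne'

lemma HaarCoefficientBound.tsum_haarCoeff {C : ℝ≥0} (hT : HaarCoefficientBound T C)
    (η θ : Fin n → Fin 2) (h : (η, θ) ≠ (0, 0)) :
    ∑' m, ENNReal.ofReal (1 + Real.posLog (latticeNorm m)) * (haarCoeff T η θ m : ℝ≥0∞) ≤ C := by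
  simp only [hT.coe_haarCoeff h]
  exact hT η θ h

/-- The hypotheses on the operator are invariant under dilations, hence they pass to its matrices at
all scales with the same coefficient bounds. -/
lemma isLatticeKernel_cellKernel {C : ℝ≥0} (hL : VanishesAtLargeScales T) (h1 : AnnihilatesOne T)
    (h2 : AdjointAnnihilatesOne T) (hT : HaarCoefficientBound T C) (M : ℕ) :
    IsLatticeKernel (cellKernel T M) (haarCoeff T) where
  bound η θ hηθ j z m := by
    have h := haar_pairing T η θ M j (fun i => z i + 2 ^ (j + 1) * m i) z
    rw [← dyadicCube_shift] at h
    have hle : ‖T (haar 𝕜 θ (dyadicCube M z (j + 1)))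
        (haar 𝕜 η ((dyadicCube M z (j + 1)).shift m))‖ ≤ haarCoeff T η θ m := by
      have := le_iSup (fun I : Cube n => ‖T (haar 𝕜 θ I) (haar 𝕜 η (I.shift m))‖ₑ)
        (dyadicCube M z (j + 1))
      rw [← hT.coe_haarCoeff hηθ, enorm_eq_nnnorm, ENNReal.coe_le_coe] at this
      exact_mod_cast this
    rw [h, norm_mul, norm_inv, norm_pow, norm_pow, RCLike.norm_ofNat,
      inv_mul_le_iff₀ (by positivity)] at hle
    exact hle
  hasSum_left θ hθ j z := by
    have h := (h2 (dyadicCube M z (j + 1)) θ hθ).mul_left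
      ((2 ^ M) ^ n / ((haarNorm n M j : ℝ) : 𝕜))
    rw [mul_zero] at h
    refine hasSum_of_eq h fun m => ?_
    rw [haarSum_left, dyadicCube_shift]
    rfl
  hasSum_right η hη j w := by
    have h := (h1 (dyadicCube M w (j + 1)) η hη).mul_left
      ((2 ^ M) ^ n / ((haarNorm n M j : ℝ) : 𝕜))
    rw [mul_zero] at h
    refine hasSum_of_eq h fun m => ?_
    rw [haarSum_right, dyadicCube_shift]
  tendsto_centered := by
    have hQ : ∀ k : ℕ, dyadicCube M (fun _ : Fin n => -2 ^ (k + M)) (k + M + 1)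
        = Cube.centered n k := by
      intro k
      refine Prod.ext (funext fun i => ?_) (Subtype.ext ?_)
      · change ((-2 ^ (k + M) : ℤ) : ℝ) / 2 ^ M = -2 ^ k
        push_cast
        rw [pow_add, neg_div, mul_div_cancel_right₀ _ (by positivity)]
      · change ((2 ^ (k + M + 1) : ℕ) : ℝ) / 2 ^ M = 2 * 2 ^ k
        push_cast
        rw [show k + M + 1 = 1 + k + M by ring, pow_add, mul_div_cancel_right₀ _ (by positivity)]
        ring
    rw [← tendsto_add_atTop_iff_nat M]
    have h := hL.const_mul ((((2 : 𝕜) ^ M) ^ n)⁻¹)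
    rw [mul_zero] at h
    refine h.congr fun k => ?_
    rw [boxSum_cellKernel, hQ]
    have hs : (((Cube.centered n k).side ^ n : ℝ) : 𝕜) = (2 * 2 ^ k) ^ n := by
      change (((2 * 2 ^ k) ^ n : ℝ) : 𝕜) = _
      push_cast
      rfl
    rw [hs]
    have h2 : (2 : 𝕜) ≠ 0 := two_ne_zero
    generalize T (ind 𝕜 (Cube.centered n k)) (ind 𝕜 (Cube.centered n k)) = x
    have h3 : ((2 : 𝕜) ^ (k + M + 1)) ^ n = (2 * 2 ^ k) ^ n * (2 ^ M) ^ n := by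
      rw [← mul_pow]
      congr 1
      ring
    rw [h3]
    have h4 : ((2 : 𝕜) ^ M) ^ n ≠ 0 := pow_ne_zero _ (pow_ne_zero _ h2)
    have h5 : ((2 : 𝕜) * 2 ^ k) ^ n ≠ 0 := pow_ne_zero _ (mul_ne_zero h2 (pow_ne_zero _ h2))
    generalize ((2 : 𝕜) ^ M) ^ n = A at *
    generalize ((2 : 𝕜) * 2 ^ k) ^ n = B at *
    field_simp

end Discretisation

/-! ### Approximation of the operator at a fixed scale -/

section Approximation

variable {n : ℕ} {𝕜 : Type*} [RCLike 𝕜]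

lemma cell_eq_dyadicCube (M d : ℕ) (b : Fin n → ℤ) :
    cell M b = dyadicCube (M + d) (fun i => 2 ^ d * b i) d := by
  refine Prod.ext (funext fun i => ?_) (Subtype.ext ?_)
  · change (b i : ℝ) / 2 ^ M = ((2 ^ d * b i : ℤ) : ℝ) / 2 ^ (M + d)
    push_cast
    rw [pow_add, mul_comm ((2 : ℝ) ^ M), mul_div_mul_left _ _ (by positivity)]
  · change ((2 : ℝ) ^ M)⁻¹ = ((2 ^ d : ℕ) : ℝ) / 2 ^ (M + d)
    push_cast
    rw [pow_add]
    field_simp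

lemma ind_cell_eq_sum (M d : ℕ) (b : Fin n → ℤ) : ind 𝕜 (cell M b)
    = ∑ v ∈ box n d, ind 𝕜 (cell (M + d) ((fun i => 2 ^ d * b i) + v)) := by
  rw [cell_eq_dyadicCube M d, ind_dyadicCube]

/-- The indices of the cells of side `2^{-m}` in the cube `[-2^m, 2^m)ⁿ`. -/
noncomputable def cellIndices (n m : ℕ) : Finset (Fin n → ℤ) :=
  Fintype.piFinset fun _ => Finset.Ico (-2 ^ (2 * m)) (2 ^ (2 * m))

lemma mem_cellIndices {m : ℕ} {a : Fin n → ℤ} :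
    a ∈ cellIndices n m ↔ ∀ i, -2 ^ (2 * m) ≤ a i ∧ a i < 2 ^ (2 * m) := by
  simp [cellIndices]

/-- The conditional expectation of a functional on step functions with respect to the cells of
side `2^{-m}` in the cube `[-2^m, 2^m)ⁿ`. -/
noncomputable def approx (τ : StepFun 𝕜 n →ₗ[𝕜] 𝕜) (m : ℕ) : StepFun 𝕜 n :=
  ∑ a ∈ cellIndices n m, ((2 ^ m) ^ n * τ (ind 𝕜 (cell m a))) • ind 𝕜 (cell m a)

lemma approx_apply (τ : StepFun 𝕜 n →ₗ[𝕜] 𝕜) (m : ℕ) (y : Fin n → ℝ) :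
    (approx τ m : (Fin n → ℝ) → 𝕜) y = (cellIndices n m : Set (Fin n → ℤ)).indicator
      (fun a => (2 ^ m) ^ n * τ (ind 𝕜 (cell m a))) (gridMap n m y) := by
  classical
  have h := sum_ind_cell_apply (𝕜 := 𝕜) m 0 (cellIndices n m)
    (fun a => (2 ^ m) ^ n * τ (ind 𝕜 (cell m a))) y
  simp only [zero_add, sub_zero] at h
  rw [approx, h, Set.indicator_apply]
  rfl

variable {X : Type*} [NormedAddCommGroup X] [NormedSpace ℝ X] [NormedSpace 𝕜 X]
  [IsScalarTower ℝ 𝕜 X]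

/-- The `T(1)` theorem at a fixed scale, for step functions on dyadic cells of any larger scale. -/
theorem approx_le (hn : 0 < n) {T : StepOperator 𝕜 n} {C : ℝ≥0} (hL : VanishesAtLargeScales T)
    (h1 : AnnihilatesOne T) (h2 : AdjointAnnihilatesOne T) (hT : HaarCoefficientBound T C)
    {p : ℝ≥0∞} (hp1 : 1 ≤ p) (hp : p ≠ ∞) {β : ℝ≥0∞} (hβ : IsDiscreteBound (Fin n → ℤ) p X β)
    (s : Finset (ℕ × (Fin n → ℤ))) (x : ℕ × (Fin n → ℤ) → X) {m : ℕ} (hm : ∀ c ∈ s, c.1 ≤ m) :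
    eLpNorm (fun y => ∑ c ∈ s,
        (approx (T (ind 𝕜 (cell c.1 c.2))) m : (Fin n → ℝ) → 𝕜) y • x c) p volume
      ≤ 32 * 8 ^ n * C * (β ^ 2 * eLpNorm (fun y => ∑ c ∈ s,
        (ind 𝕜 (cell c.1 c.2) : (Fin n → ℝ) → 𝕜) y • x c) p volume) := by
  classical
  -- the cells of side `2^{-m}` in a given cell
  let P : ℕ × (Fin n → ℤ) → Finset (Fin n → ℤ) := fun c =>
    (box n (m - c.1)).image fun v => (fun i => 2 ^ (m - c.1) * c.2 i) + v
  have hP : ∀ c ∈ s, ind 𝕜 (cell c.1 c.2) = ∑ b ∈ P c, ind 𝕜 (cell m b) := by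
    intro c hc
    have h := ind_cell_eq_sum (𝕜 := 𝕜) c.1 (m - c.1) c.2
    rw [Nat.add_sub_cancel' (hm c hc)] at h
    rw [h, Finset.sum_image fun _ _ _ _ h => add_right_injective _ h]
  set F := s.biUnion P with hF
  let f : (Fin n → ℤ) → X := fun b => ∑ c ∈ s, if b ∈ P c then x c else 0
  have hf : ∀ b ∉ F, f b = 0 := fun b hb => Finset.sum_eq_zero fun c hc =>
    if_neg fun h => hb (Finset.mem_biUnion.2 ⟨c, hc, h⟩)
  have hright : (fun y => ∑ c ∈ s, (ind 𝕜 (cell c.1 c.2) : (Fin n → ℝ) → 𝕜) y • x c)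
      = f ∘ gridMap n m := by
    funext y
    refine Finset.sum_congr rfl fun c hc => ?_
    have h := sum_ind_cell_apply (𝕜 := 𝕜) m 0 (P c) (fun _ => 1) y
    simp only [zero_add, sub_zero, one_smul] at h
    rw [hP c hc, h, ite_smul, one_smul, zero_smul]
  have hleft : (fun y => ∑ c ∈ s,
      (approx (T (ind 𝕜 (cell c.1 c.2))) m : (Fin n → ℝ) → 𝕜) y • x c)
      = ((cellIndices n m : Set (Fin n → ℤ)).indicator
        fun a => ∑ b ∈ F, cellKernel T m a b • f b) ∘ gridMap n m := by
    funext y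
    simp only [approx_apply, Function.comp_apply]
    by_cases ha : gridMap n m y ∈ (cellIndices n m : Set (Fin n → ℤ))
    · simp only [Set.indicator_of_mem ha, f, Finset.smul_sum]
      rw [Finset.sum_comm]
      refine Finset.sum_congr rfl fun c hc => ?_
      simp only [smul_ite, smul_zero]
      rw [← Finset.sum_filter, ← Finset.sum_smul, Finset.filter_mem_eq_inter,
        Finset.inter_eq_right.2 (Finset.subset_biUnion_of_mem P hc), hP c hc, map_sum,
        LinearMap.sum_apply, Finset.mul_sum]
      rfl
    · simp only [Set.indicator_of_notMem ha, zero_smul, Finset.sum_const_zero]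
  rw [hright, hleft, eLpNorm_comp_gridMap, eLpNorm_comp_gridMap]
  have h := (isLatticeKernel_cellKernel hL h1 h2 hT m).eLpNorm_le hn hT.tsum_haarCoeff hp1 hp hβ hf
    (cellIndices n m)
  calc _ ≤ cellVol n m ^ (1 / p).toReal *
        (32 * 8 ^ n * C * (β ^ 2 * eLpNorm f p Measure.count)) := by gcongr
    _ = _ := by ring

end Approximation

/-! ### The image of a cell -/

section Cells

/-- A bounded martingale in a Hilbert space converges. -/
lemma exists_tendsto_of_inner_eq (𝕜 : Type*) {H : Type*} [RCLike 𝕜] [NormedAddCommGroup H]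
    [InnerProductSpace 𝕜 H] [CompleteSpace H] {g : ℕ → H}
    (h : ∀ m k, m ≤ k → inner 𝕜 (g m) (g k) = inner 𝕜 (g m) (g m)) {B : ℝ}
    (hB : ∀ m, ‖g m‖ ≤ B) : ∃ u, Tendsto g atTop (𝓝 u) := by
  have hpyth : ∀ m k, m ≤ k → ‖g k - g m‖ ^ 2 = ‖g k‖ ^ 2 - ‖g m‖ ^ 2 := by
    intro m k hmk
    rw [norm_sub_rev, norm_sub_sq (𝕜 := 𝕜), h m k hmk, inner_self_eq_norm_sq]
    ring
  have hmono : Monotone fun m => ‖g m‖ ^ 2 := by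
    intro m k hmk
    have := hpyth m k hmk
    have h0 := sq_nonneg ‖g k - g m‖
    dsimp only
    linarith
  have hbdd : BddAbove (Set.range fun m => ‖g m‖ ^ 2) := by
    refine ⟨B ^ 2, ?_⟩
    rintro _ ⟨m, rfl⟩
    exact pow_le_pow_left₀ (norm_nonneg _) (hB m) 2
  have hcauchy := (tendsto_atTop_ciSup hmono hbdd).cauchySeq
  refine cauchySeq_tendsto_of_complete (Metric.cauchySeq_iff'.2 fun ε hε => ?_)
  obtain ⟨N, hN⟩ := Metric.cauchySeq_iff'.1 hcauchy (ε ^ 2) (by positivity)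
  refine ⟨N, fun k hk => ?_⟩
  have h1 := hN k hk
  rw [Real.dist_eq, ← hpyth N k hk, abs_of_nonneg (sq_nonneg _)] at h1
  rw [dist_eq_norm]
  exact lt_of_pow_lt_pow_left₀ 2 hε.le h1

variable {n : ℕ} {𝕜 : Type*} [RCLike 𝕜]

/-- The tensor product with a fixed vector, as a linear map. -/
noncomputable def tensorLpLinear {X : Type*} [NormedAddCommGroup X] [NormedSpace 𝕜 X] (p : ℝ≥0∞)
    (x : X) : StepFun 𝕜 n →ₗ[𝕜] Lp X p (volume : Measure (Fin n → ℝ)) where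
  toFun f := tensorLp p f x
  map_add' f g := by
    rw [tensorLp, tensorLp, tensorLp, ← MemLp.toLp_add]
    congr 1
    funext y
    exact add_smul _ _ _
  map_smul' c f := by
    rw [tensorLp, tensorLp, RingHom.id_apply, ← MemLp.toLp_const_smul]
    congr 1
    funext y
    exact mul_smul _ _ _

lemma inner_tensorLp (f g : StepFun 𝕜 n) :
    inner 𝕜 (tensorLp 2 f (1 : 𝕜)) (tensorLp 2 g (1 : 𝕜))
      = ∫ y, (g : (Fin n → ℝ) → 𝕜) y * starRingEnd 𝕜 ((f : (Fin n → ℝ) → 𝕜) y) := by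
  rw [L2.inner_def]
  refine integral_congr_ae ?_
  filter_upwards [(StepFun.memLp_smul 2 f (1 : 𝕜)).coeFn_toLp,
    (StepFun.memLp_smul 2 g (1 : 𝕜)).coeFn_toLp] with y h1 h2
  rw [tensorLp, tensorLp, h1, h2, RCLike.inner_apply]
  simp

open Classical in
lemma inner_cell (m : ℕ) (a b : Fin n → ℤ) :
    inner 𝕜 (tensorLp 2 (ind 𝕜 (cell m a)) (1 : 𝕜)) (tensorLp 2 (ind 𝕜 (cell m b)) (1 : 𝕜))
      = if a = b then (((2 ^ m) ^ n)⁻¹ : 𝕜) else 0 := by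
  rw [inner_tensorLp]
  simp only [ind_cell_apply]
  split_ifs with h
  · subst h
    have h1 : (fun y => (if gridMap n m y = a then (1 : 𝕜) else 0) *
        starRingEnd 𝕜 (if gridMap n m y = a then (1 : 𝕜) else 0))
        = (cell m a).toSet.indicator fun _ => (1 : 𝕜) := by
      funext y
      by_cases hy : gridMap n m y = a
      · rw [if_pos hy, Set.indicator_of_mem (mem_cell.2 hy), map_one, mul_one]
      · rw [if_neg hy, Set.indicator_of_notMem fun h => hy (mem_cell.1 h), zero_mul]
    rw [h1, integral_indicator_const _ (cell m a).measurableSet_toSet, Measure.real, volume_cell,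
      cellVol_toReal, RCLike.real_smul_eq_coe_mul, mul_one]
    push_cast
    rfl
  · refine integral_eq_zero_of_ae (Eventually.of_forall fun y => ?_)
    by_cases hy : gridMap n m y = b
    · have : gridMap n m y ≠ a := fun h' => h (h'.symm.trans hy)
      simp [this]
    · simp [hy]

lemma inner_cell_approx (τ : StepFun 𝕜 n →ₗ[𝕜] 𝕜) {m : ℕ} {b : Fin n → ℤ}
    (hb : b ∈ cellIndices n m) :
    inner 𝕜 (tensorLp 2 (ind 𝕜 (cell m b)) (1 : 𝕜)) (tensorLp 2 (approx τ m) (1 : 𝕜))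
      = τ (ind 𝕜 (cell m b)) := by
  classical
  have h : tensorLp 2 (approx τ m) (1 : 𝕜) = ∑ a ∈ cellIndices n m,
      ((2 ^ m) ^ n * τ (ind 𝕜 (cell m a))) • tensorLp 2 (ind 𝕜 (cell m a)) (1 : 𝕜) := by
    change tensorLpLinear 2 (1 : 𝕜) (approx τ m) = _
    rw [approx, map_sum]
    exact Finset.sum_congr rfl fun a _ => map_smul _ _ _
  rw [h, inner_sum]
  simp only [inner_smul_right, inner_cell, mul_ite, mul_zero]
  rw [Finset.sum_ite_eq, if_pos hb]
  have h2 : ((2 : 𝕜) ^ m) ^ n ≠ 0 := pow_ne_zero _ (pow_ne_zero _ two_ne_zero)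
  field_simp

/-- The compatibility of the approximations of different scales: they form a martingale. -/
lemma inner_cell_approx_add (τ : StepFun 𝕜 n →ₗ[𝕜] 𝕜) (M d : ℕ) {b : Fin n → ℤ}
    (hb : ∀ i, -2 ^ (2 * M + d) ≤ b i ∧ b i < 2 ^ (2 * M + d)) :
    inner 𝕜 (tensorLp 2 (ind 𝕜 (cell M b)) (1 : 𝕜)) (tensorLp 2 (approx τ (M + d)) (1 : 𝕜))
      = τ (ind 𝕜 (cell M b)) := by
  have h : tensorLp 2 (ind 𝕜 (cell M b)) (1 : 𝕜) = ∑ v ∈ box n d,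
      tensorLp 2 (ind 𝕜 (cell (M + d) ((fun i => 2 ^ d * b i) + v))) (1 : 𝕜) := by
    change tensorLpLinear 2 (1 : 𝕜) (ind 𝕜 (cell M b)) = _
    rw [ind_cell_eq_sum M d, map_sum]
    rfl
  rw [h, sum_inner, ind_cell_eq_sum M d, map_sum]
  refine Finset.sum_congr rfl fun v hv => inner_cell_approx τ (mem_cellIndices.2 fun i => ?_)
  obtain ⟨h1, h2⟩ := hb i
  obtain ⟨h3, h4⟩ := mem_box.1 hv i
  have h5 : (0 : ℤ) < 2 ^ d := by positivity
  have h6 : (2 : ℤ) ^ (2 * (M + d)) = 2 ^ d * 2 ^ (2 * M + d) := by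
    rw [← pow_add]
    congr 1
    ring
  simp only [Pi.add_apply]
  rw [h6]
  constructor <;> nlinarith

lemma inner_approx_approx (τ : StepFun 𝕜 n →ₗ[𝕜] 𝕜) (m k : ℕ) (hmk : m ≤ k) :
    inner 𝕜 (tensorLp 2 (approx τ m) (1 : 𝕜)) (tensorLp 2 (approx τ k) (1 : 𝕜))
      = inner 𝕜 (tensorLp 2 (approx τ m) (1 : 𝕜)) (tensorLp 2 (approx τ m) (1 : 𝕜)) := by
  have h : ∀ k, m ≤ k →
      inner 𝕜 (tensorLp 2 (approx τ m) (1 : 𝕜)) (tensorLp 2 (approx τ k) (1 : 𝕜))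
      = ∑ a ∈ cellIndices n m, starRingEnd 𝕜 ((2 ^ m) ^ n * τ (ind 𝕜 (cell m a))) *
        τ (ind 𝕜 (cell m a)) := by
    intro k hk
    obtain ⟨d, rfl⟩ := Nat.exists_eq_add_of_le hk
    have h : tensorLp 2 (approx τ m) (1 : 𝕜) = ∑ a ∈ cellIndices n m,
        ((2 ^ m) ^ n * τ (ind 𝕜 (cell m a))) • tensorLp 2 (ind 𝕜 (cell m a)) (1 : 𝕜) := by
      change tensorLpLinear 2 (1 : 𝕜) (approx τ m) = _
      rw [approx, map_sum]
      exact Finset.sum_congr rfl fun a _ => map_smul _ _ _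
    rw [h, sum_inner]
    refine Finset.sum_congr rfl fun a ha => ?_
    rw [inner_smul_left, inner_cell_approx_add τ m d fun i => ?_]
    obtain ⟨h1, h2⟩ := mem_cellIndices.1 ha i
    have h3 : (2 : ℤ) ^ (2 * m) ≤ 2 ^ (2 * m + d) :=
      pow_le_pow_right₀ one_le_two (Nat.le_add_right _ _)
    constructor <;> linarith
  rw [h k hmk, h m le_rfl]

/-- The operator maps the indicator function of a cell to a function in `L²`. -/
lemma exists_tendsto_approx (hn : 0 < n) {T : StepOperator 𝕜 n} {C : ℝ≥0}
    (hL : VanishesAtLargeScales T)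
    (h1 : AnnihilatesOne T) (h2 : AdjointAnnihilatesOne T) (hT : HaarCoefficientBound T C)
    (c : ℕ × (Fin n → ℤ)) : ∃ u : Lp 𝕜 2 (volume : Measure (Fin n → ℝ)),
      Tendsto (fun m => tensorLp 2 (approx (T (ind 𝕜 (cell c.1 c.2))) m) (1 : 𝕜)) atTop (𝓝 u) := by
  set τ := T (ind 𝕜 (cell c.1 c.2)) with hτ
  have hbound : ∀ m, ‖tensorLp 2 (approx τ (m + c.1)) (1 : 𝕜)‖
      ≤ (32 * 8 ^ n * C * (1 ^ 2 *
        eLpNorm (fun y => (ind 𝕜 (cell c.1 c.2) : (Fin n → ℝ) → 𝕜) y • (1 : 𝕜)) 2 volume)).toReal := by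
    intro m
    have h := approx_le hn hL h1 h2 hT one_le_two (by norm_num : (2 : ℝ≥0∞) ≠ ∞)
      (isDiscreteBound_two (Fin n → ℤ) 𝕜) {c} (fun _ => 1) (m := m + c.1) (by simp)
    simp only [Finset.sum_singleton] at h
    rw [tensorLp, Lp.norm_toLp]
    refine ENNReal.toReal_mono ?_ h
    exact ENNReal.mul_ne_top (by finiteness) (ENNReal.mul_ne_top (by simp)
      (StepFun.memLp_smul 2 _ _).eLpNorm_ne_top)
  obtain ⟨u, hu⟩ := exists_tendsto_of_inner_eq 𝕜
    (g := fun m => tensorLp 2 (approx τ (m + c.1)) (1 : 𝕜))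
    (fun m k hmk => inner_approx_approx τ _ _ (Nat.add_le_add_right hmk _)) hbound
  exact ⟨u, (tendsto_add_atTop_iff_nat c.1).1 hu⟩

lemma inner_cell_limit {τ : StepFun 𝕜 n →ₗ[𝕜] 𝕜} {u : Lp 𝕜 2 (volume : Measure (Fin n → ℝ))}
    (hu : Tendsto (fun m => tensorLp 2 (approx τ m) (1 : 𝕜)) atTop (𝓝 u)) (M : ℕ)
    (b : Fin n → ℤ) : inner 𝕜 (tensorLp 2 (ind 𝕜 (cell M b)) (1 : 𝕜)) u = τ (ind 𝕜 (cell M b)) := by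
  have h1 : Tendsto (fun m => inner 𝕜 (tensorLp 2 (ind 𝕜 (cell M b)) (1 : 𝕜))
      (tensorLp 2 (approx τ m) (1 : 𝕜))) atTop
      (𝓝 (inner 𝕜 (tensorLp 2 (ind 𝕜 (cell M b)) (1 : 𝕜)) u)) := tendsto_const_nhds.inner hu
  refine tendsto_nhds_unique h1 (Tendsto.congr' ?_ tendsto_const_nhds)
  have hev : ∀ i, ∀ᶠ d : ℕ in atTop, |b i| < 2 ^ d := fun i =>
    (tendsto_pow_atTop_atTop_of_one_lt (one_lt_two : (1 : ℤ) < 2)).eventually_gt_atTop |b i|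
  obtain ⟨d, hd⟩ := (eventually_all.2 hev).exists_forall_of_atTop
  filter_upwards [eventually_ge_atTop (M + d)] with m hm
  obtain ⟨e, rfl⟩ := Nat.exists_eq_add_of_le hm
  rw [add_assoc]
  refine (inner_cell_approx_add τ M (d + e) fun i => ?_).symm
  have h2 := abs_lt.1 (hd (2 * M + (d + e)) (by omega) i)
  exact ⟨h2.1.le, h2.2⟩

end Cells

/-! ### Extension to the Bochner space -/

section Extension

variable {n : ℕ} {𝕜 : Type*} [RCLike 𝕜]

lemma coeFn_tensorLp {X : Type*} [NormedAddCommGroup X] [NormedSpace 𝕜 X] (p : ℝ≥0∞)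
    (f : StepFun 𝕜 n) (x : X) :
    tensorLp p f x =ᵐ[volume] fun y => (f : (Fin n → ℝ) → 𝕜) y • x :=
  (StepFun.memLp_smul p f x).coeFn_toLp

lemma coeFn_sum_of_ae {ι X : Type*} [NormedAddCommGroup X] {p : ℝ≥0∞} (s : Finset ι)
    {g : ι → Lp X p (volume : Measure (Fin n → ℝ))} {g' : ι → (Fin n → ℝ) → X}
    (h : ∀ i, g i =ᵐ[volume] g' i) : ⇑(∑ i ∈ s, g i) =ᵐ[volume] fun y => ∑ i ∈ s, g' i y := by
  refine (Lp.coeFn_finsetSum s g).trans ?_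
  have : ∀ᵐ y : Fin n → ℝ, ∀ i ∈ s, g i y = g' i y :=
    (Finset.eventually_all s).2 fun i _ => h i
  filter_upwards [this] with y hy
  rw [Finset.sum_apply]
  exact Finset.sum_congr rfl hy

variable {X : Type*} [NormedAddCommGroup X] [NormedSpace ℝ X] [NormedSpace 𝕜 X]
  [IsScalarTower ℝ 𝕜 X]

/-- The bound for the limit of the approximations follows from Fatou's lemma. -/
lemma limit_le (hn : 0 < n) {T : StepOperator 𝕜 n} {C : ℝ≥0} (hL : VanishesAtLargeScales T)
    (h1 : AnnihilatesOne T) (h2 : AdjointAnnihilatesOne T) (hT : HaarCoefficientBound T C)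
    {p : ℝ≥0∞} (hp1 : 1 ≤ p) (hp : p ≠ ∞) {β : ℝ≥0∞} (hβ : IsDiscreteBound (Fin n → ℤ) p X β)
    {u : ℕ × (Fin n → ℤ) → Lp 𝕜 2 (volume : Measure (Fin n → ℝ))}
    (hu : ∀ c : ℕ × (Fin n → ℤ), Tendsto (fun m =>
      tensorLp 2 (approx (T (ind 𝕜 (cell c.1 c.2))) m) (1 : 𝕜)) atTop (𝓝 (u c)))
    (s : Finset (ℕ × (Fin n → ℤ))) (x : ℕ × (Fin n → ℤ) → X) :
    eLpNorm (fun y => ∑ c ∈ s, u c y • x c) p volume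
      ≤ 32 * 8 ^ n * C * (β ^ 2 * eLpNorm (fun y => ∑ c ∈ s,
        (ind 𝕜 (cell c.1 c.2) : (Fin n → ℝ) → 𝕜) y • x c) p volume) := by
  let J : ℕ × (Fin n → ℤ) → Lp 𝕜 2 (volume : Measure (Fin n → ℝ)) →L[𝕜]
      Lp X 2 (volume : Measure (Fin n → ℝ)) := fun c =>
    (ContinuousLinearMap.toSpanSingleton 𝕜 (x c)).compLpL 2 volume
  have hJ : ∀ c f, J c f =ᵐ[volume] fun y => f y • x c := fun c f =>
    (ContinuousLinearMap.toSpanSingleton 𝕜 (x c)).coeFn_compLpL f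
  have htend : Tendsto (fun m => ∑ c ∈ s, J c
      (tensorLp 2 (approx (T (ind 𝕜 (cell c.1 c.2))) m) (1 : 𝕜))) atTop
      (𝓝 (∑ c ∈ s, J c (u c))) :=
    tendsto_finsetSum _ fun c _ => ((J c).continuous.tendsto _).comp (hu c)
  obtain ⟨ns, hns, hae⟩ := (tendstoInMeasure_of_tendsto_Lp htend).exists_seq_tendsto_ae
  have hlim : ⇑(∑ c ∈ s, J c (u c)) =ᵐ[volume] fun y => ∑ c ∈ s, u c y • x c :=
    coeFn_sum_of_ae s fun c => hJ c (u c)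
  have happ : ∀ m, ⇑(∑ c ∈ s, J c (tensorLp 2 (approx (T (ind 𝕜 (cell c.1 c.2))) m) (1 : 𝕜)))
      =ᵐ[volume] fun y => ∑ c ∈ s,
        (approx (T (ind 𝕜 (cell c.1 c.2))) m : (Fin n → ℝ) → 𝕜) y • x c := by
    intro m
    refine coeFn_sum_of_ae s fun c => (hJ c _).trans ?_
    filter_upwards [coeFn_tensorLp 2 (approx (T (ind 𝕜 (cell c.1 c.2))) m) (1 : 𝕜)] with y hy
    rw [hy, smul_eq_mul, mul_one]
  rw [← eLpNorm_congr_ae hlim]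
  refine (Lp.eLpNorm_lim_le_liminf_eLpNorm (fun i => Lp.aestronglyMeasurable _) _ hae).trans ?_
  obtain ⟨M, hM⟩ : ∃ M, ∀ c ∈ s, c.1 ≤ M := ⟨s.sup Prod.fst, fun c hc => Finset.le_sup hc⟩
  refine liminf_le_of_le (by isBoundedDefault) fun b hb => ?_
  obtain ⟨i, hi, hi'⟩ := (hb.and (eventually_ge_atTop M)).exists
  refine hi.trans ?_
  rw [eLpNorm_congr_ae (happ _)]
  exact approx_le hn hL h1 h2 hT hp1 hp hβ s x fun c hc =>
    (hM c hc).trans (hi'.trans (hns.id_le i))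

variable (𝕜) in
/-- The step function with prescribed values on dyadic cells, as a linear map. -/
noncomputable def stepLp (n : ℕ) (X : Type*) [NormedAddCommGroup X] [NormedSpace 𝕜 X] (p : ℝ≥0∞) :
    ((ℕ × (Fin n → ℤ)) →₀ X) →ₗ[𝕜] Lp X p (volume : Measure (Fin n → ℝ)) :=
  Finsupp.lsum 𝕜 fun c =>
    { toFun := fun x => tensorLp p (ind 𝕜 (cell c.1 c.2)) x
      map_add' := fun x x' => by
        rw [tensorLp, tensorLp, tensorLp, ← MemLp.toLp_add]
        congr 1
        funext y
        exact smul_add _ _ _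
      map_smul' := fun k x => by
        rw [tensorLp, tensorLp, RingHom.id_apply, ← MemLp.toLp_const_smul]
        congr 1
        funext y
        exact smul_comm _ _ _ }

lemma stepLp_apply {X : Type*} [NormedAddCommGroup X] [NormedSpace 𝕜 X] (p : ℝ≥0∞)
    (v : (ℕ × (Fin n → ℤ)) →₀ X) :
    stepLp 𝕜 n X p v = ∑ c ∈ v.support, tensorLp p (ind 𝕜 (cell c.1 c.2)) (v c) := rfl

lemma stepLp_single {X : Type*} [NormedAddCommGroup X] [NormedSpace 𝕜 X] (p : ℝ≥0∞)
    (c : ℕ × (Fin n → ℤ)) (x : X) :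
    stepLp 𝕜 n X p (Finsupp.single c x) = tensorLp p (ind 𝕜 (cell c.1 c.2)) x := by
  rw [stepLp, Finsupp.lsum_single]
  rfl

end Extension

section Density

variable {n : ℕ} {𝕜 : Type*} [RCLike 𝕜] {X : Type*} [NormedAddCommGroup X] [NormedSpace 𝕜 X]

/-- The value of a function at the corner of the cell of side `2^{-M}` that contains the given
point. -/
noncomputable def cornerValue (g : (Fin n → ℝ) → X) (M : ℕ) (y : Fin n → ℝ) : X :=
  g fun i => gridMap n M y i / 2 ^ M

lemma dist_corner_le (M : ℕ) (y : Fin n → ℝ) :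
    dist y (fun i => (gridMap n M y i : ℝ) / 2 ^ M) ≤ (2 ^ M)⁻¹ := by
  refine (dist_pi_le_iff (by positivity)).2 fun i => ?_
  have h2 : (0 : ℝ) < 2 ^ M := by positivity
  have h3 := Int.floor_le (2 ^ M * y i)
  have h4 := Int.lt_floor_add_one (2 ^ M * y i)
  have h5 : y i - (gridMap n M y i : ℝ) / 2 ^ M = (2 ^ M * y i - ⌊2 ^ M * y i⌋) * (2 ^ M)⁻¹ := by
    rw [gridMap]
    field_simp
  rw [Real.dist_eq, h5, abs_of_nonneg (mul_nonneg (by linarith) (by positivity))]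
  exact mul_le_of_le_one_left (by positivity) (by linarith)

lemma exists_stepLp_eq {p : ℝ≥0∞} {g : (Fin n → ℝ) → X} (hg : HasCompactSupport g) (M : ℕ) :
    ∃ v, stepLp 𝕜 n X p v =ᵐ[volume] cornerValue g M := by
  obtain ⟨R, hR⟩ := hg.isCompact.isBounded.subset_closedBall 0
  let Λ : Finset (Fin n → ℤ) := Fintype.piFinset fun _ => Finset.Icc (-⌈2 ^ M * R⌉) ⌈2 ^ M * R⌉
  refine ⟨∑ a ∈ Λ, Finsupp.single (M, a) (g fun i => a i / 2 ^ M), ?_⟩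
  rw [map_sum]
  simp only [stepLp_single]
  refine (coeFn_sum_of_ae Λ fun a => coeFn_tensorLp p _ _).trans (Eventually.of_forall fun y => ?_)
  simp only [ind_cell_apply, ite_smul, one_smul, zero_smul]
  rw [Finset.sum_ite_eq]
  split_ifs with h
  · rfl
  · symm
    refine image_eq_zero_of_notMem_tsupport (f := g) fun hmem => h ?_
    have h2 : (0 : ℝ) < 2 ^ M := by positivity
    rw [Fintype.mem_piFinset]
    intro i
    have h3 := hR hmem
    rw [mem_closedBall_zero_iff] at h3
    have h4 := (norm_le_pi_norm _ i).trans h3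
    rw [Real.norm_eq_abs, abs_le, le_div_iff₀ h2, div_le_iff₀ h2] at h4
    have h5 := Int.le_ceil (2 ^ M * R)
    rw [Finset.mem_Icc, ← Int.cast_le (R := ℝ), ← Int.cast_le (R := ℝ)]
    push_cast
    constructor <;> linarith [h4.1, h4.2]

lemma tendsto_cornerValue {p : ℝ≥0∞} {g : (Fin n → ℝ) → X}
    (hg : HasCompactSupport g) (hc : Continuous g) :
    Tendsto (fun M => eLpNorm (cornerValue g M - g) p volume) atTop (𝓝 0) := by
  obtain ⟨R, hR⟩ := hg.isCompact.isBounded.subset_closedBall 0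
  have huc : UniformContinuous g :=
    hc.uniformContinuous_of_tendsto_cocompact hg.is_zero_at_infty
  set B := Metric.closedBall (0 : Fin n → ℝ) (R + 1) with hB
  have hzero : ∀ M, ∀ y ∉ B, cornerValue g M y - g y = 0 := by
    intro M y hy
    rw [hB, Metric.mem_closedBall, dist_zero_right, not_le] at hy
    have h1 : (2 ^ M : ℝ)⁻¹ ≤ 1 := inv_le_one_of_one_le₀ (one_le_pow₀ one_le_two)
    rw [cornerValue, image_eq_zero_of_notMem_tsupport (f := g) fun h => ?_,
      image_eq_zero_of_notMem_tsupport (f := g) (x := y) fun h => ?_, sub_zero]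
    · have := hR h
      rw [mem_closedBall_zero_iff] at this
      linarith
    · have h2 := hR h
      rw [mem_closedBall_zero_iff] at h2
      have h3 := dist_corner_le M y
      have h4 := norm_le_norm_add_norm_sub' y (fun i => (gridMap n M y i : ℝ) / 2 ^ M)
      rw [← dist_eq_norm] at h4
      linarith
  have hBtop : volume B ≠ ∞ := measure_closedBall_lt_top.ne
  rw [ENNReal.tendsto_nhds_zero]
  intro ε hε
  set V : ℝ≥0∞ := volume B ^ p.toReal⁻¹ with hV
  have hVtop : V ≠ ∞ := ENNReal.rpow_ne_top_of_nonneg (by positivity) hBtop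
  obtain ⟨δ, hδε, hδ⟩ : ∃ δ : ℝ, V * ENNReal.ofReal δ ≤ ε ∧ 0 < δ := by
    have h1 : Tendsto (fun δ : ℝ => V * ENNReal.ofReal δ) (𝓝[>] 0) (𝓝 0) := by
      have h2 := (ENNReal.continuous_ofReal.tendsto 0).mono_left
        (nhdsWithin_le_nhds (s := Set.Ioi 0))
      have h3 := ENNReal.Tendsto.const_mul (a := V) h2 (Or.inr hVtop)
      simpa using h3
    exact ((ENNReal.tendsto_nhds_zero.1 h1 ε hε).and self_mem_nhdsWithin).exists
  obtain ⟨r, hr, hgr⟩ := Metric.uniformContinuous_iff.1 huc δ hδ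
  have hM : ∀ᶠ M : ℕ in atTop, ((2 : ℝ) ^ M)⁻¹ < r :=
    (tendsto_inv_atTop_zero.comp (tendsto_pow_atTop_atTop_of_one_lt one_lt_two)).eventually_lt_const
      hr
  filter_upwards [hM] with M hM
  have hsupp : Function.support (cornerValue g M - g) ⊆ B := fun y hy => by
    by_contra h
    exact hy (hzero M y h)
  rw [← eLpNorm_restrict_eq_of_support_subset hsupp]
  refine (eLpNorm_le_of_ae_bound (C := δ) (Eventually.of_forall fun y => ?_)).trans ?_
  · rw [Pi.sub_apply, ← dist_eq_norm, dist_comm]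
    exact (hgr ((dist_corner_le M y).trans_lt hM)).le
  · rw [Measure.restrict_apply_univ]
    exact hδε

lemma denseRange_stepLp [NormedSpace ℝ X] {p : ℝ≥0∞} [Fact (1 ≤ p)] (hp : p ≠ ∞) :
    DenseRange (stepLp 𝕜 n X p) := by
  have hcont : ∀ (g : (Fin n → ℝ) → X) (hg : MemLp g p volume), HasCompactSupport g →
      Continuous g → hg.toLp g ∈ closure (Set.range (stepLp 𝕜 n X p)) := by
    intro g hg hs hc
    choose v hv using exists_stepLp_eq (𝕜 := 𝕜) (p := p) hs
    refine mem_closure_of_tendsto (f := fun M => stepLp 𝕜 n X p (v M)) (b := atTop) ?_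
      (Eventually.of_forall fun M => Set.mem_range_self _)
    rw [Lp.tendsto_Lp_iff_tendsto_eLpNorm']
    refine (tendsto_cornerValue hs hc).congr fun M => eLpNorm_congr_ae ?_
    exact ((hv M).sub hg.coeFn_toLp).symm
  intro h
  rw [← closure_closure]
  refine EMetric.mem_closure_iff.2 fun ε hε => ?_
  obtain ⟨δ, hδ0, hδ⟩ := exists_between hε
  obtain ⟨g, hgs, hgδ, hgc, hg⟩ :=
    (Lp.memLp h).exists_hasCompactSupport_eLpNorm_sub_le hp hδ0.ne'
  refine ⟨hg.toLp g, hcont g hg hgs hgc, ?_⟩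
  rw [Lp.edist_def]
  refine lt_of_le_of_lt (le_of_eq (eLpNorm_congr_ae ?_)) (hgδ.trans_lt hδ)
  exact (EventuallyEq.refl _ _).sub hg.coeFn_toLp

end Density

section Extension

variable {n : ℕ} {𝕜 : Type*} [RCLike 𝕜] {X : Type*} [NormedAddCommGroup X] [NormedSpace ℝ X]
  [NormedSpace 𝕜 X] [IsScalarTower ℝ 𝕜 X]

/-- The bounded operator that maps a step function on dyadic cells to the limit of its
approximations. -/
lemma exists_extension_cells [CompleteSpace X] (hn : 0 < n) {T : StepOperator 𝕜 n} {C : ℝ≥0}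
    (hL : VanishesAtLargeScales T)
    (h1 : AnnihilatesOne T) (h2 : AdjointAnnihilatesOne T) (hT : HaarCoefficientBound T C)
    {p : ℝ≥0∞} [Fact (1 ≤ p)] (hp : p ≠ ∞) {β : ℝ≥0} (hβ : IsDiscreteBound (Fin n → ℤ) p X β)
    {u : ℕ × (Fin n → ℤ) → Lp 𝕜 2 (volume : Measure (Fin n → ℝ))}
    (hu : ∀ c : ℕ × (Fin n → ℤ), Tendsto (fun m =>
      tensorLp 2 (approx (T (ind 𝕜 (cell c.1 c.2))) m) (1 : 𝕜)) atTop (𝓝 (u c))) :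
    ∃ S : Lp X p (volume : Measure (Fin n → ℝ)) →L[𝕜] Lp X p (volume : Measure (Fin n → ℝ)),
      (∀ c x, S (tensorLp p (ind 𝕜 (cell c.1 c.2)) x) =ᵐ[volume] fun y => u c y • x) ∧
        ‖S‖ ≤ 32 * 8 ^ n * C * β ^ 2 := by
  have hp1 : 1 ≤ p := Fact.out
  have hlim := limit_le (X := X) hn hL h1 h2 hT hp1 hp hβ hu
  have hmem : ∀ (c : ℕ × (Fin n → ℤ)) (x : X), MemLp (fun y => u c y • x) p volume := by
    intro c x
    refine ⟨(Lp.aestronglyMeasurable (u c)).smul_const x, ?_⟩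
    have h := hlim {c} fun _ => x
    simp only [Finset.sum_singleton] at h
    exact h.trans_lt (ENNReal.mul_lt_top (by finiteness) (ENNReal.mul_lt_top (by finiteness)
      (StepFun.memLp_smul p _ x).eLpNorm_lt_top))
  let Φ : ((ℕ × (Fin n → ℤ)) →₀ X) →ₗ[𝕜] Lp X p (volume : Measure (Fin n → ℝ)) :=
    Finsupp.lsum 𝕜 fun c =>
    { toFun := fun x => (hmem c x).toLp
      map_add' := fun x x' => by
        rw [← MemLp.toLp_add]
        congr 1
        funext y
        exact smul_add _ _ _
      map_smul' := fun k x => by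
        rw [RingHom.id_apply, ← MemLp.toLp_const_smul]
        congr 1
        funext y
        exact smul_comm _ _ _ }
  have hΦ : ∀ v, Φ v = ∑ c ∈ v.support, (hmem c (v c)).toLp := fun v => rfl
  have hΦs : ∀ c x, Φ (Finsupp.single c x) = (hmem c x).toLp := fun c x => by
    simp only [Φ]
    rw [Finsupp.lsum_single]
    rfl
  have hnorm : ∀ v, ‖Φ v‖ ≤ (32 * 8 ^ n * C * β ^ 2 : ℝ) * ‖stepLp 𝕜 n X p v‖ := by
    intro v
    have hE : stepLp 𝕜 n X p v =ᵐ[volume] fun y => ∑ c ∈ v.support,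
        (ind 𝕜 (cell c.1 c.2) : (Fin n → ℝ) → 𝕜) y • v c := by
      rw [stepLp_apply]
      exact coeFn_sum_of_ae _ fun c => coeFn_tensorLp p _ _
    have hF : Φ v =ᵐ[volume] fun y => ∑ c ∈ v.support, u c y • v c := by
      rw [hΦ]
      exact coeFn_sum_of_ae _ fun c => (hmem c (v c)).coeFn_toLp
    have h := hlim v.support v
    rw [← eLpNorm_congr_ae hE, ← eLpNorm_congr_ae hF] at h
    rw [Lp.norm_def, Lp.norm_def]
    refine (ENNReal.toReal_mono ?_ h).trans (le_of_eq ?_)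
    · exact ENNReal.mul_ne_top (by finiteness)
        (ENNReal.mul_ne_top (by finiteness) (Lp.eLpNorm_ne_top _))
    · simp only [ENNReal.toReal_mul, ENNReal.toReal_pow, ENNReal.coe_toReal]
      norm_num
      ring
  have hdense := denseRange_stepLp (𝕜 := 𝕜) (n := n) (X := X) hp
  refine ⟨Φ.extendOfNorm (stepLp 𝕜 n X p), fun c x => ?_,
    LinearMap.opNorm_extendOfNorm_le hdense (by positivity) hnorm⟩
  rw [← stepLp_single, LinearMap.extendOfNorm_eq hdense ⟨_, hnorm⟩, hΦs]
  exact (hmem c x).coeFn_toLp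

end Extension

/-! ### The pairing with step functions -/

section Pairing

variable {n : ℕ} {𝕜 : Type*} [RCLike 𝕜] {X : Type*} [NormedAddCommGroup X] [NormedSpace ℝ X]
  [NormedSpace 𝕜 X] [IsScalarTower ℝ 𝕜 X] {p : ℝ≥0∞}

lemma ind_smul_eq_indicator {Y : Type*} [AddCommGroup Y] [Module 𝕜 Y] (I : Cube n)
    (h : (Fin n → ℝ) → Y) :
    (fun y => (ind 𝕜 I : (Fin n → ℝ) → 𝕜) y • h y) = I.toSet.indicator h := by
  funext y
  change cubeIndicator 𝕜 I y • h y = _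
  by_cases hy : y ∈ I.toSet
  · rw [cubeIndicator, Set.indicator_of_mem hy, Set.indicator_of_mem hy, Pi.one_apply, one_smul]
  · rw [cubeIndicator, Set.indicator_of_notMem hy, Set.indicator_of_notMem hy, zero_smul]

lemma integrableOn_cube {X : Type*} [NormedAddCommGroup X] (hp : 1 ≤ p)
    (h : Lp X p (volume : Measure (Fin n → ℝ))) (I : Cube n) : IntegrableOn h I.toSet := by
  have : IsFiniteMeasure ((volume : Measure (Fin n → ℝ)).restrict I.toSet) :=
    isFiniteMeasure_restrict.2 I.volume_toSet_ne_top
  exact ((Lp.memLp h).restrict _).integrable hp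

/-- Two linear maps on step functions agree if they agree on the indicator functions of cubes. -/
lemma StepFun.hom_ext {Y : Type*} [AddCommGroup Y] [Module 𝕜 Y] {L L' : StepFun 𝕜 n →ₗ[𝕜] Y}
    (h : ∀ I : Cube n, L (ind 𝕜 I) = L' (ind 𝕜 I)) : L = L' := by
  refine LinearMap.ext fun f => ?_
  obtain ⟨f, hf⟩ := f
  refine Submodule.span_induction (p := fun f hf => L ⟨f, hf⟩ = L' ⟨f, hf⟩) ?_ ?_ ?_ ?_ hf
  · rintro _ ⟨I, rfl⟩
    exact h I
  · exact (map_zero L).trans (map_zero L').symm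
  · intro f g hf hg h1 h2
    change L ((⟨f, hf⟩ : StepFun 𝕜 n) + ⟨g, hg⟩) = L' ((⟨f, hf⟩ : StepFun 𝕜 n) + ⟨g, hg⟩)
    rw [map_add, map_add, h1, h2]
  · intro c f hf h1
    change L (c • (⟨f, hf⟩ : StepFun 𝕜 n)) = L' (c • (⟨f, hf⟩ : StepFun 𝕜 n))
    rw [map_smul, map_smul, h1]

lemma StepFun.integrable_smul {X : Type*} [NormedAddCommGroup X] [NormedSpace 𝕜 X] (hp : 1 ≤ p)
    (h : Lp X p (volume : Measure (Fin n → ℝ))) (g : StepFun 𝕜 n) :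
    Integrable (fun y => (g : (Fin n → ℝ) → 𝕜) y • h y) volume := by
  obtain ⟨g, hg⟩ := g
  refine Submodule.span_induction (p := fun g _ => Integrable (fun y => g y • h y) volume)
    ?_ ?_ ?_ ?_ hg
  · rintro _ ⟨I, rfl⟩
    have h1 := ind_smul_eq_indicator (𝕜 := 𝕜) I h
    change Integrable (fun y => (ind 𝕜 I : (Fin n → ℝ) → 𝕜) y • h y) volume
    rw [h1, integrable_indicator_iff I.measurableSet_toSet]
    exact integrableOn_cube hp h I
  · simp
  · intro f g _ _ hf hg
    simpa [add_smul] using! hf.add hg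
  · intro c f _ hf
    simpa [mul_smul] using! hf.smul c

variable (𝕜 X p) in
/-- The pairing `∫ g h` of `h ∈ L^p(ℝⁿ; X)` with a step function `g`. -/
noncomputable def pairing (n : ℕ) (hp : 1 ≤ p) :
    Lp X p (volume : Measure (Fin n → ℝ)) →ₗ[𝕜] StepFun 𝕜 n →ₗ[𝕜] X :=
  LinearMap.mk₂ 𝕜 (fun h g => ∫ y, (g : (Fin n → ℝ) → 𝕜) y • h y)
    (fun h h' g => by
      rw [← integral_add (StepFun.integrable_smul hp h g) (StepFun.integrable_smul hp h' g)]
      refine integral_congr_ae ?_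
      filter_upwards [Lp.coeFn_add h h'] with y hy
      rw [hy, Pi.add_apply, smul_add])
    (fun c h g => by
      rw [← integral_smul]
      refine integral_congr_ae ?_
      filter_upwards [Lp.coeFn_smul c h] with y hy
      rw [hy, Pi.smul_apply, smul_comm])
    (fun h g g' => by
      rw [← integral_add (StepFun.integrable_smul hp h g) (StepFun.integrable_smul hp h g')]
      refine integral_congr_ae (Eventually.of_forall fun y => ?_)
      exact add_smul _ _ _)
    (fun c h g => by
      rw [← integral_smul]
      refine integral_congr_ae (Eventually.of_forall fun y => ?_)
      exact mul_smul _ _ _)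

lemma pairing_apply (hp : 1 ≤ p) (h : Lp X p (volume : Measure (Fin n → ℝ))) (g : StepFun 𝕜 n) :
    pairing 𝕜 X p n hp h g = ∫ y, (g : (Fin n → ℝ) → 𝕜) y • h y := rfl

lemma pairing_ind (hp : 1 ≤ p) (h : Lp X p (volume : Measure (Fin n → ℝ))) (I : Cube n) :
    pairing 𝕜 X p n hp h (ind 𝕜 I) = ∫ y in I.toSet, h y := by
  rw [pairing_apply, ind_smul_eq_indicator, integral_indicator I.measurableSet_toSet]

lemma tendsto_pairing [Fact (1 ≤ p)] (hp : 1 ≤ p) {ι : Type*} {l : Filter ι}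
    {h : ι → Lp X p (volume : Measure (Fin n → ℝ))} {h₀ : Lp X p (volume : Measure (Fin n → ℝ))}
    (hh : Tendsto h l (𝓝 h₀)) (I : Cube n) :
    Tendsto (fun i => pairing 𝕜 X p n hp (h i) (ind 𝕜 I)) l
      (𝓝 (pairing 𝕜 X p n hp h₀ (ind 𝕜 I))) := by
  simp only [pairing_ind]
  refine tendsto_integral_of_L1' _ (integrableOn_cube hp h₀ I).aestronglyMeasurable
    (Eventually.of_forall fun i => integrableOn_cube hp (h i) I) ?_
  set V : ℝ≥0∞ := (volume.restrict I.toSet) Set.univ ^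
    (1 / (1 : ℝ≥0∞).toReal - 1 / p.toReal) with hV
  have hVtop : V ≠ ∞ := by
    rw [hV, Measure.restrict_apply_univ]
    refine ENNReal.rpow_ne_top_of_nonneg ?_ I.volume_toSet_ne_top
    rcases eq_or_ne p ∞ with rfl | hp'
    · simp
    · have h1 : 1 ≤ p.toReal := by
        rw [← ENNReal.toReal_one]
        exact ENNReal.toReal_mono hp' hp
      rw [ENNReal.toReal_one, div_one, sub_nonneg]
      exact div_le_one_of_le₀ h1 (by positivity)
  have h2 := ENNReal.Tendsto.mul_const (b := V) ((Lp.tendsto_Lp_iff_tendsto_eLpNorm' _ _).1 hh)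
    (Or.inr hVtop)
  rw [zero_mul] at h2
  refine tendsto_of_tendsto_of_tendsto_of_le_of_le tendsto_const_nhds h2 (fun _ => zero_le)
    fun i => ?_
  have hm : AEStronglyMeasurable (⇑(h i) - ⇑h₀) (volume.restrict I.toSet) :=
    ((Lp.aestronglyMeasurable (h i)).sub (Lp.aestronglyMeasurable h₀)).restrict
  refine (eLpNorm_le_eLpNorm_mul_rpow_measure_univ hp hm).trans ?_
  exact mul_le_mul_left (eLpNorm_restrict_le _ _ _ _) _

end Pairing

/-! ### Approximation of cubes by dyadic cubes -/

section Cubes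

variable {n : ℕ}

/-- A cube with dyadic corner and side, contained in the given cube and close to it. The side is
`2^{-M} (⌊2^M ℓ⌋ - 1)` as soon as this is positive. -/
noncomputable def innerCube (I : Cube n) (M : ℕ) : Cube n :=
  gridCube M (fun i => ⌈2 ^ M * I.corner i⌉) (⌊2 ^ M * I.side⌋₊ - 2 + 1) (Nat.succ_pos _)

lemma innerCube_corner (I : Cube n) (M : ℕ) (i : Fin n) :
    (innerCube I M).corner i = ⌈2 ^ M * I.corner i⌉ / 2 ^ M := rfl

lemma innerCube_side (I : Cube n) (M : ℕ) :
    (innerCube I M).side = ((⌊2 ^ M * I.side⌋₊ - 2 + 1 : ℕ) : ℝ) / 2 ^ M := rfl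

lemma tendsto_const_div_two_pow (c : ℝ) : Tendsto (fun M : ℕ => c / 2 ^ M) atTop (𝓝 0) :=
  tendsto_const_nhds.div_atTop (tendsto_pow_atTop_atTop_of_one_lt one_lt_two)

lemma innerCube_bounds (I : Cube n) : ∀ᶠ M : ℕ in atTop,
    I.side - 2 / 2 ^ M ≤ (innerCube I M).side ∧ (innerCube I M).side ≤ I.side - 1 / 2 ^ M := by
  have h := (tendsto_const_div_two_pow 2).eventually_lt_const I.side_pos
  filter_upwards [h] with M hM
  have h2 : (0 : ℝ) < 2 ^ M := by positivity
  have h0 : 0 ≤ 2 ^ M * I.side := mul_nonneg h2.le I.side_pos.le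
  have h3 : 2 ≤ ⌊2 ^ M * I.side⌋₊ := by
    rw [Nat.le_floor_iff h0]
    rw [div_lt_iff₀ h2] at hM
    push_cast
    linarith
  have h4 := Nat.floor_le h0
  have h5 := Nat.lt_floor_add_one (2 ^ M * I.side)
  have h6 : ((⌊2 ^ M * I.side⌋₊ - 2 + 1 : ℕ) : ℝ) = ⌊2 ^ M * I.side⌋₊ - 1 := by
    rw [Nat.cast_add, Nat.cast_sub h3]
    push_cast
    ring
  have h7 : I.side = 2 ^ M * I.side / 2 ^ M := by field_simp
  rw [innerCube_side, h6]
  constructor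
  · rw [h7, ← sub_div, mul_div_cancel_left₀ _ h2.ne', div_le_div_iff_of_pos_right h2]
    linarith
  · rw [h7, ← sub_div, mul_div_cancel_left₀ _ h2.ne', div_le_div_iff_of_pos_right h2]
    linarith

lemma innerCube_corner_bounds (I : Cube n) (M : ℕ) (i : Fin n) :
    I.corner i ≤ (innerCube I M).corner i ∧
      (innerCube I M).corner i ≤ I.corner i + 1 / 2 ^ M := by
  have h2 : (0 : ℝ) < 2 ^ M := by positivity
  have h4 := Int.le_ceil (2 ^ M * I.corner i)
  have h5 := Int.ceil_lt_add_one (2 ^ M * I.corner i)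
  rw [innerCube_corner]
  constructor
  · rw [le_div_iff₀ h2]
    linarith
  · rw [div_le_iff₀ h2, add_mul, one_div, inv_mul_cancel₀ h2.ne']
    linarith

lemma tendsto_innerCube_side (I : Cube n) :
    Tendsto (fun M => (innerCube I M).side) atTop (𝓝 I.side) := by
  have h1 : Tendsto (fun M : ℕ => I.side - 2 / 2 ^ M) atTop (𝓝 (I.side - 0)) :=
    tendsto_const_nhds.sub (tendsto_const_div_two_pow 2)
  have h2 : Tendsto (fun M : ℕ => I.side - 1 / 2 ^ M) atTop (𝓝 (I.side - 0)) :=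
    tendsto_const_nhds.sub (tendsto_const_div_two_pow 1)
  rw [sub_zero] at h1 h2
  exact tendsto_of_tendsto_of_tendsto_of_le_of_le' h1 h2
    ((innerCube_bounds I).mono fun _ h => h.1) ((innerCube_bounds I).mono fun _ h => h.2)

lemma tendsto_innerCube (I : Cube n) : Tendsto (innerCube I) atTop (𝓝 I) := by
  refine Tendsto.prodMk_nhds (tendsto_pi_nhds.2 fun i => ?_)
    (tendsto_subtype_rng.2 (tendsto_innerCube_side I))
  have h2 : Tendsto (fun M : ℕ => I.corner i + 1 / 2 ^ M) atTop (𝓝 (I.corner i + 0)) :=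
    tendsto_const_nhds.add (tendsto_const_div_two_pow 1)
  rw [add_zero] at h2
  exact tendsto_of_tendsto_of_tendsto_of_le_of_le tendsto_const_nhds h2
    (fun M => (innerCube_corner_bounds I M i).1) fun M => (innerCube_corner_bounds I M i).2

lemma innerCube_subset (I : Cube n) : ∀ᶠ M : ℕ in atTop, (innerCube I M).toSet ⊆ I.toSet := by
  filter_upwards [innerCube_bounds I] with M hM y hy i
  obtain ⟨h1, h2⟩ := hy i
  obtain ⟨h3, h4⟩ := innerCube_corner_bounds I M i
  constructor <;> linarith [hM.2]

lemma tendsto_volume_diff (I : Cube n) :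
    Tendsto (fun M => volume (I.toSet \ (innerCube I M).toSet)) atTop (𝓝 0) := by
  have h1 : Tendsto (fun M => volume I.toSet - volume (innerCube I M).toSet) atTop
      (𝓝 (volume I.toSet - volume I.toSet)) := by
    refine ENNReal.Tendsto.sub tendsto_const_nhds ?_ (Or.inl I.volume_toSet_ne_top)
    simp only [Cube.volume_toSet]
    exact ENNReal.Tendsto.pow (ENNReal.tendsto_ofReal (tendsto_innerCube_side I))
  rw [tsub_self] at h1
  refine h1.congr' ?_
  filter_upwards [innerCube_subset I] with M hM
  exact (measure_sdiff hM (innerCube I M).measurableSet_toSet.nullMeasurableSet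
    (innerCube I M).volume_toSet_ne_top).symm

variable {𝕜 : Type*} [RCLike 𝕜] {X : Type*} [NormedAddCommGroup X] [NormedSpace 𝕜 X]

lemma tensorLp_ind (p : ℝ≥0∞) (I : Cube n) (x : X) : tensorLp p (ind 𝕜 I) x
    = indicatorConstLp p I.measurableSet_toSet I.volume_toSet_ne_top x := by
  rw [tensorLp, indicatorConstLp]
  congr 1
  exact ind_smul_eq_indicator I fun _ => x

lemma tendsto_tensorLp_innerCube {p : ℝ≥0∞} [Fact (1 ≤ p)] (hp : p ≠ ∞) (I : Cube n) (x : X) :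
    Tendsto (fun M => tensorLp p (ind 𝕜 (innerCube I M)) x) atTop
      (𝓝 (tensorLp p (ind 𝕜 I) x)) := by
  simp only [tensorLp_ind]
  refine tendsto_indicatorConstLp_set hp ((tendsto_volume_diff I).congr' ?_)
  filter_upwards [innerCube_subset I] with M hM
  rw [symmDiff_def, sdiff_eq_bot_iff.2 hM, bot_sup_eq]

lemma tendsto_setIntegral_innerCube [NormedSpace ℝ X] {h : (Fin n → ℝ) → X} (I : Cube n)
    (hh : IntegrableOn h I.toSet) :
    Tendsto (fun M => ∫ y in (innerCube I M).toSet, h y) atTop (𝓝 (∫ y in I.toSet, h y)) := by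
  have h1 := ((integrable_indicator_iff I.measurableSet_toSet).2 hh).tendsto_setIntegral_nhds_zero
    (tendsto_volume_diff I)
  have h2 := (tendsto_const_nhds (x := ∫ y in I.toSet, h y)).sub h1
  rw [sub_zero] at h2
  refine h2.congr' ?_
  filter_upwards [innerCube_subset I] with M hM
  have h3 : ∫ y in I.toSet \ (innerCube I M).toSet, I.toSet.indicator h y
      = ∫ y in I.toSet \ (innerCube I M).toSet, h y :=
    setIntegral_congr_fun (I.measurableSet_toSet.diff (innerCube I M).measurableSet_toSet)
      fun y hy => Set.indicator_of_mem hy.1 h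
  rw [h3, setIntegral_sdiff (innerCube I M).measurableSet_toSet hh hM, sub_sub_cancel]

end Cubes

/-! ### From dyadic cells to all cubes -/

section AllCubes

variable {n : ℕ} {𝕜 : Type*} [RCLike 𝕜]

/-- Two bilinear maps that agree on dyadic cells agree on the cubes with dyadic corner and side. -/
lemma gridCube_ext {Y : Type*} [AddCommGroup Y] [Module 𝕜 Y]
    {A B : StepFun 𝕜 n →ₗ[𝕜] StepFun 𝕜 n →ₗ[𝕜] Y}
    (h : ∀ (c : ℕ × (Fin n → ℤ)) M b, A (ind 𝕜 (cell c.1 c.2)) (ind 𝕜 (cell M b))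
      = B (ind 𝕜 (cell c.1 c.2)) (ind 𝕜 (cell M b)))
    (M : ℕ) (z : Fin n → ℤ) (s : ℕ) (hs : 0 < s) (N : ℕ) (w : Fin n → ℤ) (t : ℕ) (ht : 0 < t) :
    A (ind 𝕜 (gridCube M z s hs)) (ind 𝕜 (gridCube N w t ht))
      = B (ind 𝕜 (gridCube M z s hs)) (ind 𝕜 (gridCube N w t ht)) := by
  simp only [ind_gridCube, map_sum, LinearMap.sum_apply]
  exact Finset.sum_congr rfl fun v _ => Finset.sum_congr rfl fun w' _ => h (M, _) N _

variable {X : Type*} [NormedAddCommGroup X] [NormedSpace ℝ X]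
  [NormedSpace 𝕜 X] [IsScalarTower ℝ 𝕜 X]

/-- The limit of the approximations of `T 1_c` represents the functional `T 1_c` on cells. -/
lemma pairing_cell [CompleteSpace X] {p : ℝ≥0∞} (hp1 : 1 ≤ p) {T : StepOperator 𝕜 n}
    {u : ℕ × (Fin n → ℤ) → Lp 𝕜 2 (volume : Measure (Fin n → ℝ))}
    (hu : ∀ c : ℕ × (Fin n → ℤ), Tendsto (fun m =>
      tensorLp 2 (approx (T (ind 𝕜 (cell c.1 c.2))) m) (1 : 𝕜)) atTop (𝓝 (u c)))
    {h : Lp X p (volume : Measure (Fin n → ℝ))} {c : ℕ × (Fin n → ℤ)} {x : X}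
    (hh : h =ᵐ[volume] fun y => u c y • x) (M : ℕ) (b : Fin n → ℤ) :
    pairing 𝕜 X p n hp1 h (ind 𝕜 (cell M b))
      = T (ind 𝕜 (cell c.1 c.2)) (ind 𝕜 (cell M b)) • x := by
  rw [pairing_ind, setIntegral_congr_ae (cell M b).measurableSet_toSet (hh.mono fun _ h _ => h),
    integral_smul_const, ← inner_cell_limit (hu c) M b, tensorLp_ind,
    L2.inner_indicatorConstLp_one]

/-- A bounded operator that represents the pairing on dyadic cells represents it on all step
functions, by the weak continuity of the pairing. -/
lemma isBoundedExtension_of_cells [CompleteSpace X] {p : ℝ≥0∞} [Fact (1 ≤ p)] (hp : p ≠ ∞)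
    {T : StepOperator 𝕜 n} (hT : IsWeaklyContinuous T)
    {S : Lp X p (volume : Measure (Fin n → ℝ)) →L[𝕜] Lp X p (volume : Measure (Fin n → ℝ))}
    (hS : ∀ (c : ℕ × (Fin n → ℤ)) M b x, pairing 𝕜 X p n Fact.out
      (S (tensorLp p (ind 𝕜 (cell c.1 c.2)) x)) (ind 𝕜 (cell M b))
      = T (ind 𝕜 (cell c.1 c.2)) (ind 𝕜 (cell M b)) • x) : IsBoundedExtension T S := by
  have hp1 : 1 ≤ p := Fact.out
  intro f g x
  let A : StepFun 𝕜 n →ₗ[𝕜] StepFun 𝕜 n →ₗ[𝕜] X :=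
    pairing 𝕜 X p n hp1 ∘ₗ S.toLinearMap ∘ₗ tensorLpLinear p x
  let B : StepFun 𝕜 n →ₗ[𝕜] StepFun 𝕜 n →ₗ[𝕜] X :=
    T.compr₂ (LinearMap.toSpanSingleton 𝕜 X x)
  have hA : ∀ f g, A f g = pairing 𝕜 X p n hp1 (S (tensorLp p f x)) g := fun f g => rfl
  have hB : ∀ f g, B f g = T f g • x := fun f g => rfl
  have hgrid := gridCube_ext (A := A) (B := B) fun c M b => hS c M b x
  have hleft : ∀ (I : Cube n) N w t ht,
      A (ind 𝕜 I) (ind 𝕜 (gridCube N w t ht)) = B (ind 𝕜 I) (ind 𝕜 (gridCube N w t ht)) := by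
    intro I N w t ht
    have h1 : Tendsto (fun M => A (ind 𝕜 (innerCube I M)) (ind 𝕜 (gridCube N w t ht))) atTop
        (𝓝 (A (ind 𝕜 I) (ind 𝕜 (gridCube N w t ht)))) :=
      tendsto_pairing hp1 ((S.continuous.tendsto _).comp (tendsto_tensorLp_innerCube hp I x)) _
    have h2 : Tendsto (fun M => B (ind 𝕜 (innerCube I M)) (ind 𝕜 (gridCube N w t ht))) atTop
        (𝓝 (B (ind 𝕜 I) (ind 𝕜 (gridCube N w t ht)))) :=
      (((hT.1 _).tendsto I).comp (tendsto_innerCube I)).smul_const x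
    exact tendsto_nhds_unique (h1.congr fun M => hgrid _ _ _ _ _ _ _ _) h2
  have hall : ∀ I J : Cube n, A (ind 𝕜 I) (ind 𝕜 J) = B (ind 𝕜 I) (ind 𝕜 J) := by
    intro I J
    have h1 : Tendsto (fun M => A (ind 𝕜 I) (ind 𝕜 (innerCube J M))) atTop
        (𝓝 (A (ind 𝕜 I) (ind 𝕜 J))) := by
      simp only [hA, pairing_ind]
      exact tendsto_setIntegral_innerCube J (integrableOn_cube hp1 _ J)
    have h2 : Tendsto (fun M => B (ind 𝕜 I) (ind 𝕜 (innerCube J M))) atTop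
        (𝓝 (B (ind 𝕜 I) (ind 𝕜 J))) :=
      (((hT.2 I).tendsto J).comp (tendsto_innerCube J)).smul_const x
    exact tendsto_nhds_unique (h1.congr fun M => hleft I _ _ _ _) h2
  have hAB : A = B := StepFun.hom_ext fun I => StepFun.hom_ext fun J => hall I J
  exact congr($hAB f g)

/-- The `T(1)` theorem, with the bound in terms of the discrete unconditionality constant. -/
theorem exists_isBoundedExtension [CompleteSpace X] (hn : 0 < n) {T : StepOperator 𝕜 n} {C : ℝ≥0}
    (hc : IsWeaklyContinuous T) (hL : VanishesAtLargeScales T) (h1 : AnnihilatesOne T)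
    (h2 : AdjointAnnihilatesOne T) (hT : HaarCoefficientBound T C)
    {p : ℝ≥0∞} [Fact (1 ≤ p)] (hp : p ≠ ∞) {β : ℝ≥0} (hβ : IsDiscreteBound (Fin n → ℤ) p X β) :
    ∃ S : Lp X p (volume : Measure (Fin n → ℝ)) →L[𝕜] Lp X p (volume : Measure (Fin n → ℝ)),
      IsBoundedExtension T S ∧ ‖S‖ ≤ 32 * 8 ^ n * C * β ^ 2 := by
  choose u hu using exists_tendsto_approx hn hL h1 h2 hT
  obtain ⟨S, hS, hnorm⟩ := exists_extension_cells (X := X) hn hL h1 h2 hT hp hβ hu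
  exact ⟨S, isBoundedExtension_of_cells hp hc fun c M b x =>
    pairing_cell Fact.out hu (hS c x) M b, hnorm⟩

end AllCubes

end HaarT1


theorem mainTheorem2 (n : ℕ) (hn : 0 < n) (C : ℝ≥0) :
    ∃ K : ℝ≥0, ∀ (𝕜 : Type*) [RCLike 𝕜] (X : Type*) [NormedAddCommGroup X] [NormedSpace ℝ X]
      [NormedSpace 𝕜 X] [IsScalarTower ℝ 𝕜 X] [CompleteSpace X] (p : ℝ≥0∞) [Fact (1 ≤ p)]
      (T : HaarT1.StepOperator 𝕜 n),
      HaarT1.IsUMD X → 1 < p → p < ∞ →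
      HaarT1.IsWeaklyContinuous T → HaarT1.VanishesAtLargeScales T →
      HaarT1.AnnihilatesOne T → HaarT1.AdjointAnnihilatesOne T →
      HaarT1.HaarCoefficientBound T C →
      ∃ S : Lp X p (volume : Measure (Fin n → ℝ)) →L[𝕜] Lp X p (volume : Measure (Fin n → ℝ)),
        HaarT1.IsBoundedExtension T S ∧ ‖S‖ₑ ≤ K * HaarT1.umdConst n p X ^ 2 := by
  -- The summand `1` makes the constant positive, so that the bound is void, and not `0`, where
  -- `umdConst n p X = ∞`.
  refine ⟨32 * 8 ^ n * C + 1, ?_⟩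
  intro 𝕜 _ X _ _ _ _ _ p _ T hX hp1 hp hc hL h1 h2 hT
  obtain ⟨β₀, hβ₀⟩ := hX.exists_isDiscreteBound n hp1 hp
  have hβ := HaarT1.isDiscreteBound_umdConst n p X hβ₀
  by_cases htop : HaarT1.umdConst n p X = ∞
  · obtain ⟨S, hS, -⟩ := HaarT1.exists_isBoundedExtension hn hc hL h1 h2 hT hp.ne hβ₀
    refine ⟨S, hS, ?_⟩
    rw [htop, ENNReal.top_pow two_ne_zero, ENNReal.mul_top (by positivity)]
    exact le_top
  · lift HaarT1.umdConst n p X to ℝ≥0 using htop with β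
    obtain ⟨S, hS, hnorm⟩ := HaarT1.exists_isBoundedExtension hn hc hL h1 h2 hT hp.ne hβ
    refine ⟨S, hS, ?_⟩
    have h : ‖S‖₊ ≤ (32 * 8 ^ n * C + 1) * β ^ 2 := by
      rw [← NNReal.coe_le_coe]
      push_cast
      refine hnorm.trans (mul_le_mul_of_nonneg_right ?_ (by positivity))
      linarith
    exact_mod_cast (ENNReal.coe_le_coe.2 h)
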